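/- We work in homotopy type theory (HoTT): dependent type theory with universes $\mathcal U_0:\mathcal U_1:\cdots$, $\Pi$, $\Sigma$, $+$, $\mathbf 0$, $\mathbf 1$, $\mathbf 2$, $\mathbb N$, identity types, function extensionality, univalence, propositional truncation, and the quotient inductive-inductive type $\mathsf{Brw}:\mathcal U_0$ of Brouwer ordinals with its order $\le$. The latter two are generated simultaneously by $\mathsf{zero}$, $\mathsf{suc}$ and limits $\mathsf{lim}\,f$ of sequences $f:\mathbb N\to\mathsf{Brw}$ with $\mathsf{suc}(f_n)\le f_{n+1}$ for all $n$; by the equations $\mathsf{lim}\,f=\mathsf{lim}\,g$ whenever $f$ and $g$ simulate each other ($\forall k.\,\exists n.\,f_k\le g_n$ and $\forall k.\,\exists n.\,g_k\le f_n$); by the set truncation of $\mathsf{Brw}$; and by the rules that $\mathsf{zero}\le x$, that $\le$ is transitive and proposition-valued, that $\mathsf{suc}$ is monotone, that $x\le f_k$ implies $x\le\mathsf{lim}\,f$, and that $\mathsf{lim}\,f\le x$ if $f_k\le x$ for all $k$. Let $\omega^2=\mathsf{lim}_n(\omega\cdot n)$, where $\omega\cdot 0=\mathsf{zero}$ and $\omega\cdot(n+1)=\mathsf{lim}_k(\omega\cdot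 n+k)$. The quantifier $\exists$ and the connective $\lor$ are propositionally truncated. A proposition $P$ is *$\omega^2$-decidable* if $\exists y:\mathsf{Brw}.\,(P\leftrightarrow\omega^2\le y)$, and *semidecidable* if $\exists s:\mathbb N\to\mathbf 2.\,(P\leftrightarrow\exists i.\,s_i=1)$. *Markov's principle* $\mathsf{MP}$ states that every binary sequence $s$ that is not constantly $0$ has an $i$ with $s_i=1$; $\mathsf{LPO}$ states that for every binary sequence $s$ we have $(\exists i.\,s_i=1)\lor(\forall i.\,s_i=0)$; *countable choice* $\mathsf{CC}_j$ states that $(\forall n.\,\|B(n)\|)\to\|\Pi(n:\mathbb N).\,B(n)\|$ for every $B:\mathbb N\to\mathcal U_j$. Let $\mathsf{Collapse}_i$ be the statement that every $\omega^2$-decidable proposition in $\mathcal U_i$ is semidecidable. A *theory* is a collection of closed types that contains every closed type which has a closed term in HoTT and is closed under modus ponens; for instance, the closed types that are inhabited in a given model of HoTT form a theory. **Theorem 8.4.** For every universe level $i$, HoTT proves $\mathsf{Collapse}_i\to(\mathsf{MP}\to\mathsf{LPO})$: if every $\omega^2$-decidable proposition is semidecidable, then Markov's principle implies $\mathsf{LPO}$.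 Consequently, for all levels $i,j$: if a theory (in particular, the theory of some model of HoTT) contains $\mathsf{CC}_j$ and $\mathsf{MP}$ but not $\mathsf{LPO}$, then it does not contain $\mathsf{Collapse}_i$, and HoTT does not prove $\mathsf{CC}_j\to\mathsf{Collapse}_i$. Thus, given such a model, countable choice does not collapse $\omega^2$-decidability to semidecidability. -/

import Mathlib

/-!
# Homotopy type theory as a formal system

The result formalised here is a theorem *of* homotopy type theory: read in a classical
metatheory the principles it speaks about are simply true.  So the formal system is defined
first: dependent type theory with a hierarchy of universes, given (as in the first presentation
of the appendix of the HoTT book) by variables, abstraction, application, and primitive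
constants with their types and defining equations.  The statements in question are closed types
of that system, and to prove one of them is to derive a closed term of it.
-/

namespace HoTT

/-- The primitive constants.  The natural numbers are universe levels. -/
inductive Const : Type
  -- dependent pairs, coproducts, empty type, unit type, booleans, natural numbers
  | sig (i : ℕ) | pair (i : ℕ) | sigInd (i j : ℕ)
  | sum (i : ℕ) | inl (i : ℕ) | inr (i : ℕ) | sumInd (i j : ℕ)
  | empty | emptyInd (j : ℕ)
  | unit | star | unitInd (j : ℕ)
  | bool | ff | tt | boolInd (j : ℕ)
  | nat | zero | succ | natInd (j : ℕ)
  -- identity types, function extensionality, univalence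
  | id (i : ℕ) | refl (i : ℕ) | idInd (i j : ℕ)
  | funext (i : ℕ) | univalence (i : ℕ)
  -- propositional truncation
  | trunc (i : ℕ) | tr (i : ℕ) | squash (i : ℕ) | truncRec (i j : ℕ)
  -- Brouwer ordinals and their order, as a quotient inductive-inductive type
  | brw | le
  | bzero | bsuc | blim | bisim | brwSet
  | leZero | leTrans | leSuc | leCocone | leLimiting | leProp
  | brwInd (j : ℕ) | leInd (j : ℕ)
  deriving DecidableEq

/-- Raw terms (and types), with de Bruijn indices.  In `pi A B` and `lam A b` the second
argument lives in a context extended by a variable of type `A`. -/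
inductive Tm : Type
  | var (n : ℕ)
  | univ (i : ℕ)
  | pi (A B : Tm)
  | lam (A b : Tm)
  | app (f u : Tm)
  | const (c : Const)
  deriving DecidableEq

/-- `lift n c t`: add `n` to the variables of `t` with index at least `c`. -/
def Tm.lift (n : ℕ) : ℕ → Tm → Tm
  | c, .var k => if k < c then .var k else .var (k + n)
  | _, .univ i => .univ i
  | c, .pi A B => .pi (Tm.lift n c A) (Tm.lift n (c + 1) B)
  | c, .lam A b => .lam (Tm.lift n c A) (Tm.lift n (c + 1) b)
  | c, .app f u => .app (Tm.lift n c f) (Tm.lift n c u)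
  | _, .const c => .const c

/-- `subst u k t`: substitute `u` for the variable with index `k` in `t`
and remove that variable from the context. -/
def Tm.subst (u : Tm) : ℕ → Tm → Tm
  | k, .var m => if m < k then .var m else if m = k then u.lift k 0 else .var (m - 1)
  | _, .univ i => .univ i
  | k, .pi A B => .pi (Tm.subst u k A) (Tm.subst u (k + 1) B)
  | k, .lam A b => .lam (Tm.subst u k A) (Tm.subst u (k + 1) b)
  | k, .app f v => .app (Tm.subst u k f) (Tm.subst u k v)
  | _, .const c => .const c

/-- `B.inst u`: replace the last variable of the context of `B` by `u`. -/
def Tm.inst (B u : Tm) : Tm := Tm.subst u 0 B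

/-! ## Writing terms with named binders

An `Exp` gives a raw term for each depth (the number of enclosing binders).
The binders `pi` and `lam` take functions of the bound variable. -/

structure Exp : Type where
  toTm : ℕ → Tm

namespace Exp

def app (f u : Exp) : Exp := ⟨fun d => .app (f.toTm d) (u.toTm d)⟩

instance : CoeFun Exp (fun _ => Exp → Exp) := ⟨app⟩

/-- The closed raw term given by an expression without free variables. -/
def close (e : Exp) : Tm := e.toTm 0

end Exp

/-- The variable bound at depth `d`. -/
def bound (d : ℕ) : Exp := ⟨fun d' => .var (d' - d - 1)⟩

def pi (A : Exp) (B : Exp → Exp) : Exp :=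
  ⟨fun d => .pi (A.toTm d) ((B (bound d)).toTm (d + 1))⟩

def lam (A : Exp) (b : Exp → Exp) : Exp :=
  ⟨fun d => .lam (A.toTm d) ((b (bound d)).toTm (d + 1))⟩

def U (i : ℕ) : Exp := ⟨fun _ => .univ i⟩

def cst (c : Const) : Exp := ⟨fun _ => .const c⟩

/-- Non-dependent function types. -/
def arr (A B : Exp) : Exp := pi A fun _ => B

infixr:25 " ⟶ₜ " => arr

def Sig (i : ℕ) : Exp := cst (.sig i)
def Sum (i : ℕ) : Exp := cst (.sum i)
def Empty : Exp := cst .empty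
def Unit : Exp := cst .unit
def Bool : Exp := cst .bool
def ff : Exp := cst .ff
def tt : Exp := cst .tt
def Nat : Exp := cst .nat
def zero : Exp := cst .zero
def succ : Exp := cst .succ
def Id (i : ℕ) : Exp := cst (.id i)
def Trunc (i : ℕ) : Exp := cst (.trunc i)
def Brw : Exp := cst .brw
def Le : Exp := cst .le
def bzero : Exp := cst .bzero
def bsuc : Exp := cst .bsuc
def blim : Exp := cst .blim

/-! ## Defined notions used in the types of the constants -/

/-- Binary products. -/
def Prod (i : ℕ) (A B : Exp) : Exp := Sig i A (lam A fun _ => B)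

/-- `A` is a (homotopy) proposition. -/
def isProp (i : ℕ) (A : Exp) : Exp := pi A fun x => pi A fun y => Id i A x y

/-- `A` is a (homotopy) set. -/
def isSet (i : ℕ) (A : Exp) : Exp := pi A fun x => pi A fun y => isProp i (Id i A x y)

/-- Truncated existence: `∃ x : A, B x`. -/
def ex (i : ℕ) (A : Exp) (B : Exp → Exp) : Exp := Trunc i (Sig i A (lam A B))

/-- `f : A → B` is an equivalence: it has a left inverse and a right inverse. -/
def isEquiv (i : ℕ) (A B f : Exp) : Exp :=
  Prod i
    (Sig i (B ⟶ₜ A) (lam (B ⟶ₜ A) fun g => pi A fun x => Id i A (g (f x)) x))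
    (Sig i (B ⟶ₜ A) (lam (B ⟶ₜ A) fun h => pi B fun y => Id i B (f (h y)) y))

def Equiv (i : ℕ) (A B : Exp) : Exp :=
  Sig i (A ⟶ₜ B) (lam (A ⟶ₜ B) fun f => isEquiv i A B f)

/-- The identity equivalence of `A`. -/
def idEquiv (i : ℕ) (A : Exp) : Exp :=
  let one := lam A fun x => x
  let inv := cst (.pair i) (A ⟶ₜ A)
    (lam (A ⟶ₜ A) fun g => pi A fun x => Id i A (g x) x)
    one (lam A fun x => cst (.refl i) A x)
  let half := Sig i (A ⟶ₜ A) (lam (A ⟶ₜ A) fun g => pi A fun x => Id i A (g x) x)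
  cst (.pair i) (A ⟶ₜ A) (lam (A ⟶ₜ A) fun f => isEquiv i A A f) one
    (cst (.pair i) half (lam half fun _ => half) inv inv)

/-- The canonical map from `A = B` to `A ≃ B`. -/
def idToEquiv (i : ℕ) (A B : Exp) : Exp :=
  lam (Id (i + 1) (U i) A B) fun p =>
    cst (.idInd (i + 1) (i + 1)) (U i)
      (lam (U i) fun X => lam (U i) fun Y => lam (Id (i + 1) (U i) X Y) fun _ => Equiv i X Y)
      (lam (U i) fun X => idEquiv i X) A B p

/-- The canonical map from `f = g` to `∀ x, f x = g x`. -/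
def happly (i : ℕ) (A B f g : Exp) : Exp :=
  let F := pi A fun x => B x
  lam (Id i F f g) fun p =>
    cst (.idInd i i) F
      (lam F fun f => lam F fun g => lam (Id i F f g) fun _ =>
        pi A fun x => Id i (B x) (f x) (g x))
      (lam F fun f => lam A fun x => cst (.refl i) (B x) (f x)) f g p

/-- Transport of `u : P x` along `p : x = y`. -/
def transport (i j : ℕ) (A P x y p u : Exp) : Exp :=
  cst (.idInd i j) A
    (lam A fun x => lam A fun y => lam (Id i A x y) fun _ => P x ⟶ₜ P y)
    (lam A fun x => lam (P x) fun v => v) x y p u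

/-- The sequence `f` of ordinals is strictly increasing; `x < y` is `bsuc x ≤ y`. -/
def incr (f : Exp) : Exp := pi Nat fun n => Le (bsuc (f n)) (f (succ n))

/-- The sequence `f` is simulated by the sequence `g`. -/
def sim (f g : Exp) : Exp := pi Nat fun k => ex 0 Nat fun n => Le (f k) (g n)

/-! ## Parameters of the eliminators

Each telescope is bound by a quantifier `q`, which is `pi` for types and `lam` for terms. -/

section Telescopes

variable (q : Exp → (Exp → Exp) → Exp)

def sigTele (i j : ℕ) (body : Exp → Exp → Exp → Exp → Exp) : Exp :=
  q (U i) fun A => q (A ⟶ₜ U i) fun B => q (Sig i A B ⟶ₜ U j) fun C =>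
  q (pi A fun a => pi (B a) fun b => C (cst (.pair i) A B a b)) fun g => body A B C g

def sumTele (i j : ℕ) (body : Exp → Exp → Exp → Exp → Exp → Exp) : Exp :=
  q (U i) fun A => q (U i) fun B => q (Sum i A B ⟶ₜ U j) fun C =>
  q (pi A fun a => C (cst (.inl i) A B a)) fun l =>
  q (pi B fun b => C (cst (.inr i) A B b)) fun r => body A B C l r

def unitTele (j : ℕ) (body : Exp → Exp → Exp) : Exp :=
  q (Unit ⟶ₜ U j) fun C => q (C (cst .star)) fun c => body C c

def boolTele (j : ℕ) (body : Exp → Exp → Exp → Exp) : Exp :=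
  q (Bool ⟶ₜ U j) fun C => q (C ff) fun a => q (C tt) fun b => body C a b

def natTele (j : ℕ) (body : Exp → Exp → Exp → Exp) : Exp :=
  q (Nat ⟶ₜ U j) fun C => q (C zero) fun z =>
  q (pi Nat fun n => C n ⟶ₜ C (succ n)) fun s => body C z s

def idTele (i j : ℕ) (body : Exp → Exp → Exp → Exp) : Exp :=
  q (U i) fun A =>
  q (pi A fun x => pi A fun y => Id i A x y ⟶ₜ U j) fun C =>
  q (pi A fun x => C x x (cst (.refl i) A x)) fun c => body A C c

def truncTele (i j : ℕ) (body : Exp → Exp → Exp → Exp → Exp) : Exp :=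
  q (U i) fun A => q (U j) fun B => q (isProp j B) fun h => q (A ⟶ₜ B) fun f => body A B h f

/-- The data for a simultaneous induction on Brouwer ordinals and their order: a family of sets
`A` over the ordinals, a family of propositions `R` over the order, and one method for every
constructor.  The body receives `A`, `R`, the methods for `bzero`, `bsuc` and `blim`, and a
function that applies a given eliminator constant to the whole telescope. -/
def brwTele (j : ℕ) (body : Exp → Exp → Exp → Exp → Exp → (Const → Exp) → Exp) : Exp :=
  q (Brw ⟶ₜ U j) fun A =>
  q (pi Brw fun x => pi Brw fun y => A x ⟶ₜ A y ⟶ₜ Le x y ⟶ₜ U j) fun R =>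
  -- truncation constructors
  q (pi Brw fun x => isSet j (A x)) fun hA =>
  q (pi Brw fun x => pi Brw fun y => pi (A x) fun a => pi (A y) fun b => pi (Le x y) fun e =>
    isProp j (R x y a b e)) fun hR =>
  -- point constructors
  q (A bzero) fun mz =>
  q (pi Brw fun x => A x ⟶ₜ A (bsuc x)) fun ms =>
  q (pi (Nat ⟶ₜ Brw) fun f => pi (incr f) fun p =>
    pi (pi Nat fun n => A (f n)) fun f' =>
    pi (pi Nat fun n => R (bsuc (f n)) (f (succ n)) (ms (f n) (f' n)) (f' (succ n)) (p n))
      fun _ => A (blim f p)) fun ml =>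
  -- bisimilar sequences have equal limits
  q (pi (Nat ⟶ₜ Brw) fun f => pi (incr f) fun p =>
    pi (pi Nat fun n => A (f n)) fun f' =>
    pi (pi Nat fun n => R (bsuc (f n)) (f (succ n)) (ms (f n) (f' n)) (f' (succ n)) (p n))
      fun p' =>
    pi (Nat ⟶ₜ Brw) fun g => pi (incr g) fun r =>
    pi (pi Nat fun n => A (g n)) fun g' =>
    pi (pi Nat fun n => R (bsuc (g n)) (g (succ n)) (ms (g n) (g' n)) (g' (succ n)) (r n))
      fun r' =>
    pi (sim f g) fun u => pi (sim g f) fun v =>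
    pi (pi Nat fun k => ex j Nat fun n =>
      Sig j (Le (f k) (g n)) (lam (Le (f k) (g n)) fun e => R (f k) (g n) (f' k) (g' n) e))
      fun _ =>
    pi (pi Nat fun k => ex j Nat fun n =>
      Sig j (Le (g k) (f n)) (lam (Le (g k) (f n)) fun e => R (g k) (f n) (g' k) (f' n) e))
      fun _ =>
    Id j (A (blim g r))
      (transport 0 j Brw A (blim f p) (blim g r) (cst .bisim f p g r u v) (ml f p f' p'))
      (ml g r g' r')) fun mb =>
  -- constructors of the order
  q (pi Brw fun x => pi (A x) fun a => R bzero x mz a (cst .leZero x)) fun oz =>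
  q (pi Brw fun x => pi Brw fun y => pi Brw fun z =>
    pi (A x) fun a => pi (A y) fun b => pi (A z) fun c =>
    pi (Le x y) fun e => pi (Le y z) fun e' =>
    R x y a b e ⟶ₜ R y z b c e' ⟶ₜ R x z a c (cst .leTrans x y z e e')) fun ot =>
  q (pi Brw fun x => pi Brw fun y => pi (A x) fun a => pi (A y) fun b => pi (Le x y) fun e =>
    R x y a b e ⟶ₜ R (bsuc x) (bsuc y) (ms x a) (ms y b) (cst .leSuc x y e)) fun os =>
  q (pi (Nat ⟶ₜ Brw) fun f => pi (incr f) fun p =>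
    pi (pi Nat fun n => A (f n)) fun f' =>
    pi (pi Nat fun n => R (bsuc (f n)) (f (succ n)) (ms (f n) (f' n)) (f' (succ n)) (p n))
      fun p' =>
    pi Brw fun x => pi (A x) fun a => pi Nat fun k => pi (Le x (f k)) fun e =>
    R x (f k) a (f' k) e ⟶ₜ
      R x (blim f p) a (ml f p f' p') (cst .leCocone f p x k e)) fun oc =>
  q (pi (Nat ⟶ₜ Brw) fun f => pi (incr f) fun p =>
    pi (pi Nat fun n => A (f n)) fun f' =>
    pi (pi Nat fun n => R (bsuc (f n)) (f (succ n)) (ms (f n) (f' n)) (f' (succ n)) (p n))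
      fun p' =>
    pi Brw fun x => pi (A x) fun a => pi (pi Nat fun k => Le (f k) x) fun e =>
    pi (pi Nat fun k => R (f k) x (f' k) a (e k)) fun _ =>
      R (blim f p) x (ml f p f' p') a (cst .leLimiting f p x e)) fun ol =>
  body A R mz ms ml fun c => cst c A R hA hR mz ms ml mb oz ot os oc ol

end Telescopes

/-! ## The types of the constants -/

def Const.type : Const → Exp
  | .sig i => pi (U i) fun A => (A ⟶ₜ U i) ⟶ₜ U i
  | .pair i => pi (U i) fun A => pi (A ⟶ₜ U i) fun B => pi A fun a => B a ⟶ₜ Sig i A B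
  | .sigInd i j => sigTele pi i j fun A B C _ => pi (Sig i A B) fun p => C p
  | .sum i => U i ⟶ₜ U i ⟶ₜ U i
  | .inl i => pi (U i) fun A => pi (U i) fun B => A ⟶ₜ Sum i A B
  | .inr i => pi (U i) fun A => pi (U i) fun B => B ⟶ₜ Sum i A B
  | .sumInd i j => sumTele pi i j fun A B C _ _ => pi (Sum i A B) fun p => C p
  | .empty => U 0
  | .emptyInd j => pi (Empty ⟶ₜ U j) fun C => pi Empty fun x => C x
  | .unit => U 0
  | .star => Unit
  | .unitInd j => unitTele pi j fun C _ => pi Unit fun x => C x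
  | .bool => U 0
  | .ff => Bool
  | .tt => Bool
  | .boolInd j => boolTele pi j fun C _ _ => pi Bool fun x => C x
  | .nat => U 0
  | .zero => Nat
  | .succ => Nat ⟶ₜ Nat
  | .natInd j => natTele pi j fun C _ _ => pi Nat fun n => C n
  | .id i => pi (U i) fun A => A ⟶ₜ A ⟶ₜ U i
  | .refl i => pi (U i) fun A => pi A fun x => Id i A x x
  | .idInd i j => idTele pi i j fun A C _ =>
      pi A fun x => pi A fun y => pi (Id i A x y) fun p => C x y p
  | .funext i => pi (U i) fun A => pi (A ⟶ₜ U i) fun B =>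
      pi (pi A fun x => B x) fun f => pi (pi A fun x => B x) fun g =>
        isEquiv i (Id i (pi A fun x => B x) f g) (pi A fun x => Id i (B x) (f x) (g x))
          (happly i A B f g)
  | .univalence i => pi (U i) fun A => pi (U i) fun B =>
      isEquiv (i + 1) (Id (i + 1) (U i) A B) (Equiv i A B) (idToEquiv i A B)
  | .trunc i => U i ⟶ₜ U i
  | .tr i => pi (U i) fun A => A ⟶ₜ Trunc i A
  | .squash i => pi (U i) fun A => isProp i (Trunc i A)
  | .truncRec i j => truncTele pi i j fun A B _ _ => Trunc i A ⟶ₜ B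
  | .brw => U 0
  | .le => Brw ⟶ₜ Brw ⟶ₜ U 0
  | .bzero => Brw
  | .bsuc => Brw ⟶ₜ Brw
  | .blim => pi (Nat ⟶ₜ Brw) fun f => incr f ⟶ₜ Brw
  | .bisim => pi (Nat ⟶ₜ Brw) fun f => pi (incr f) fun p =>
      pi (Nat ⟶ₜ Brw) fun g => pi (incr g) fun r =>
        sim f g ⟶ₜ sim g f ⟶ₜ Id 0 Brw (HoTT.blim f p) (HoTT.blim g r)
  | .brwSet => isSet 0 Brw
  | .leZero => pi Brw fun x => Le HoTT.bzero x
  | .leTrans => pi Brw fun x => pi Brw fun y => pi Brw fun z =>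
      Le x y ⟶ₜ Le y z ⟶ₜ Le x z
  | .leSuc => pi Brw fun x => pi Brw fun y => Le x y ⟶ₜ Le (HoTT.bsuc x) (HoTT.bsuc y)
  | .leCocone => pi (Nat ⟶ₜ Brw) fun f => pi (incr f) fun p => pi Brw fun x =>
      pi Nat fun k => Le x (f k) ⟶ₜ Le x (HoTT.blim f p)
  | .leLimiting => pi (Nat ⟶ₜ Brw) fun f => pi (incr f) fun p => pi Brw fun x =>
      (pi Nat fun k => Le (f k) x) ⟶ₜ Le (HoTT.blim f p) x
  | .leProp => pi Brw fun x => pi Brw fun y => isProp 0 (Le x y)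
  | .brwInd j => brwTele pi j fun A _ _ _ _ _ => pi Brw fun x => A x
  | .leInd j => brwTele pi j fun _ R _ _ _ ind => pi Brw fun x => pi Brw fun y =>
      pi (Le x y) fun e => R x y (ind (.brwInd j) x) (ind (.brwInd j) y) e

/-! ## The defining equations of the constants -/

/-- Names of the computation rules of the eliminators. -/
inductive Rule : Type
  | sig (i j : ℕ) | inl (i j : ℕ) | inr (i j : ℕ) | unit (j : ℕ) | ff (j : ℕ) | tt (j : ℕ)
  | zero (j : ℕ) | succ (j : ℕ) | refl (i j : ℕ) | tr (i j : ℕ)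
  | bzero (j : ℕ) | bsuc (j : ℕ) | blim (j : ℕ)
  deriving DecidableEq

/-- Every rule is written as `eqn lhs rhs type` below the binders of its variables. -/
def Rule.eqn (q : Exp → (Exp → Exp) → Exp) (eqn : Exp → Exp → Exp → Exp) : Rule → Exp
  | .sig i j => sigTele q i j fun A B C g => q A fun a => q (B a) fun b =>
      eqn (cst (.sigInd i j) A B C g (cst (.pair i) A B a b)) (g a b)
        (C (cst (.pair i) A B a b))
  | .inl i j => sumTele q i j fun A B C l r => q A fun a =>
      eqn (cst (.sumInd i j) A B C l r (cst (.inl i) A B a)) (l a) (C (cst (.inl i) A B a))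
  | .inr i j => sumTele q i j fun A B C l r => q B fun b =>
      eqn (cst (.sumInd i j) A B C l r (cst (.inr i) A B b)) (r b) (C (cst (.inr i) A B b))
  | .unit j => unitTele q j fun C c => eqn (cst (.unitInd j) C c (cst .star)) c (C (cst .star))
  | .ff j => boolTele q j fun C a b => eqn (cst (.boolInd j) C a b HoTT.ff) a (C HoTT.ff)
  | .tt j => boolTele q j fun C a b => eqn (cst (.boolInd j) C a b HoTT.tt) b (C HoTT.tt)
  | .zero j => natTele q j fun C z s =>
      eqn (cst (.natInd j) C z s HoTT.zero) z (C HoTT.zero)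
  | .succ j => natTele q j fun C z s => q Nat fun n =>
      eqn (cst (.natInd j) C z s (HoTT.succ n)) (s n (cst (.natInd j) C z s n))
        (C (HoTT.succ n))
  | .refl i j => idTele q i j fun A C c => q A fun x =>
      eqn (cst (.idInd i j) A C c x x (cst (.refl i) A x)) (c x) (C x x (cst (.refl i) A x))
  | .tr i j => truncTele q i j fun A B h f => q A fun a =>
      eqn (cst (.truncRec i j) A B h f (cst (.tr i) A a)) (f a) B
  | .bzero j => brwTele q j fun A _ mz _ _ ind =>
      eqn (ind (.brwInd j) HoTT.bzero) mz (A HoTT.bzero)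
  | .bsuc j => brwTele q j fun A _ _ ms _ ind => q Brw fun x =>
      eqn (ind (.brwInd j) (HoTT.bsuc x)) (ms x (ind (.brwInd j) x)) (A (HoTT.bsuc x))
  | .blim j => brwTele q j fun A _ _ _ ml ind =>
      q (Nat ⟶ₜ Brw) fun f => q (incr f) fun p =>
      eqn (ind (.brwInd j) (HoTT.blim f p))
        (ml f p (lam Nat fun n => ind (.brwInd j) (f n))
          (lam Nat fun n => ind (.leInd j) (HoTT.bsuc (f n)) (f (HoTT.succ n)) (p n)))
        (A (HoTT.blim f p))

/-- The two sides of a rule, as closed functions of its variables, and their common type. -/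
def Rule.lhs : Rule → Exp := Rule.eqn lam fun l _ _ => l
def Rule.rhs : Rule → Exp := Rule.eqn lam fun _ r _ => r
def Rule.type : Rule → Exp := Rule.eqn pi fun _ _ T => T

/-! ## Derivability -/

/-- `JEq Γ a b A` is the judgment `Γ ⊢ a ≡ b : A`; the judgment `Γ ⊢ a : A` is
`Γ ⊢ a ≡ a : A`.  A context lists the types of its variables, the last one first.  Each congruence
rule contains the corresponding typing rule as its diagonal; `beta` contains the usual β-rule as
the case `A' = A`. -/
inductive JEq : List Tm → Tm → Tm → Tm → Prop
  | symm {Γ a b A} : JEq Γ a b A → JEq Γ b a A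
  | trans {Γ a b c A} : JEq Γ a b A → JEq Γ b c A → JEq Γ a c A
  | conv {Γ a b A B i} : JEq Γ a b A → JEq Γ A B (.univ i) → JEq Γ a b B
  | cumul {Γ A B i} : JEq Γ A B (.univ i) → JEq Γ A B (.univ (i + 1))
  | var {Γ n A} : Γ[n]? = some A → JEq Γ (.var n) (.var n) (A.lift (n + 1) 0)
  | univ {Γ i} : JEq Γ (.univ i) (.univ i) (.univ (i + 1))
  | pi {Γ A A' B B' i} : JEq Γ A A' (.univ i) → JEq (A :: Γ) B B' (.univ i) →
      JEq Γ (.pi A B) (.pi A' B') (.univ i)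
  | lam {Γ A A' b b' B i} : JEq Γ A A' (.univ i) → JEq (A :: Γ) b b' B →
      JEq Γ (.lam A b) (.lam A' b') (.pi A B)
  | app {Γ f f' u u' A B} : JEq Γ f f' (.pi A B) → JEq Γ u u' A →
      JEq Γ (.app f u) (.app f' u') (B.inst u)
  | beta {Γ A A' b u B} : JEq Γ (.lam A b) (.lam A b) (.pi A' B) → JEq Γ u u A' →
      JEq Γ (.app (.lam A b) u) (b.inst u) (B.inst u)
  | eta {Γ f A B} : JEq Γ f f (.pi A B) →
      JEq Γ f (.lam A (.app (f.lift 1 0) (.var 0))) (.pi A B)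
  | const {Γ} (c : Const) : JEq Γ (.const c) (.const c) c.type.close
  | comp {Γ} (r : Rule) : JEq Γ r.lhs.close r.rhs.close r.type.close

/-- `Γ ⊢ a : A`. -/
def HasType (Γ : List Tm) (a A : Tm) : Prop := JEq Γ a a A

/-- The closed type `A` is provable in homotopy type theory: it has a closed term. -/
def Provable (A : Exp) : Prop := ∃ t : Tm, HasType [] t A.close

/-- A theory extending homotopy type theory: a collection of closed types which contains those
that have a closed term and is closed under modus ponens.  The closed types that hold (are
inhabited) in a given model form a theory. -/
structure IsTheory (T : Set Tm) : Prop where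
  of_provable : ∀ A : Tm, (∃ t : Tm, HasType [] t A) → A ∈ T
  mp : ∀ A B : Tm, Tm.pi A (B.lift 1 0) ∈ T → A ∈ T → B ∈ T

/-! ## The ordinal `ω²` -/

def fst (i : ℕ) (A B p : Exp) : Exp :=
  cst (.sigInd i i) A B (lam (Sig i A B) fun _ => A) (lam A fun a => lam (B a) fun _ => a) p

def snd (i : ℕ) (A B p : Exp) : Exp :=
  cst (.sigInd i i) A B (lam (Sig i A B) fun p => B (fst i A B p))
    (lam A fun a => lam (B a) fun b => b) p

/-- `x + k` for a natural number `k`. -/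
def addNat (x k : Exp) : Exp :=
  cst (.natInd 0) (lam Nat fun _ => Brw) x (lam Nat fun _ => lam Brw fun y => bsuc y) k

/-- From `r : x ≤ x`, a proof of `x + k ≤ x + k`. -/
def addNatRefl (x r k : Exp) : Exp :=
  cst (.natInd 0) (lam Nat fun k => Le (addNat x k) (addNat x k)) r
    (lam Nat fun k => lam (Le (addNat x k) (addNat x k)) fun h =>
      cst .leSuc (addNat x k) (addNat x k) h) k

/-- The sequence `k ↦ x + k`. -/
def addSeq (x : Exp) : Exp := lam Nat fun k => addNat x k

/-- `k ↦ x + k` is strictly increasing, given `r : x ≤ x`. -/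
def addSeqIncr (x r : Exp) : Exp := lam Nat fun k => addNatRefl x r (succ k)

/-- `x + ω`, the limit of `x + k`. -/
def addOmega (x r : Exp) : Exp := blim (addSeq x) (addSeqIncr x r)

/-- `x + ω ≤ x + ω`. -/
def addOmegaRefl (x r : Exp) : Exp :=
  cst .leLimiting (addSeq x) (addSeqIncr x r) (addOmega x r)
    (lam Nat fun k =>
      cst .leCocone (addSeq x) (addSeqIncr x r) (addNat x k) k (addNatRefl x r k))

def leDiag : Exp := lam Brw fun x => Le x x

/-- `ω · n` together with a proof of `ω · n ≤ ω · n`: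
`ω · 0 = 0` and `ω · (n + 1) = ω · n + ω`. -/
def omegaMulAux (n : Exp) : Exp :=
  cst (.natInd 0) (lam Nat fun _ => Sig 0 Brw leDiag)
    (cst (.pair 0) Brw leDiag bzero (cst .leZero bzero))
    (lam Nat fun _ => lam (Sig 0 Brw leDiag) fun z =>
      cst (.pair 0) Brw leDiag
        (addOmega (fst 0 Brw leDiag z) (snd 0 Brw leDiag z))
        (addOmegaRefl (fst 0 Brw leDiag z) (snd 0 Brw leDiag z))) n

/-- `ω · n` for a natural number `n`. -/
def omegaMul (n : Exp) : Exp := fst 0 Brw leDiag (omegaMulAux n)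

/-- `ω · n + 1 ≤ ω · n + ω`. -/
def omegaMulIncr : Exp :=
  lam Nat fun n =>
    let x := omegaMul n
    let r := snd 0 Brw leDiag (omegaMulAux n)
    cst .leCocone (addSeq x) (addSeqIncr x r) (bsuc x) (succ zero) (addNatRefl x r (succ zero))

/-- `ω²`, the limit of `ω · n`. -/
def omegaSq : Exp := blim (lam Nat fun n => omegaMul n) omegaMulIncr

/-! ## Decidability notions and principles -/

/-- `A ↔ B`. -/
def iff (i : ℕ) (A B : Exp) : Exp := Prod i (A ⟶ₜ B) (B ⟶ₜ A)

/-- `P` is `α`-decidable: `∃ y : Brw, P ↔ α ≤ y`. -/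
def ordDec (i : ℕ) (α P : Exp) : Exp := ex i Brw fun y => iff i P (Le α y)

/-- `∃ n, s n = 1` for a binary sequence `s`. -/
def hasOne (s : Exp) : Exp := ex 0 Nat fun n => Id 0 Bool (s n) tt

/-- `∀ n, s n = 0` for a binary sequence `s`. -/
def allZero (s : Exp) : Exp := pi Nat fun n => Id 0 Bool (s n) ff

/-- `P` is semidecidable: `∃ s : ℕ → 2, P ↔ ∃ n, s n = 1`. -/
def semiDec (i : ℕ) (P : Exp) : Exp := ex i (Nat ⟶ₜ Bool) fun s => iff i P (hasOne s)

/-- Every `ω²`-decidable proposition (in the universe `U i`) is semidecidable. -/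
def collapse (i : ℕ) : Exp :=
  pi (U i) fun P => isProp i P ⟶ₜ ordDec i omegaSq P ⟶ₜ semiDec i P

/-- Markov's principle: a binary sequence that is not constantly `0` has a digit `1`. -/
def MP : Exp := pi (Nat ⟶ₜ Bool) fun s => (allZero s ⟶ₜ Empty) ⟶ₜ hasOne s

/-- The limited principle of omniscience: a binary sequence has a digit `1` or is
constantly `0` (with the truncated disjunction). -/
def LPO : Exp := pi (Nat ⟶ₜ Bool) fun s => Trunc 0 (Sum 0 (hasOne s) (allZero s))

/-- Countable choice for families of types in the universe `U j`. -/
def CC (j : ℕ) : Exp :=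
  pi (Nat ⟶ₜ U j) fun B => (pi Nat fun n => Trunc j (B n)) ⟶ₜ Trunc j (pi Nat fun n => B n)

end HoTT

namespace HoTT

/-! ## A verified type checker -/

/-! Functions on raw terms, defined directly by the recursor so that they evaluate fast.
Substitution is in continuation passing style: evaluating it yields a term that consists of
constructors only, which is then passed on. -/

/-- Case distinction that tells apart any two constants. -/
def Const.elim {α : Type} (K : ℕ → ℕ → ℕ → α) : Const → α
  | .sig i => K 0 i 0
  | .pair i => K 1 i 0
  | .sigInd i j => K 2 i j
  | .sum i => K 3 i 0
  | .inl i => K 4 i 0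
  | .inr i => K 5 i 0
  | .sumInd i j => K 6 i j
  | .empty => K 7 0 0
  | .emptyInd i => K 8 i 0
  | .unit => K 9 0 0
  | .star => K 10 0 0
  | .unitInd i => K 11 i 0
  | .bool => K 12 0 0
  | .ff => K 13 0 0
  | .tt => K 14 0 0
  | .boolInd i => K 15 i 0
  | .nat => K 16 0 0
  | .zero => K 17 0 0
  | .succ => K 18 0 0
  | .natInd i => K 19 i 0
  | .id i => K 20 i 0
  | .refl i => K 21 i 0
  | .idInd i j => K 22 i j
  | .funext i => K 23 i 0
  | .univalence i => K 24 i 0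
  | .trunc i => K 25 i 0
  | .tr i => K 26 i 0
  | .squash i => K 27 i 0
  | .truncRec i j => K 28 i j
  | .brw => K 29 0 0
  | .le => K 30 0 0
  | .bzero => K 31 0 0
  | .bsuc => K 32 0 0
  | .blim => K 33 0 0
  | .bisim => K 34 0 0
  | .brwSet => K 35 0 0
  | .leZero => K 36 0 0
  | .leTrans => K 37 0 0
  | .leSuc => K 38 0 0
  | .leCocone => K 39 0 0
  | .leLimiting => K 40 0 0
  | .leProp => K 41 0 0
  | .brwInd i => K 42 i 0
  | .leInd i => K 43 i 0

def Const.same (c c' : Const) : _root_.Bool :=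
  c.elim fun k i j => c'.elim fun k' i' j' =>
    _root_.Nat.beq k k' && (_root_.Nat.beq i i' && _root_.Nat.beq j j')

/-- A left inverse of `Const.elim`. -/
def Const.ofCode (i j : ℕ) (k : ℕ) : Const :=
  [.sig i, .pair i, .sigInd i j, .sum i, .inl i, .inr i, .sumInd i j, .empty, .emptyInd i, .unit,
   .star, .unitInd i, .bool, .ff, .tt, .boolInd i, .nat, .zero, .succ, .natInd i, .id i, .refl i,
   .idInd i j, .funext i, .univalence i, .trunc i, .tr i, .squash i, .truncRec i j, .brw, .le,
   .bzero, .bsuc, .blim, .bisim, .brwSet, .leZero, .leTrans, .leSuc, .leCocone, .leLimiting,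
   .leProp, .brwInd i, .leInd i].getD k .nat

theorem Const.ofCode_elim (c : Const) : c.elim (fun k i j => Const.ofCode i j k) = c := by
  cases c <;> rfl

theorem Const.elim_eq {α : Type} (K : ℕ → ℕ → ℕ → α) (c : Const) :
    c.elim K = K (c.elim fun k _ _ => k) (c.elim fun _ i _ => i) (c.elim fun _ _ j => j) := by
  cases c <;> rfl

theorem Const.eq_of_same {c c' : Const} (h : c.same c' = true) : c = c' := by
  rw [Const.same, Const.elim_eq, Const.elim_eq] at h
  simp only [Bool.and_eq_true, _root_.Nat.beq_eq] at h
  rw [← c.ofCode_elim, ← c'.ofCode_elim, Const.elim_eq, Const.elim_eq _ c', h.1, h.2.1, h.2.2]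

/-- Syntactic equality of raw terms, as a Boolean. -/
noncomputable def Tm.same (t : Tm) : Tm → _root_.Bool :=
  Tm.rec (motive := fun _ => Tm → _root_.Bool)
    (fun m t => Tm.rec (motive := fun _ => _root_.Bool) (fun n => _root_.Nat.beq m n)
      (fun _ => false) (fun _ _ _ _ => false) (fun _ _ _ _ => false) (fun _ _ _ _ => false)
      (fun _ => false) t)
    (fun i t => Tm.rec (motive := fun _ => _root_.Bool) (fun _ => false)
      (fun j => _root_.Nat.beq i j) (fun _ _ _ _ => false) (fun _ _ _ _ => false)
      (fun _ _ _ _ => false) (fun _ => false) t)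
    (fun _ _ sA sB t => Tm.rec (motive := fun _ => _root_.Bool) (fun _ => false) (fun _ => false)
      (fun A B _ _ => Bool.rec false (sA A) (sB B)) (fun _ _ _ _ => false) (fun _ _ _ _ => false)
      (fun _ => false) t)
    (fun _ _ sA sb t => Tm.rec (motive := fun _ => _root_.Bool) (fun _ => false) (fun _ => false)
      (fun _ _ _ _ => false) (fun A b _ _ => Bool.rec false (sA A) (sb b)) (fun _ _ _ _ => false)
      (fun _ => false) t)
    (fun _ _ sf su t => Tm.rec (motive := fun _ => _root_.Bool) (fun _ => false) (fun _ => false)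
      (fun _ _ _ _ => false) (fun _ _ _ _ => false) (fun f u _ _ => Bool.rec false (sf f) (su u))
      (fun _ => false) t)
    (fun c t => Tm.rec (motive := fun _ => _root_.Bool) (fun _ => false) (fun _ => false)
      (fun _ _ _ _ => false) (fun _ _ _ _ => false) (fun _ _ _ _ => false)
      (fun c' => c.same c') t) t

theorem Tm.eq_of_same {a : Tm} : ∀ {b : Tm}, a.same b = true → a = b := by
  have and_of : ∀ {x y : _root_.Bool}, (Bool.rec false x y : _root_.Bool) = true →
      x = true ∧ y = true := by
    intro x y; cases x <;> cases y <;> simp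
  induction a with
  | var m => intro b h; cases b <;> first
      | cases h
      | exact congrArg _ (_root_.Nat.eq_of_beq_eq_true h)
  | univ m => intro b h; cases b <;> first
      | cases h
      | exact congrArg _ (_root_.Nat.eq_of_beq_eq_true h)
  | const c => intro b h; cases b <;> first | cases h | exact congrArg _ (Const.eq_of_same h)
  | _ _ _ ih ih' =>
    intro b h
    cases b <;> first
      | cases h
      | (obtain ⟨h1, h2⟩ := and_of h; rw [ih h1, ih' h2])

theorem JEq.left {Γ a b A} (h : JEq Γ a b A) : JEq Γ a a A := h.trans h.symm

theorem JEq.right {Γ a b A} (h : JEq Γ a b A) : JEq Γ b b A := h.symm.trans h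

theorem JEq.cumul_le {Γ A B i j} (hij : i ≤ j) (h : JEq Γ A B (.univ i)) :
    JEq Γ A B (.univ j) := by
  induction hij with
  | refl => exact h
  | step _ ih => exact ih.cumul

theorem JEq.weaken {Γ a b A} (h : JEq Γ a b A) (Δ : List Tm) : JEq (Γ ++ Δ) a b A := by
  induction h with
  | symm _ ih => exact ih.symm
  | trans _ _ ih ih' => exact ih.trans ih'
  | conv _ _ ih ih' => exact ih.conv ih'
  | cumul _ ih => exact ih.cumul
  | var h =>
    obtain ⟨hlt, _⟩ := List.getElem?_eq_some_iff.1 h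
    exact .var (by rwa [List.getElem?_append_left hlt])
  | univ => exact .univ
  | pi _ _ ih ih' => exact ih.pi ih'
  | lam _ _ ih ih' => exact ih.lam ih'
  | app _ _ ih ih' => exact ih.app ih'
  | beta _ _ ih ih' => exact ih.beta ih'
  | eta _ ih => exact ih.eta
  | const c => exact .const c
  | comp r => exact .comp r

/-! ## Raising universe levels

Derivations can be transported along the map on levels that fixes `0` and `1` and adds `m` to all
other levels, except that univalence has to be restricted to level `0`. -/

def raiseLevel (m : ℕ) : ℕ → ℕ
  | 0 => 0
  | 1 => 1
  | i + 2 => m + (i + 2)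

theorem raiseLevel_mono (m : ℕ) {i j : ℕ} (h : i ≤ j) : raiseLevel m i ≤ raiseLevel m j := by
  unfold raiseLevel
  split <;> split <;> omega

theorem raiseLevel_succ_le (m i : ℕ) : raiseLevel m i + 1 ≤ raiseLevel m (i + 1) := by
  rcases i with _ | _ | i <;> simp only [raiseLevel] <;> omega

theorem raiseLevel_zero : ∀ i, raiseLevel 0 i = i
  | 0 => rfl
  | 1 => rfl
  | _ + 2 => _root_.Nat.zero_add _

def Const.raise (m : ℕ) (c : Const) : Const :=
  c.elim fun k i j => .ofCode (raiseLevel m i) (raiseLevel m j) k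

def Tm.raise (m : ℕ) : Tm → Tm
  | .var n => .var n
  | .univ i => .univ (raiseLevel m i)
  | .pi A B => .pi (A.raise m) (B.raise m)
  | .lam A b => .lam (A.raise m) (b.raise m)
  | .app f u => .app (f.raise m) (u.raise m)
  | .const c => .const (c.raise m)

def Rule.raise (m : ℕ) : Rule → Rule
  | .sig i j => .sig (raiseLevel m i) (raiseLevel m j)
  | .inl i j => .inl (raiseLevel m i) (raiseLevel m j)
  | .inr i j => .inr (raiseLevel m i) (raiseLevel m j)
  | .unit j => .unit (raiseLevel m j)
  | .ff j => .ff (raiseLevel m j)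
  | .tt j => .tt (raiseLevel m j)
  | .zero j => .zero (raiseLevel m j)
  | .succ j => .succ (raiseLevel m j)
  | .refl i j => .refl (raiseLevel m i) (raiseLevel m j)
  | .tr i j => .tr (raiseLevel m i) (raiseLevel m j)
  | .bzero j => .bzero (raiseLevel m j)
  | .bsuc j => .bsuc (raiseLevel m j)
  | .blim j => .blim (raiseLevel m j)

theorem Tm.raise_zero (t : Tm) : t.raise 0 = t := by
  induction t with
  | const c =>
    simp only [Tm.raise, Const.raise, raiseLevel_zero]
    exact congrArg _ c.ofCode_elim
  | _ => simp_all [Tm.raise, raiseLevel_zero]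

theorem Tm.raise_lift (m n : ℕ) (t : Tm) : ∀ c, (t.lift n c).raise m = (t.raise m).lift n c := by
  induction t with
  | var k => intro c; simp only [Tm.lift, Tm.raise]; split <;> rfl
  | _ => simp_all [Tm.lift, Tm.raise]

theorem Tm.raise_subst (m : ℕ) (u t : Tm) :
    ∀ k, (Tm.subst u k t).raise m = Tm.subst (u.raise m) k (t.raise m) := by
  induction t with
  | var n =>
    intro k
    simp only [Tm.subst, Tm.raise]
    split
    · rfl
    · split
      · exact Tm.raise_lift ..
      · rfl
  | _ => simp_all [Tm.subst, Tm.raise]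

theorem Tm.raise_inst (m : ℕ) (B u : Tm) : (B.inst u).raise m = (B.raise m).inst (u.raise m) :=
  Tm.raise_subst ..

/-- Univalence for universes other than `U 0`. -/
def Const.isHighUnivalence : Const → _root_.Bool
  | .univalence (_ + 1) => true
  | _ => false

theorem Const.raise_type (m : ℕ) (c : Const) (hc : c.isHighUnivalence = false) :
    c.type.close.raise m = (c.raise m).type.close := by
  cases c with
  | univalence i =>
    cases i with
    | zero => rfl
    | succ i => cases hc
  | _ => rfl

theorem Rule.raise_lhs (m : ℕ) (r : Rule) : r.lhs.close.raise m = (r.raise m).lhs.close := by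
  cases r <;> rfl

theorem Rule.raise_rhs (m : ℕ) (r : Rule) : r.rhs.close.raise m = (r.raise m).rhs.close := by
  cases r <;> rfl

theorem Rule.raise_type (m : ℕ) (r : Rule) : r.type.close.raise m = (r.raise m).type.close := by
  cases r <;> rfl

/-- Derivability after raising the levels by `m`. -/
def JEqAt (m : ℕ) (Γ : List Tm) (a b A : Tm) : Prop :=
  JEq (Γ.map (Tm.raise m)) (a.raise m) (b.raise m) (A.raise m)

theorem jeqAt_zero {Γ a b A} : JEqAt 0 Γ a b A ↔ JEq Γ a b A := by
  have : Tm.raise 0 = id := funext Tm.raise_zero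
  simp only [JEqAt, this, List.map_id, id]

namespace JEqAt

variable {m : ℕ}

theorem symm {Γ a b A} (h : JEqAt m Γ a b A) : JEqAt m Γ b a A := JEq.symm h

theorem trans {Γ a b c A} (h : JEqAt m Γ a b A) (h' : JEqAt m Γ b c A) : JEqAt m Γ a c A :=
  JEq.trans h h'

theorem left {Γ a b A} (h : JEqAt m Γ a b A) : JEqAt m Γ a a A := h.trans h.symm

theorem right {Γ a b A} (h : JEqAt m Γ a b A) : JEqAt m Γ b b A := h.symm.trans h

theorem conv {Γ a b A B i} (h : JEqAt m Γ a b A) (h' : JEqAt m Γ A B (.univ i)) :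
    JEqAt m Γ a b B :=
  JEq.conv h h'

theorem cumul_le {Γ A B i j} (hij : i ≤ j) (h : JEqAt m Γ A B (.univ i)) :
    JEqAt m Γ A B (.univ j) :=
  JEq.cumul_le (raiseLevel_mono m hij) h

theorem var {Γ n A} (h : Γ[n]? = some A) : JEqAt m Γ (.var n) (.var n) (A.lift (n + 1) 0) := by
  unfold JEqAt
  rw [Tm.raise_lift]
  exact .var (by rw [List.getElem?_map, h]; rfl)

theorem univ {Γ i} : JEqAt m Γ (.univ i) (.univ i) (.univ (i + 1)) :=
  JEq.cumul_le (raiseLevel_succ_le m i) .univ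

theorem pi {Γ A A' B B' i} (h : JEqAt m Γ A A' (.univ i)) (h' : JEqAt m (A :: Γ) B B' (.univ i)) :
    JEqAt m Γ (.pi A B) (.pi A' B') (.univ i) :=
  JEq.pi h h'

theorem lam {Γ A A' b b' B i} (h : JEqAt m Γ A A' (.univ i)) (h' : JEqAt m (A :: Γ) b b' B) :
    JEqAt m Γ (.lam A b) (.lam A' b') (.pi A B) :=
  JEq.lam h h'

theorem app {Γ f f' u u' A B} (h : JEqAt m Γ f f' (.pi A B)) (h' : JEqAt m Γ u u' A) :
    JEqAt m Γ (.app f u) (.app f' u') (B.inst u) := by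
  unfold JEqAt
  rw [Tm.raise_inst]
  exact JEq.app h h'

theorem beta {Γ A A' b u B} (h : JEqAt m Γ (.lam A b) (.lam A b) (.pi A' B))
    (h' : JEqAt m Γ u u A') : JEqAt m Γ (.app (.lam A b) u) (b.inst u) (B.inst u) := by
  unfold JEqAt
  rw [Tm.raise_inst, Tm.raise_inst]
  exact JEq.beta h h'

theorem const {Γ} (c : Const) (hc : c.isHighUnivalence = false) :
    JEqAt m Γ (.const c) (.const c) c.type.close := by
  unfold JEqAt
  rw [Const.raise_type m c hc]
  exact .const _

theorem comp {Γ} (r : Rule) : JEqAt m Γ r.lhs.close r.rhs.close r.type.close := by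
  unfold JEqAt
  rw [Rule.raise_lhs, Rule.raise_rhs, Rule.raise_type]
  exact .comp _

theorem weaken {Γ a b A} (h : JEqAt m Γ a b A) (Δ : List Tm) : JEqAt m (Γ ++ Δ) a b A := by
  unfold JEqAt
  rw [List.map_append]
  exact JEq.weaken h _

end JEqAt

/-- The type that a table of typed terms gives to a term. -/
noncomputable def lookup (t : Tm) : List (Tm × Tm) → Option Tm
  | [] => none
  | (u, A) :: l => bif u.same t then some A else lookup t l

/-- A table of closed terms and their types. -/
def TypeTable (m : ℕ) (l : List (Tm × Tm)) : Prop := ∀ p ∈ l, JEqAt m [] p.1 p.1 p.2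

theorem TypeTable.lookup {m : ℕ} {l : List (Tm × Tm)} (hl : TypeTable m l) {Γ t A}
    (h : lookup t l = some A) : JEqAt m Γ t t A := by
  induction l with
  | nil => cases h
  | cons p l ih =>
    obtain ⟨u, B⟩ := p
    unfold HoTT.lookup at h
    cases hu : u.same t <;> rw [hu] at h
    · exact ih (fun p hp => hl p (List.mem_cons_of_mem _ hp)) h
    · cases h
      rw [← Tm.eq_of_same hu]
      exact (hl (u, A) List.mem_cons_self).weaken Γ

section Continuations

variable {α : Type}

/-- Pass a term on.  Unfolding this definition bounds the recursion depth of evaluation. -/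
def Tm.pass (K : Tm → α) (t : Tm) : α := K t

noncomputable def Tm.liftK (n : ℕ) (t : Tm) : ℕ → (Tm → α) → α :=
  Tm.rec (motive := fun _ => ℕ → (Tm → α) → α)
    (fun k c K => Bool.rec (Tm.pass K (.var k)) (Tm.pass K (.var (k + n))) (_root_.Nat.ble c k))
    (fun i _ K => Tm.pass K (.univ i))
    (fun _ _ lA lB c K => lA c fun A => lB c.succ fun B => Tm.pass K (.pi A B))
    (fun _ _ lA lb c K => lA c fun A => lb c.succ fun b => Tm.pass K (.lam A b))
    (fun _ _ lf lu c K => lf c fun f => lu c fun u => Tm.pass K (.app f u))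
    (fun x _ K => Tm.pass K (.const x)) t

noncomputable def Tm.substK (u t : Tm) : ℕ → (Tm → α) → α :=
  Tm.rec (motive := fun _ => ℕ → (Tm → α) → α)
    (fun m k K => Bool.rec
      (Bool.rec (Tm.pass K (.var m)) (Tm.pass K (.var (m - 1))) (_root_.Nat.ble k m))
      (u.liftK k 0 K) (_root_.Nat.beq m k))
    (fun i _ K => Tm.pass K (.univ i))
    (fun _ _ sA sB k K => sA k fun A => sB k.succ fun B => Tm.pass K (.pi A B))
    (fun _ _ sA sb k K => sA k fun A => sb k.succ fun b => Tm.pass K (.lam A b))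
    (fun _ _ sf su k K => sf k fun f => su k fun u => Tm.pass K (.app f u))
    (fun x _ K => Tm.pass K (.const x)) t

noncomputable def Tm.force (t : Tm) : (Tm → α) → α :=
  Tm.rec (motive := fun _ => (Tm → α) → α)
    (fun k K => Tm.pass K (.var k))
    (fun i K => Tm.pass K (.univ i))
    (fun _ _ hA hB K => hA fun A => hB fun B => Tm.pass K (.pi A B))
    (fun _ _ hA hb K => hA fun A => hb fun b => Tm.pass K (.lam A b))
    (fun _ _ hf hu K => hf fun f => hu fun u => Tm.pass K (.app f u))
    (fun x K => Tm.pass K (.const x)) t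

@[simp] theorem Tm.liftK_eq (n : ℕ) (t : Tm) : ∀ (c : ℕ) (K : Tm → α),
    t.liftK n c K = K (t.lift n c) := by
  induction t with
  | var k =>
    intro c K
    rcases lt_or_ge k c with h | h
    · have : _root_.Nat.ble c k = false := by
        rw [← Bool.not_eq_true, _root_.Nat.ble_eq]; omega
      simp [Tm.liftK, Tm.pass, Tm.lift, this, h]
    · have : _root_.Nat.ble c k = true := by rw [_root_.Nat.ble_eq]; exact h
      simp [Tm.liftK, Tm.pass, Tm.lift, this, _root_.not_lt.2 h]
  | _ => simp_all [Tm.liftK, Tm.pass, Tm.lift]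

@[simp] theorem Tm.substK_eq (u t : Tm) : ∀ (k : ℕ) (K : Tm → α),
    Tm.substK u t k K = K (Tm.subst u k t) := by
  induction t with
  | var m =>
    intro k K
    rcases lt_trichotomy m k with h | h | h
    · have h1 : _root_.Nat.beq m k = false := by
        rw [← Bool.not_eq_true, _root_.Nat.beq_eq]; omega
      have h2 : _root_.Nat.ble k m = false := by
        rw [← Bool.not_eq_true, _root_.Nat.ble_eq]; omega
      simp [Tm.substK, Tm.pass, Tm.subst, h1, h2, h]
    · subst h
      simp [Tm.substK, Tm.pass, Tm.subst]
    · have h1 : _root_.Nat.beq m k = false := by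
        rw [← Bool.not_eq_true, _root_.Nat.beq_eq]; omega
      have h2 : _root_.Nat.ble k m = true := by
        rw [_root_.Nat.ble_eq]; exact h.le
      simp [Tm.substK, Tm.pass, Tm.subst, h1, h2, h.not_gt, h.ne']
  | _ => simp_all [Tm.substK, Tm.pass, Tm.subst]

@[simp] theorem Tm.force_eq (t : Tm) : ∀ K : Tm → α, t.force K = K t := by
  induction t <;> simp_all [Tm.force, Tm.pass]

end Continuations

/-- The mutually recursive functions of the checker: inferring and checking types, weak head
normal forms, and equality.  The closed terms of the table are not inspected. -/
structure Checker where
  table : List (Tm × Tm)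
  infer : List Tm → Tm → Option Tm
  check : List Tm → Tm → Tm → _root_.Bool
  whnf : List Tm → Tm → Option (Tm × Tm)
  eq : List Tm → Tm → Tm → Option Tm
  eqAt : List Tm → Tm → Tm → Tm → _root_.Bool

structure Checker.Sound (m : ℕ) (K : Checker) : Prop where
  table : TypeTable m K.table
  infer : ∀ {Γ t A}, K.infer Γ t = some A → JEqAt m Γ t t A
  check : ∀ {Γ t A}, K.check Γ t A = true → JEqAt m Γ t t A
  whnf : ∀ {Γ t t' A}, K.whnf Γ t = some (t', A) → JEqAt m Γ t t' A
  eq : ∀ {Γ a b A}, K.eq Γ a b = some A → JEqAt m Γ a b A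
  eqAt : ∀ {Γ a b A}, K.eqAt Γ a b A = true → JEqAt m Γ a b A

namespace Checker

variable (K : Checker) (Γ : List Tm)

/-- The level of a term that is a universe up to conversion. -/
noncomputable def level : Tm → Option ℕ
  | .univ i => some i
  | S => (K.whnf Γ S).bind fun
    | (.univ i, .univ _) => some i
    | _ => none

/-- The universe level of a type. -/
noncomputable def sort (A : Tm) : Option ℕ := (K.infer Γ A).bind fun S => level K Γ S

/-- The domain and the codomain of a function type. -/
noncomputable def asPi : Tm → Option (Tm × Tm)
  | .pi A B => some (A, B)
  | T => (K.whnf Γ T).bind fun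
    | (.pi A B, S) => (level K Γ S).bind fun _ => some (A, B)
    | _ => none

/-- The level at which two types are equal. -/
noncomputable def eqSort (A B : Tm) : Option ℕ := (K.eq Γ A B).bind fun S => level K Γ S

/-- Inclusion of universes. -/
def leLevel : Option ℕ → Option ℕ → _root_.Bool
  | some i, some j => _root_.Nat.ble i j
  | _, _ => false

/-- Inclusion of types. -/
noncomputable def conv (A B : Tm) : _root_.Bool :=
  A.same B || match A, B with
    | .univ i, B => leLevel (some i) (level K Γ B)
    | A, .univ j => leLevel (level K Γ A) (some j)
    | A, B => (eqSort K Γ A B).isSome || leLevel (level K Γ A) (level K Γ B)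
/-- Head reduction of an abstraction applied to arguments. -/
noncomputable def headBeta (t : Tm) : Option (Tm × Tm) :=
  Tm.rec (motive := fun _ => Option (Tm × Tm)) (fun _ => none) (fun _ => none)
    (fun _ _ _ _ => none)
    (fun A b _ _ => match lookup (.lam A b) K.table with
      | some _ => none
      | none => (K.infer Γ (.lam A b)).bind fun T => some (.lam A b, T))
    (fun _ u hf _ => hf.bind fun
      | (.lam _ b, .pi A B) => bif K.check Γ u A then
          Tm.substK u b 0 fun b => Tm.substK u B 0 fun B => some (b, B) else none
      | _ => none)
    (fun _ => none) t

/-- Equality of iterated applications, by comparing the arguments. -/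
noncomputable def eqSpine (t : Tm) : Tm → Option Tm :=
  Tm.rec (motive := fun _ => Tm → Option Tm)
    (fun m t => bif (Tm.var m).same t then K.infer Γ t else none) (fun _ _ => none)
    (fun _ _ _ _ _ => none) (fun A b _ _ t => bif (Tm.lam A b).same t then K.infer Γ t else none)
    (fun f u eqf _ t => bif (Tm.app f u).same t then K.infer Γ t else match t with
      | .app f' u' => (eqf f').bind fun F => (asPi K Γ F).bind fun (A, B) =>
          bif K.eqAt Γ u u' A then Tm.substK u B 0 some else none
      | _ => none)
    (fun c t => bif (Tm.const c).same t then K.infer Γ t else none) t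

/-- Head and arguments of an iterated application. -/
noncomputable def spine (t : Tm) : List Tm → Tm × List Tm :=
  Tm.rec (motive := fun _ => List Tm → Tm × List Tm)
    (fun m us => (.var m, us)) (fun i us => (.univ i, us)) (fun A B _ _ us => (.pi A B, us))
    (fun A b _ _ us => (.lam A b, us)) (fun _ u sf _ us => sf (u :: us))
    (fun c us => (.const c, us)) t

/-- Apply both sides of an equation between abstractions to a list of arguments. -/
noncomputable def instEqn : List Tm → Tm → Tm → Tm → Option (Tm × Tm × Tm)
  | [], l, r, T => some (l, r, T)
  | u :: us, .lam _ l, .lam _ r, .pi A B =>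
    bif K.check Γ u A then Tm.substK u l 0 fun l => Tm.substK u r 0 fun r =>
      Tm.substK u B 0 fun B => instEqn us l r B else none
  | _, _, _, _ => none

/-- The number of arguments of an eliminator with computation rules. -/
def arity : Const → Option ℕ
  | .natInd _ => some 4
  | .boolInd _ => some 4
  | .sigInd _ _ => some 5
  | .idInd _ _ => some 6
  | .brwInd _ => some 14
  | _ => none

/-- Whether a term is an eliminator applied to all but its last argument. -/
noncomputable def isElim (f : Tm) : _root_.Bool :=
  match spine f [] with
  | (.const c, us) => match arity c with
    | some n => _root_.Nat.beq n (us.length + 1)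
    | none => false
  | _ => false

/-- The computation rule that applies at the root of a term, with the values of its variables. -/
noncomputable def redex (t : Tm) : Option (Rule × List Tm) :=
  match spine t [] with
  | (.const (.natInd j), [C, z, s, .const .zero]) => some (.zero j, [C, z, s])
  | (.const (.natInd j), [C, z, s, .app (.const .succ) n]) => some (.succ j, [C, z, s, n])
  | (.const (.boolInd j), [C, a, b, .const .ff]) => some (.ff j, [C, a, b])
  | (.const (.boolInd j), [C, a, b, .const .tt]) => some (.tt j, [C, a, b])
  | (.const (.sigInd i j), [A, B, C, g, .app (.app (.app (.app (.const (.pair _)) _) _) a) b]) =>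
      some (.sig i j, [A, B, C, g, a, b])
  | (.const (.idInd i j), [A, C, c, x, _, .app (.app (.const (.refl _)) _) _]) =>
      some (.refl i j, [A, C, c, x])
  | (.const (.brwInd j), [A, R, a, b, c, d, e, f, g, h, i, k, l, .const .bzero]) =>
      some (.bzero j, [A, R, a, b, c, d, e, f, g, h, i, k, l])
  | (.const (.brwInd j), [A, R, a, b, c, d, e, f, g, h, i, k, l, .app (.const .bsuc) x]) =>
      some (.bsuc j, [A, R, a, b, c, d, e, f, g, h, i, k, l, x])
  | (.const (.brwInd j), [A, R, a, b, c, d, e, f, g, h, i, k, l,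
      .app (.app (.const .blim) x) p]) =>
      some (.blim j, [A, R, a, b, c, d, e, f, g, h, i, k, l, x, p])
  | _ => none

noncomputable def inferRule : Tm → Option Tm
  | .var n => (Γ[n]?).bind fun A => A.liftK (n + 1) 0 some
  | .univ i => some (.univ (i + 1))
  | .pi A B => (sort K Γ A).bind fun i => (sort K (A :: Γ) B).bind fun j => some (.univ (max i j))
  | .lam A b => (sort K Γ A).bind fun _ => (K.infer (A :: Γ) b).bind fun B => some (.pi A B)
  | .app f u => (K.infer Γ f).bind fun F => (asPi K Γ F).bind fun (A, B) =>
      bif K.check Γ u A then Tm.substK u B 0 some else none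
  | .const c => bif c.isHighUnivalence then none else c.type.close.force some

noncomputable def inferStep (t : Tm) : Option Tm :=
  match lookup t K.table with
  | some A => some A
  | none => inferRule K Γ t

/-- Check a term by inferring its type. -/
noncomputable def checkInfer (t T : Tm) : _root_.Bool :=
  match K.infer Γ t with
  | none => false
  | some T' => conv K Γ T' T

/-- Check an abstraction. -/
noncomputable def checkLam (A b T : Tm) : _root_.Bool :=
  match asPi K Γ T with
  | none => false
  | some (A', B) => (eqSort K Γ A' A).isSome && K.check (A' :: Γ) b B

noncomputable def checkStep (t T : Tm) : _root_.Bool :=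
  match lookup t K.table with
  | some T' => conv K Γ T' T
  | none => match t with
    | .lam A b => checkLam K Γ A b T
    | t => checkInfer K Γ t T

/-- Reduce `t` and present the result as an element of `T`. -/
noncomputable def whnfTo (t T : Tm) : Option (Tm × Tm) :=
  (K.whnf Γ t).bind fun (t', S) => bif conv K Γ S T then some (t', T) else none

/-- Reduce an eliminator applied to a constructor. -/
noncomputable def contract (t T : Tm) : Option (Tm × Tm) :=
  match redex t with
  | none => some (t, T)
  | some (r, us) =>
    r.lhs.close.force fun l => r.rhs.close.force fun r' => r.type.close.force fun S =>
      (instEqn K Γ us l r' S).bind fun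
    | (l, r, T') => bif (l.same t || K.eqAt Γ l t T') && conv K Γ T' T then whnfTo K Γ r T else none

noncomputable def whnfApp (f u : Tm) : Option (Tm × Tm) :=
  match headBeta K Γ (.app f u) with
  | some (t, T) => whnfTo K Γ t T
  | none => (K.whnf Γ f).bind fun (f', F) => (asPi K Γ F).bind fun (A, B) => match f' with
    | .lam C b => bif K.check Γ u A then Tm.substK u B 0 fun B =>
        match lookup (.lam C b) K.table with
        | some _ => some (.app (.lam C b) u, B)
        | none => Tm.substK u b 0 fun b => whnfTo K Γ b B else none
    | f' => bif isElim f' then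
        (whnfTo K Γ u A).bind fun (u', _) => Tm.substK u' B 0 fun B => contract K Γ (.app f' u') B
      else bif K.check Γ u A then Tm.substK u B 0 fun B => some (.app f' u, B) else none

noncomputable def whnfStep (t : Tm) : Option (Tm × Tm) :=
  match t with
  | .app f u => match lookup (.app f u) K.table with
    | some A => some (.app f u, A)
    | none => whnfApp K Γ f u
  | t => (K.infer Γ t).bind fun A => some (t, A)

/-- Equality of terms, by comparing their parts. -/
noncomputable def eqParts : Tm → Tm → Option Tm
  | .pi A B, .pi A' B' => (eqSort K Γ A A').bind fun i =>
      (eqSort K (A :: Γ) B B').bind fun j => some (.univ (max i j))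
  | .lam A b, .lam A' b' => (eqSort K Γ A A').bind fun _ =>
      (K.eq (A :: Γ) b b').bind fun B => some (.pi A B)
  | .app f u, t => eqSpine K Γ (.app f u) t
  | _, _ => none

/-- Equality of terms that are not syntactically equal, by reducing them first. -/
noncomputable def eqWhnf (a b : Tm) : Option Tm :=
  (K.whnf Γ a).bind fun (a', A) => (K.whnf Γ b).bind fun (b', B) =>
    bif a'.same a && b'.same b then none else
    match (bif a'.same b' then K.infer Γ a' else eqParts K Γ a' b') with
    | none => none
    | some T => bif conv K Γ A T && conv K Γ B T then some T else none

noncomputable def eqStep (a b : Tm) : Option Tm :=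
  bif a.same b then K.infer Γ a else
  match eqParts K Γ a b with
  | some A => some A
  | none => eqWhnf K Γ a b

/-- Equality of terms of a given type, by inferring their type. -/
noncomputable def eqInfer (a b T : Tm) : _root_.Bool :=
  match K.eq Γ a b with
  | none => false
  | some T' => conv K Γ T' T

/-- Equality of abstractions. -/
noncomputable def eqLam (A b A' b' T : Tm) : _root_.Bool :=
  match asPi K Γ T with
  | none => false
  | some (C, D) => (eqSort K Γ C A).isSome && (eqSort K Γ C A').isSome && K.eqAt (C :: Γ) b b' D

noncomputable def eqAtStep (a b T : Tm) : _root_.Bool :=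
  bif a.same b then K.check Γ a T else
  match a, b with
  | .lam A b, .lam A' b' => eqLam K Γ A b A' b' T
  | a, b => eqInfer K Γ a b T

noncomputable def step : Checker where
  table := K.table
  infer Γ t := inferStep K Γ t
  check Γ t T := checkStep K Γ t T
  whnf Γ t := whnfStep K Γ t
  eq Γ a b := eqStep K Γ a b
  eqAt Γ a b T := eqAtStep K Γ a b T

/-- The checker whose recursion depth is bounded by the given number. -/
noncomputable def ofDepth (l : List (Tm × Tm)) : ℕ → Checker
  | 0 => ⟨l, fun _ _ => none, fun _ _ _ => false, fun _ _ => none, fun _ _ _ => none,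
      fun _ _ _ _ => false⟩
  | n + 1 => step (ofDepth l n)

variable {K Γ} {m : ℕ}
theorem Sound.level (hK : K.Sound m) {S : Tm} {i : ℕ} (h : level K Γ S = some i) {a b : Tm}
    (hS : JEqAt m Γ a b S) : JEqAt m Γ a b (.univ i) := by
  unfold Checker.level at h
  split at h
  · cases h; exact hS
  · obtain ⟨⟨S', T⟩, hn, h⟩ := Option.bind_eq_some_iff.1 h
    split at h
    · rename_i heq
      cases heq; cases h
      exact hS.conv (hK.whnf hn)
    · cases h

theorem Sound.sort (hK : K.Sound m) {A : Tm} {i : ℕ} (h : sort K Γ A = some i) :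
    JEqAt m Γ A A (.univ i) := by
  obtain ⟨S, h1, h2⟩ := Option.bind_eq_some_iff.1 h
  exact hK.level h2 (hK.infer h1)

theorem Sound.asPi (hK : K.Sound m) {T A B : Tm} (h : asPi K Γ T = some (A, B)) (a b : Tm) :
    JEqAt m Γ a b T ↔ JEqAt m Γ a b (.pi A B) := by
  unfold Checker.asPi at h
  split at h
  · cases h; rfl
  · obtain ⟨⟨T', S⟩, hn, h⟩ := Option.bind_eq_some_iff.1 h
    split at h
    · rename_i heq
      cases heq
      obtain ⟨i, hi, h⟩ := Option.bind_eq_some_iff.1 h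
      cases h
      have := hK.level hi (hK.whnf hn)
      exact ⟨fun h => h.conv this, fun h => h.conv this.symm⟩
    · cases h

theorem Sound.eqSort (hK : K.Sound m) {A B : Tm} {i : ℕ} (h : eqSort K Γ A B = some i) :
    JEqAt m Γ A B (.univ i) := by
  obtain ⟨S, h1, h2⟩ := Option.bind_eq_some_iff.1 h
  exact hK.level h2 (hK.eq h1)

theorem Sound.leLevel_left (hK : K.Sound m) {A a b : Tm} {j : ℕ}
    (h : leLevel (Checker.level K Γ A) (some j) = true) (hA : JEqAt m Γ a b A) :
    JEqAt m Γ a b (.univ j) := by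
  cases hl : Checker.level K Γ A with
  | none => rw [hl] at h; cases h
  | some i =>
    rw [hl] at h
    exact (hK.level hl hA).cumul_le (_root_.Nat.le_of_ble_eq_true h)

theorem Sound.univ_of_level (hK : K.Sound m) {A : Tm} {i : ℕ} (h : Checker.level K Γ A = some i) :
    A = .univ i ∨ ∃ j, JEqAt m Γ A (.univ i) (.univ j) := by
  unfold Checker.level at h
  split at h
  · cases h; exact .inl rfl
  · obtain ⟨⟨S', T⟩, hn, h⟩ := Option.bind_eq_some_iff.1 h
    split at h
    · rename_i heq
      cases heq; cases h
      exact .inr ⟨_, hK.whnf hn⟩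
    · cases h

theorem Sound.leLevel (hK : K.Sound m) {A B a b : Tm}
    (h : leLevel (Checker.level K Γ A) (Checker.level K Γ B) = true) (hA : JEqAt m Γ a b A) :
    JEqAt m Γ a b B := by
  cases hB : Checker.level K Γ B with
  | none => rw [hB] at h; revert h; cases Checker.level K Γ A <;> intro h <;> cases h
  | some j =>
    rw [hB] at h
    have h1 := hK.leLevel_left h hA
    rcases hK.univ_of_level hB with rfl | ⟨k, hk⟩
    · exact h1
    · exact h1.conv hk.symm

theorem Sound.conv (hK : K.Sound m) {A B a b : Tm} (h : conv K Γ A B = true)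
    (hA : JEqAt m Γ a b A) : JEqAt m Γ a b B := by
  unfold Checker.conv at h
  rcases Bool.or_eq_true_iff.1 h with h | h
  · rwa [← Tm.eq_of_same h]
  split at h
  · exact hK.leLevel (A := .univ _) h hA
  · exact hK.leLevel_left h hA
  · rcases Bool.or_eq_true_iff.1 h with h | h
    · obtain ⟨i, hi⟩ := Option.isSome_iff_exists.1 h
      exact hA.conv (hK.eqSort hi)
    · exact hK.leLevel h hA

theorem Sound.headBeta (hK : K.Sound m) {t : Tm} : ∀ {t' T : Tm},
    headBeta K Γ t = some (t', T) → JEqAt m Γ t t' T := by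
  induction t with
  | lam A b =>
    intro t' T h
    change (match lookup (.lam A b) K.table with | some _ => _ | none => _) = _ at h
    split at h
    · cases h
    obtain ⟨S, h1, h2⟩ := Option.bind_eq_some_iff.1 h
    cases h2
    exact hK.infer h1
  | app f u ih _ =>
    intro t' T h
    obtain ⟨⟨f', F⟩, h1, h2⟩ := Option.bind_eq_some_iff.1 h
    split at h2
    · rename_i heq
      cases heq
      simp only [Tm.substK_eq] at h2
      cases hc : K.check Γ u _ <;> rw [hc] at h2 <;> cases h2
      have h3 := ih h1
      have hu := hK.check hc
      exact (h3.app hu).trans (.beta h3.right hu)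
    · cases h2
  | _ => intro t' T h; cases h

theorem Sound.inferOfSame (hK : K.Sound m) {t t' T : Tm} (hs : t.same t' = true)
    (h : K.infer Γ t = some T) : JEqAt m Γ t t' T := by
  rw [← Tm.eq_of_same hs]
  exact hK.infer h

theorem Sound.eqSpine (hK : K.Sound m) {t : Tm} : ∀ {t' T : Tm},
    eqSpine K Γ t t' = some T → JEqAt m Γ t t' T := by
  induction t with
  | var m =>
    intro t' T h
    change (bif (Tm.var m).same t' then _ else _) = _ at h
    cases hs : (Tm.var m).same t' <;> rw [hs] at h
    · cases h
    · rw [Tm.eq_of_same hs]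
      exact hK.infer h
  | const c =>
    intro t' T h
    change (bif (Tm.const c).same t' then _ else _) = _ at h
    cases hs : (Tm.const c).same t' <;> rw [hs] at h
    · cases h
    · rw [Tm.eq_of_same hs]
      exact hK.infer h
  | lam A b =>
    intro t' T h
    change (bif (Tm.lam A b).same t' then _ else _) = _ at h
    cases hs : (Tm.lam A b).same t' <;> rw [hs] at h
    · cases h
    · rw [Tm.eq_of_same hs]
      exact hK.infer h
  | app f u ih _ =>
    intro t' T h
    change (bif (Tm.app f u).same t' then _ else _) = _ at h
    cases hs : (Tm.app f u).same t' <;> rw [hs] at h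
    · dsimp only [cond] at h
      split at h
      · obtain ⟨F, h1, h2⟩ := Option.bind_eq_some_iff.1 h
        obtain ⟨⟨A, B⟩, h3, h4⟩ := Option.bind_eq_some_iff.1 h2
        simp only [Tm.substK_eq] at h4
        cases hc : K.eqAt Γ u _ A <;> rw [hc] at h4 <;> cases h4
        exact .app ((hK.asPi h3 _ _).1 (ih h1)) (hK.eqAt hc)
      · cases h
    · rw [Tm.eq_of_same hs]
      exact hK.infer h
  | _ => intro t' T h; cases h

theorem Sound.instEqn (hK : K.Sound m) : ∀ {us : List Tm} {l r T l' r' T' : Tm},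
    instEqn K Γ us l r T = some (l', r', T') → JEqAt m Γ l r T → JEqAt m Γ l' r' T'
  | [], _, _, _, _, _, _, h, hl => by cases h; exact hl
  | u :: us, l, r, T, l', r', T', h, hl => by
    unfold Checker.instEqn at h
    split at h
    · rename_i h0; cases h0
    · rename_i heq
      cases heq
      simp only [Tm.substK_eq] at h
      cases hc : K.check Γ u _ <;> rw [hc] at h
      · cases h
      have hu := hK.check hc
      exact hK.instEqn h
        (((JEqAt.beta hl.left hu).symm.trans (hl.app hu)).trans (.beta hl.right hu))
    · cases h

theorem Sound.inferRule (hK : K.Sound m) {t A : Tm} (h : inferRule K Γ t = some A) :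
    JEqAt m Γ t t A := by
  cases t with
  | var n =>
    obtain ⟨B, h1, h2⟩ := Option.bind_eq_some_iff.1 h
    rw [Tm.liftK_eq] at h2
    cases h2
    exact .var h1
  | univ i => cases h; exact .univ
  | pi A B =>
    obtain ⟨i, h1, h2⟩ := Option.bind_eq_some_iff.1 h
    obtain ⟨j, h3, h4⟩ := Option.bind_eq_some_iff.1 h2
    cases h4
    exact .pi ((hK.sort h1).cumul_le (le_max_left _ _)) ((hK.sort h3).cumul_le (le_max_right _ _))
  | lam A b =>
    obtain ⟨i, h1, h2⟩ := Option.bind_eq_some_iff.1 h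
    obtain ⟨B, h3, h4⟩ := Option.bind_eq_some_iff.1 h2
    cases h4
    exact .lam (hK.sort h1) (hK.infer h3)
  | app f u =>
    obtain ⟨F, h1, h2⟩ := Option.bind_eq_some_iff.1 h
    obtain ⟨⟨A', B⟩, h3, h4⟩ := Option.bind_eq_some_iff.1 h2
    simp only [Tm.substK_eq] at h4
    cases hc : K.check Γ u A' <;> rw [hc] at h4 <;> cases h4
    exact .app ((hK.asPi h3 _ _).1 (hK.infer h1)) (hK.check hc)
  | const c =>
    simp only [Checker.inferRule, Tm.force_eq] at h
    cases hc : c.isHighUnivalence <;> rw [hc] at h <;> cases h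
    exact .const c hc

theorem Sound.inferStep (hK : K.Sound m) {t A : Tm} (h : inferStep K Γ t = some A) :
    JEqAt m Γ t t A := by
  unfold Checker.inferStep at h
  split at h
  · rename_i hl
    cases h
    exact hK.table.lookup hl
  · exact hK.inferRule h

theorem Sound.checkInfer (hK : K.Sound m) {t T : Tm} (h : checkInfer K Γ t T = true) :
    JEqAt m Γ t t T := by
  unfold Checker.checkInfer at h
  split at h
  · cases h
  · rename_i hi
    exact hK.conv h (hK.infer hi)

theorem Sound.checkLam (hK : K.Sound m) {A b T : Tm} (h : checkLam K Γ A b T = true) :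
    JEqAt m Γ (.lam A b) (.lam A b) T := by
  unfold Checker.checkLam at h
  split at h
  · cases h
  rename_i hp
  obtain ⟨h1, h2⟩ := Bool.and_eq_true_iff.1 h
  obtain ⟨i, h1⟩ := Option.isSome_iff_exists.1 h1
  exact (hK.asPi hp _ _).2 (JEqAt.lam (hK.eqSort h1) (hK.check h2)).right

theorem Sound.checkStep (hK : K.Sound m) {t T : Tm} (h : checkStep K Γ t T = true) :
    JEqAt m Γ t t T := by
  unfold Checker.checkStep at h
  split at h
  · rename_i hl
    exact hK.conv h (hK.table.lookup hl)
  split at h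
  · exact hK.checkLam h
  · exact hK.checkInfer h

theorem Sound.whnfTo (hK : K.Sound m) {t t' T T' : Tm} (h : whnfTo K Γ t T = some (t', T')) :
    JEqAt m Γ t t' T ∧ T' = T := by
  obtain ⟨⟨N, S⟩, h1, h2⟩ := Option.bind_eq_some_iff.1 h
  dsimp only at h2
  cases hc : Checker.conv K Γ S T <;> rw [hc] at h2 <;> cases h2
  exact ⟨hK.conv hc (hK.whnf h1), rfl⟩

theorem Sound.contract (hK : K.Sound m) {t t' T T' : Tm} (h : contract K Γ t T = some (t', T'))
    (ht : JEqAt m Γ t t T) : JEqAt m Γ t t' T ∧ T' = T := by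
  unfold Checker.contract at h
  split at h
  · cases h; exact ⟨ht, rfl⟩
  simp only [Tm.force_eq] at h
  obtain ⟨⟨l, r, S⟩, h1, h2⟩ := Option.bind_eq_some_iff.1 h
  dsimp only at h2
  cases hc : ((l.same t || K.eqAt Γ l t S) && Checker.conv K Γ S T) <;> rw [hc] at h2
  · cases h2
  obtain ⟨h3, h4⟩ := Bool.and_eq_true_iff.1 hc
  have h5 := hK.instEqn h1 (.comp _)
  have h6 : JEqAt m Γ t r S := by
    rcases Bool.or_eq_true_iff.1 h3 with h3 | h3
    · rwa [← Tm.eq_of_same h3]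
    · exact (hK.eqAt h3).symm.trans h5
  exact ⟨(hK.conv h4 h6).trans (hK.whnfTo h2).1, (hK.whnfTo h2).2⟩

theorem Sound.whnfApp (hK : K.Sound m) {f u t' A : Tm} (h : whnfApp K Γ f u = some (t', A)) :
    JEqAt m Γ (.app f u) t' A := by
  unfold Checker.whnfApp at h
  split at h
  · rename_i hb
    obtain ⟨h1, rfl⟩ := hK.whnfTo h
    exact (hK.headBeta hb).trans h1
  obtain ⟨⟨f', F⟩, h1, h2⟩ := Option.bind_eq_some_iff.1 h
  obtain ⟨⟨A', B⟩, h3, h4⟩ := Option.bind_eq_some_iff.1 h2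
  have hf := (hK.asPi h3 _ _).1 (hK.whnf h1)
  simp only [Tm.substK_eq] at h4
  split at h4
  · cases hc : K.check Γ u A' <;> rw [hc] at h4
    · cases h4
    have hu := hK.check hc
    dsimp only [cond_true] at h4
    split at h4
    · cases h4
      exact hf.app hu
    obtain ⟨h5, rfl⟩ := hK.whnfTo h4
    exact ((hf.app hu).trans (.beta hf.right hu)).trans h5
  · cases he : isElim f' <;> rw [he] at h4
    · cases hc : K.check Γ u A' <;> rw [hc] at h4 <;> cases h4
      exact hf.app (hK.check hc)
    · obtain ⟨⟨u', U⟩, h5, h6⟩ := Option.bind_eq_some_iff.1 h4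
      obtain ⟨h5, rfl⟩ := hK.whnfTo h5
      have h7 := (hf.symm.app h5.symm).symm
      obtain ⟨h8, rfl⟩ := hK.contract h6 h7.right
      exact h7.trans h8

theorem Sound.whnfStep (hK : K.Sound m) {t t' A : Tm} (h : whnfStep K Γ t = some (t', A)) :
    JEqAt m Γ t t' A := by
  unfold Checker.whnfStep at h
  split at h
  · split at h
    · rename_i hl
      cases h
      exact hK.table.lookup hl
    · exact hK.whnfApp h
  · obtain ⟨T, h1, h2⟩ := Option.bind_eq_some_iff.1 h
    cases h2
    exact hK.infer h1

theorem Sound.eqParts (hK : K.Sound m) {a b A : Tm} (h : eqParts K Γ a b = some A) :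
    JEqAt m Γ a b A := by
  unfold Checker.eqParts at h
  split at h
  · obtain ⟨i, h1, h2⟩ := Option.bind_eq_some_iff.1 h
    obtain ⟨j, h3, h4⟩ := Option.bind_eq_some_iff.1 h2
    cases h4
    exact .pi ((hK.eqSort h1).cumul_le (le_max_left _ _))
      ((hK.eqSort h3).cumul_le (le_max_right _ _))
  · obtain ⟨i, h1, h2⟩ := Option.bind_eq_some_iff.1 h
    obtain ⟨B, h3, h4⟩ := Option.bind_eq_some_iff.1 h2
    cases h4
    exact .lam (hK.eqSort h1) (hK.eq h3)
  · exact hK.eqSpine h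
  · cases h

theorem Sound.eqWhnf (hK : K.Sound m) {a b T : Tm} (h : eqWhnf K Γ a b = some T) :
    JEqAt m Γ a b T := by
  obtain ⟨⟨a', A⟩, h1, h2⟩ := Option.bind_eq_some_iff.1 h
  obtain ⟨⟨b', B⟩, h3, h4⟩ := Option.bind_eq_some_iff.1 h2
  dsimp only at h4
  cases hs : (a'.same a && b'.same b) <;> rw [hs] at h4
  · dsimp only [cond_false] at h4
    split at h4
    · cases h4
    rename_i T' hT
    cases hc : (Checker.conv K Γ A T' && Checker.conv K Γ B T') <;> rw [hc] at h4 <;> cases h4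
    obtain ⟨h5, h6⟩ := Bool.and_eq_true_iff.1 hc
    have h7 : JEqAt m Γ a' b' T := by
      cases hs : a'.same b' <;> rw [hs] at hT
      · exact hK.eqParts hT
      · exact hK.inferOfSame hs hT
    exact ((hK.conv h5 (hK.whnf h1)).trans h7).trans (hK.conv h6 (hK.whnf h3)).symm
  · cases h4

theorem Sound.eqStep (hK : K.Sound m) {a b T : Tm} (h : eqStep K Γ a b = some T) :
    JEqAt m Γ a b T := by
  unfold Checker.eqStep at h
  cases hs : a.same b <;> rw [hs] at h
  · dsimp only [cond_false] at h
    split at h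
    · rename_i hp
      cases h
      exact hK.eqParts hp
    · exact hK.eqWhnf h
  · exact hK.inferOfSame hs h

theorem Sound.eqInfer (hK : K.Sound m) {a b T : Tm} (h : eqInfer K Γ a b T = true) :
    JEqAt m Γ a b T := by
  unfold Checker.eqInfer at h
  split at h
  · cases h
  · rename_i he
    exact hK.conv h (hK.eq he)

theorem Sound.eqLam (hK : K.Sound m) {A b A' b' T : Tm} (h : eqLam K Γ A b A' b' T = true) :
    JEqAt m Γ (.lam A b) (.lam A' b') T := by
  unfold Checker.eqLam at h
  split at h
  · cases h
  rename_i hp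
  obtain ⟨h1, h4⟩ := Bool.and_eq_true_iff.1 h
  obtain ⟨h2, h3⟩ := Bool.and_eq_true_iff.1 h1
  obtain ⟨i, h2⟩ := Option.isSome_iff_exists.1 h2
  obtain ⟨j, h3⟩ := Option.isSome_iff_exists.1 h3
  have hb := hK.eqAt h4
  exact (hK.asPi hp _ _).2
    ((JEqAt.lam (hK.eqSort h2) hb.left).symm.trans (.lam (hK.eqSort h3) hb))

theorem Sound.eqAtStep (hK : K.Sound m) {a b T : Tm} (h : eqAtStep K Γ a b T = true) :
    JEqAt m Γ a b T := by
  unfold Checker.eqAtStep at h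
  cases hs : a.same b <;> rw [hs] at h
  · dsimp only [cond_false] at h
    split at h
    · exact hK.eqLam h
    · exact hK.eqInfer h
  · rw [← Tm.eq_of_same hs]
    exact hK.check h

theorem sound_ofDepth {m : ℕ} {l : List (Tm × Tm)} (hl : TypeTable m l) : ∀ n, (ofDepth l n).Sound m
  | 0 => by
    constructor
    · exact hl
    all_goals intros; contradiction
  | n + 1 =>
    have hK := sound_ofDepth hl n
    ⟨hK.table, hK.inferStep, hK.checkStep, hK.whnfStep, hK.eqStep, hK.eqAtStep⟩

end Checker

/-- Evaluate all entries of a table. -/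
noncomputable def forceTable {α : Type} : List (Tm × Tm) → (List (Tm × Tm) → α) → α
  | [], K => K []
  | (t, A) :: l, K => t.force fun t => A.force fun A => forceTable l fun l => K ((t, A) :: l)

theorem forceTable_eq {α : Type} (l : List (Tm × Tm)) :
    ∀ K : List (Tm × Tm) → α, forceTable l K = K l := by
  induction l with
  | nil => intro K; rfl
  | cons p l ih => intro K; simp [forceTable, Tm.force_eq, ih]

/-- The checker confirms that the closed term `t` has type `A`. -/
def Checks (l : List (Tm × Tm)) (t A : Exp) : Prop :=
  (forceTable l fun l => t.close.force fun t => A.close.force fun A =>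
    (Checker.ofDepth l 1000).check [] t A) = true

noncomputable instance (l : List (Tm × Tm)) (t A : Exp) : Decidable (Checks l t A) :=
  inferInstanceAs (Decidable (_ = true))

theorem TypeTable.nil {m : ℕ} : TypeTable m [] := fun _ h => by cases h

theorem Checks.jeqAt {m : ℕ} {l : List (Tm × Tm)} {t A : Exp} (h : Checks l t A)
    (hl : TypeTable m l) : JEqAt m [] t.close t.close A.close := by
  simp only [Checks, forceTable_eq, Tm.force_eq] at h
  exact (Checker.sound_ofDepth hl _).check h

theorem Checks.hasType {l : List (Tm × Tm)} {t A : Exp} (h : Checks l t A)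
    (hl : TypeTable 0 l) : HasType [] t.close A.close :=
  jeqAt_zero.1 (h.jeqAt hl)

/-- A closed term and its type. -/
def entry (t A : Exp) : Tm × Tm := (t.close, A.close)

theorem TypeTable.cons {l : List (Tm × Tm)} {t A : Exp} (hl : TypeTable 0 l)
    (h : HasType [] t.close A.close) : TypeTable 0 (entry t A :: l) := by
  intro p hp
  rcases List.mem_cons.1 hp with rfl | hp
  · exact jeqAt_zero.2 h
  · exact hl p hp


/-! ## Abbreviations -/

namespace Checker

variable (K : Checker) (D : List (Tm × Tm))

/-- Whether the head of an iterated application is an abbreviation. -/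
noncomputable def headAbbrev : Tm → _root_.Bool
  | .app f u => (lookup (.app f u) D).isSome || headAbbrev f
  | t => (lookup t D).isSome

/-- Contract an application of an abstraction if the flag `c` is set.  Here `u'` is the result of
contracting `u`, and `A` and `B` are domain and codomain of the function. -/
noncomputable def applyAbbrev (Γ : List Tm) (c : _root_.Bool) (f u u' A B : Tm) :
    Option (Tm × Tm) :=
  Tm.substK u B 0 fun T => match c, f with
  | true, .lam _ b => (sort K Γ A).bind fun _ => (sort K (A :: Γ) B).bind fun _ =>
      Tm.substK u' b 0 fun b => some (b, T)
  | _, f => some (.app f u', T)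

/-- Contract all applications of abbreviations, which are the terms of the table `D`. -/
noncomputable def unfold : List Tm → Tm → Option (Tm × Tm)
  | Γ, .pi A B => (unfold Γ A).bind fun (A', S) => (level K Γ S).bind fun i =>
      (unfold (A :: Γ) B).bind fun (B', S') => (level K (A :: Γ) S').bind fun j =>
      some (.pi A' B', .univ (max i j))
  | Γ, .lam A b => match lookup (.lam A b) D with
    | some T => some (.lam A b, T)
    | none => (unfold Γ A).bind fun (A', S) => (level K Γ S).bind fun _ =>
      (unfold (A :: Γ) b).bind fun (b', B) => some (.lam A' b', .pi A B)
  | Γ, .app f u => match lookup (.app f u) D with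
    | some T => some (.app f u, T)
    | none => (unfold Γ f).bind fun (f', F) => (asPi K Γ F).bind fun (A, B) =>
      (unfold Γ u).bind fun (u', A') => bif conv K Γ A' A then
        applyAbbrev K Γ (headAbbrev D f) f' u u' A B else none
  | Γ, t => (K.infer Γ t).bind fun A => some (t, A)

variable {K D} {m : ℕ}

/-- Substitution of equal terms into a type. -/
theorem _root_.HoTT.JEqAt.inst_congr {Γ : List Tm} {A B u u' : Tm} {i j : ℕ}
    (hA : JEqAt m Γ A A (.univ i)) (hB : JEqAt m (A :: Γ) B B (.univ j)) (hu : JEqAt m Γ u u' A) :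
    JEqAt m Γ (B.inst u) (B.inst u') (.univ j) :=
  have h := JEqAt.lam hA hB
  ((JEqAt.beta h hu.left).symm.trans (h.app hu)).trans (.beta h hu.right)

theorem Sound.applyAbbrev (hK : K.Sound m) (c : _root_.Bool) {Γ : List Tm}
    {f f' u u' A B t T : Tm} (h : applyAbbrev K Γ c f' u u' A B = some (t, T))
    (hf : JEqAt m Γ f f' (.pi A B)) (hu : JEqAt m Γ u u' A) :
    JEqAt m Γ (.app f u) t T := by
  unfold Checker.applyAbbrev at h
  simp only [Tm.substK_eq] at h
  split at h
  · obtain ⟨i, hi, h⟩ := Option.bind_eq_some_iff.1 h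
    obtain ⟨j, hj, h⟩ := Option.bind_eq_some_iff.1 h
    cases h
    exact (hf.app hu).trans ((JEqAt.beta hf.right hu.right).conv
      ((JEqAt.inst_congr (hK.sort hi) (hK.sort hj) hu).symm))
  · cases h
    exact hf.app hu

theorem Sound.unfold (hK : K.Sound m) (hD : TypeTable m D) {t : Tm} : ∀ {Γ : List Tm} {t' T : Tm},
    unfold K D Γ t = some (t', T) → JEqAt m Γ t t' T := by
  induction t with
  | pi A B ihA ihB =>
    intro Γ t' T h
    obtain ⟨⟨A', S⟩, h1, h⟩ := Option.bind_eq_some_iff.1 h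
    obtain ⟨i, h2, h⟩ := Option.bind_eq_some_iff.1 h
    obtain ⟨⟨B', S'⟩, h3, h⟩ := Option.bind_eq_some_iff.1 h
    obtain ⟨j, h4, h⟩ := Option.bind_eq_some_iff.1 h
    cases h
    exact .pi ((hK.level h2 (ihA h1)).cumul_le (le_max_left _ _))
      ((hK.level h4 (ihB h3)).cumul_le (le_max_right _ _))
  | lam A b ihA ihb =>
    intro Γ t' T h
    unfold Checker.unfold at h
    split at h
    · rename_i hd
      cases h
      exact hD.lookup hd
    obtain ⟨⟨A', S⟩, h1, h⟩ := Option.bind_eq_some_iff.1 h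
    obtain ⟨i, h2, h⟩ := Option.bind_eq_some_iff.1 h
    obtain ⟨⟨b', B⟩, h3, h⟩ := Option.bind_eq_some_iff.1 h
    cases h
    exact .lam (hK.level h2 (ihA h1)) (ihb h3)
  | app f u ihf ihu =>
    intro Γ t' T h
    unfold Checker.unfold at h
    split at h
    · rename_i hd
      cases h
      exact hD.lookup hd
    obtain ⟨⟨f', F⟩, h1, h⟩ := Option.bind_eq_some_iff.1 h
    obtain ⟨⟨A, B⟩, h2, h⟩ := Option.bind_eq_some_iff.1 h
    obtain ⟨⟨u', A'⟩, h3, h⟩ := Option.bind_eq_some_iff.1 h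
    dsimp only at h
    cases hc : Checker.conv K Γ A' A <;> rw [hc] at h
    · cases h
    exact Sound.applyAbbrev hK _ h ((hK.asPi h2 _ _).1 (ihf h1))
      (hK.conv hc (ihu h3))
  | _ =>
    intro Γ t' T h
    obtain ⟨A, h1, h2⟩ := Option.bind_eq_some_iff.1 h
    cases h2
    exact hK.infer h1

end Checker

/-- The closed term `t` of type `A` turns into `t'` when the abbreviations in `D` are contracted. -/
def Unfolds (l D : List (Tm × Tm)) (t t' A : Exp) : Prop :=
  (forceTable l fun l => forceTable D fun D =>
    t.close.force fun t => t'.close.force fun t' => A.close.force fun A =>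
    match Checker.unfold (Checker.ofDepth l 1000) D [] t with
    | some (s, S) => s.same t' && Checker.conv (Checker.ofDepth l 1000) [] S A
    | none => false) = true

noncomputable instance (l D : List (Tm × Tm)) (t t' A : Exp) :
    Decidable (Unfolds l D t t' A) :=
  inferInstanceAs (Decidable (_ = true))

theorem Unfolds.jeqAt {m : ℕ} {l D : List (Tm × Tm)} {t t' A : Exp}
    (h : Unfolds l D t t' A) (hl : TypeTable m l) (hD : TypeTable m D) :
    JEqAt m [] t.close t'.close A.close := by
  simp only [Unfolds, forceTable_eq, Tm.force_eq] at h
  split at h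
  · rename_i hu
    obtain ⟨h1, h2⟩ := Bool.and_eq_true_iff.1 h
    have hK := Checker.sound_ofDepth hl 1000
    rw [← Tm.eq_of_same h1]
    exact hK.conv h2 (hK.unfold hD hu)
  · cases h


/-! ## Terms for derived notions -/

def refl (i : ℕ) (A x : Exp) : Exp := cst (.refl i) A x

/-- Transport in a family given as a function on expressions. -/
def subst (i j : ℕ) (A : Exp) (P : Exp → Exp) (x y p u : Exp) : Exp :=
  cst (.idInd i j) A
    (lam A fun x => lam A fun y => lam (Id i A x y) fun _ => P x ⟶ₜ P y)
    (lam A fun x => lam (P x) fun v => v) x y p u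

def symm (i : ℕ) (A x y p : Exp) : Exp := subst i i A (fun z => Id i A z x) x y p (refl i A x)

def trans (i : ℕ) (A x y z p q : Exp) : Exp := subst i i A (fun w => Id i A x w) y z q p

/-- Identifications in the universe of level `i` give identifications in level `j`. -/
def idLift (i j : ℕ) (A x y p : Exp) : Exp :=
  subst i j A (fun z => Id j A x z) x y p (refl j A x)

def natRec (j : ℕ) (C : Exp → Exp) (z : Exp) (s : Exp → Exp → Exp) (n : Exp) : Exp :=
  cst (.natInd j) (lam Nat C) z (lam Nat fun n => lam (C n) fun h => s n h) n

def boolRec (j : ℕ) (C : Exp → Exp) (a b t : Exp) : Exp := cst (.boolInd j) (lam Bool C) a b t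

def emptyElim (j : ℕ) (C x : Exp) : Exp := cst (.emptyInd j) (lam Empty fun _ => C) x

def mkPair (i : ℕ) (A : Exp) (B : Exp → Exp) (a b : Exp) : Exp := cst (.pair i) A (lam A B) a b

def proj₁ (i : ℕ) (A : Exp) (B : Exp → Exp) (p : Exp) : Exp := fst i A (lam A B) p

def proj₂ (i : ℕ) (A : Exp) (B : Exp → Exp) (p : Exp) : Exp := snd i A (lam A B) p

def sigElim (i j : ℕ) (A : Exp) (B C : Exp → Exp) (f : Exp → Exp → Exp) (p : Exp) : Exp :=
  cst (.sigInd i j) A (lam A B) (lam (Sig i A (lam A B)) C)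
    (lam A fun a => lam (B a) fun b => f a b) p

def exIntro (i : ℕ) (A : Exp) (B : Exp → Exp) (a b : Exp) : Exp :=
  cst (.tr i) (Sig i A (lam A B)) (mkPair i A B a b)

/-- Elimination of a truncated existential quantifier into the proposition `C`. -/
def exElim (i j : ℕ) (A : Exp) (B : Exp → Exp) (C hC : Exp) (f : Exp → Exp → Exp) (p : Exp) :
    Exp :=
  cst (.truncRec i j) (Sig i A (lam A B)) C hC
    (lam (Sig i A (lam A B)) fun p => sigElim i j A B (fun _ => C) f p) p

/-- From `p : tt = ff`, an element of the empty type. -/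
def ttNeFf (p : Exp) : Exp :=
  subst 0 0 Bool (fun b => boolRec 1 (fun _ => U 0) Empty Unit b) tt ff p (cst .star)

def isPropEmpty : Exp := lam Empty fun x => lam Empty fun y => emptyElim 0 (Id 0 Empty x y) x

def leTrans (x y z e e' : Exp) : Exp := cst .leTrans x y z e e'

/-! ## Markov's principle and `LPO` -/

/-- For the ordinal `α`: every `α`-decidable proposition is semidecidable. -/
def collapseAt (i : ℕ) (α : Exp) : Exp :=
  pi (U i) fun P => isProp i P ⟶ₜ ordDec i α P ⟶ₜ semiDec i P

/-- Every proposition `α ≤ y` is semidecidable, where the existential quantifier is eliminated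
into propositions of the lowest universe. -/
def semidecAt (α : Exp) : Exp :=
  pi Brw fun y => pi (U 0) fun G => isProp 0 G ⟶ₜ
  (pi (Nat ⟶ₜ Bool) fun u => (Le α y ⟶ₜ hasOne u) ⟶ₜ (hasOne u ⟶ₜ Le α y) ⟶ₜ G) ⟶ₜ G

def semidecOfCollapse (i : ℕ) : Exp :=
  lam Brw fun α => lam (collapseAt i α) fun c => lam Brw fun y =>
  lam (U 0) fun G => lam (isProp 0 G) fun hG =>
  lam (pi (Nat ⟶ₜ Bool) fun u => (Le α y ⟶ₜ hasOne u) ⟶ₜ (hasOne u ⟶ₜ Le α y) ⟶ₜ G) fun g =>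
  let P := Le α y
  exElim i 0 (Nat ⟶ₜ Bool) (fun u => iff i P (hasOne u)) G hG
    (fun u k => g u (proj₁ i (P ⟶ₜ hasOne u) (fun _ => hasOne u ⟶ₜ P) k)
      (proj₂ i (P ⟶ₜ hasOne u) (fun _ => hasOne u ⟶ₜ P) k))
    (c P (lam P fun a => lam P fun b => idLift 0 i P a b (cst .leProp α y a b))
      (exIntro i Brw (fun y => iff i P (Le α y)) y
        (mkPair i (P ⟶ₜ P) (fun _ => P ⟶ₜ P) (lam P fun a => a) (lam P fun a => a))))

/-- Being constantly `0` is `α`-decidable. -/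
def allZeroDec (α : Exp) : Exp :=
  pi (Nat ⟶ₜ Bool) fun s => Sig 0 Brw (lam Brw fun y => iff 0 (allZero s) (Le α y))

/-- The disjunction of two binary digits. -/
def orDigit (x y : Exp) : Exp := boolRec 0 (fun _ => Bool) y tt x

section Telescopes

variable (q : Exp → (Exp → Exp) → Exp)

/-- The binary sequence `v` is the digitwise disjunction of `s` and `u`. -/
def orTele (s u v : Exp) (body : Exp → Exp → Exp → Exp) : Exp :=
  q (pi Nat fun n => Id 0 Bool (v n) ff ⟶ₜ Id 0 Bool (s n) ff) fun left =>
  q (pi Nat fun n => Id 0 Bool (v n) ff ⟶ₜ Id 0 Bool (u n) ff) fun right =>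
  q (pi Nat fun n => Id 0 Bool (v n) tt ⟶ₜ pi (U 0) fun G =>
    (Id 0 Bool (s n) tt ⟶ₜ G) ⟶ₜ (Id 0 Bool (u n) tt ⟶ₜ G) ⟶ₜ G) fun cases =>
  body left right cases

end Telescopes

/-- Every two binary sequences have a digitwise disjunction. -/
def orSequence : Exp :=
  lam (Nat ⟶ₜ Bool) fun s => lam (Nat ⟶ₜ Bool) fun u => lam (U 0) fun C =>
  lam (pi (Nat ⟶ₜ Bool) fun v => orTele pi s u v fun _ _ _ => C) fun k =>
  k (lam Nat fun n => orDigit (s n) (u n))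
    (lam Nat fun n => boolRec 0 (fun b => Id 0 Bool (orDigit b (u n)) ff ⟶ₜ Id 0 Bool b ff)
      (lam (Id 0 Bool (u n) ff) fun _ => refl 0 Bool ff) (lam (Id 0 Bool tt ff) fun e => e) (s n))
    (lam Nat fun n => boolRec 0 (fun b => Id 0 Bool (orDigit b (u n)) ff ⟶ₜ Id 0 Bool (u n) ff)
      (lam (Id 0 Bool (u n) ff) fun e => e)
      (lam (Id 0 Bool tt ff) fun e => emptyElim 0 (Id 0 Bool (u n) ff) (ttNeFf e)) (s n))
    (lam Nat fun n => boolRec 1 (fun b => Id 0 Bool (orDigit b (u n)) tt ⟶ₜ pi (U 0) fun G =>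
        (Id 0 Bool b tt ⟶ₜ G) ⟶ₜ (Id 0 Bool (u n) tt ⟶ₜ G) ⟶ₜ G)
      (lam (Id 0 Bool (u n) tt) fun e => lam (U 0) fun G => lam (Id 0 Bool ff tt ⟶ₜ G) fun _ =>
        lam (Id 0 Bool (u n) tt ⟶ₜ G) fun g => g e)
      (lam (Id 0 Bool tt tt) fun e => lam (U 0) fun G => lam (Id 0 Bool tt tt ⟶ₜ G) fun g =>
        lam (Id 0 Bool (u n) tt ⟶ₜ G) fun _ => g e) (s n))

def orSequenceType : Exp :=
  pi (Nat ⟶ₜ Bool) fun s => pi (Nat ⟶ₜ Bool) fun u => pi (U 0) fun C =>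
  (pi (Nat ⟶ₜ Bool) fun v => orTele pi s u v fun _ _ _ => C) ⟶ₜ C

def lpoOfSemidec : Exp :=
  lam Brw fun α => lam (allZeroDec α) fun key => lam (semidecAt α) fun semidec => lam MP fun mp =>
  lam (Nat ⟶ₜ Bool) fun s =>
  let S := Sum 0 (hasOne s) (allZero s)
  sigElim 0 0 Brw (fun y => iff 0 (allZero s) (Le α y)) (fun _ => Trunc 0 S) (fun y e =>
    let P := Le α y
    semidec y (Trunc 0 S) (cst (.squash 0) S)
      (lam (Nat ⟶ₜ Bool) fun u => lam (P ⟶ₜ hasOne u) fun one_of =>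
      lam (hasOne u ⟶ₜ P) fun of_one =>
      orSequence s u (Trunc 0 S)
        (lam (Nat ⟶ₜ Bool) fun v => orTele lam s u v fun left right cases =>
        exElim 0 0 Nat (fun n => Id 0 Bool (v n) tt) (Trunc 0 S) (cst (.squash 0) S)
          (fun n q => cases n q (Trunc 0 S)
            (lam (Id 0 Bool (s n) tt) fun e => cst (.tr 0) S (cst (.inl 0) (hasOne s) (allZero s)
              (exIntro 0 Nat (fun n => Id 0 Bool (s n) tt) n e)))
            (lam (Id 0 Bool (u n) tt) fun q => cst (.tr 0) S (cst (.inr 0) (hasOne s) (allZero s)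
              (proj₂ 0 (allZero s ⟶ₜ P) (fun _ => P ⟶ₜ allZero s) e
                (of_one (exIntro 0 Nat (fun n => Id 0 Bool (u n) tt) n q))))))
          (mp v (lam (allZero v) fun h =>
            exElim 0 0 Nat (fun n => Id 0 Bool (u n) tt) Empty isPropEmpty
              (fun n q => ttNeFf
                (trans 0 Bool tt (u n) ff (symm 0 Bool (u n) tt q) (right n (h n))))
              (one_of (proj₁ 0 (allZero s ⟶ₜ P) (fun _ => P ⟶ₜ allZero s) e
                (lam Nat fun n => left n (h n)))))))))
    (key s)

def lpoOfSemidecType : Exp :=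
  pi Brw fun α => allZeroDec α ⟶ₜ semidecAt α ⟶ₜ MP ⟶ₜ LPO

/-! ## Ordinals with a given cofinal sequence -/

section Telescopes

variable (q : Exp → (Exp → Exp) → Exp)

/-- What is needed to know about the ordinals `a c k = ω · c + k` and `w = ω²`. -/
def omegaTele (body : Exp → Exp → Exp → Exp → Exp → Exp → Exp → Exp → Exp → Exp → Exp) : Exp :=
  q (Nat ⟶ₜ Nat ⟶ₜ Brw) fun a => q Brw fun w =>
  q (pi Nat fun c => incr (a c)) fun inc =>
  q (pi Nat fun c => pi Nat fun k => Le (a c (succ k)) (bsuc (a c k))) fun le_suc =>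
  q (pi Nat fun c => pi Nat fun k => Le (a c k) (a c k)) fun le_self =>
  q (pi Nat fun c => pi Nat fun k => Le (a c k) (a (succ c) zero)) fun le_next =>
  q (pi Nat fun c => Le (a (succ c) zero) (blim (a c) (inc c))) fun le_lim =>
  q (Le (a zero zero) bzero) fun le_zero =>
  q (pi Nat fun c => Le (a c zero) w) fun le_top =>
  q (pi Brw fun x => (pi Nat fun c => Le (a c zero) x) ⟶ₜ Le w x) fun top_le =>
  body a w inc le_suc le_self le_next le_lim le_zero le_top top_le

end Telescopes

/-- The ordinal `w` is not below any `a c 0`. -/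
def topBig (a w : Exp) : Exp := pi Nat fun n => Le w (a n zero) ⟶ₜ Empty

/-- The digit `b` of index `c` decides how the sequence constructed below continues. -/
def branch (x y b : Exp) : Exp := boolRec 0 (fun _ => Brw) x y b

/-- `stage s a m c` is `a (c + m) 0` if `s` is `0` between `c` and `c + m`, and `a d (c + m - d)`
if the first digit `1` of `s` there has index `d`. -/
def stage (s a m c : Exp) : Exp :=
  natRec 0 (fun _ => Nat ⟶ₜ Brw) (lam Nat fun c => a c zero)
    (fun m g => lam Nat fun c => branch (g (succ c)) (a c (succ m)) (s c)) m c

section Telescopes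

variable (q : Exp → (Exp → Exp) → Exp)

/-- What is needed to know about `f m c = stage s a m c` and the limit `y` of the `f m 0`. -/
def stageTele (a s : Exp) (body : Exp → Exp → Exp → Exp → Exp → Exp → Exp → Exp → Exp) : Exp :=
  q (Nat ⟶ₜ Nat ⟶ₜ Brw) fun f => q Brw fun y =>
  q (pi Nat fun m => Le (f m zero) y) fun below =>
  q (pi Brw fun x => (pi Nat fun m => Le (f m zero) x) ⟶ₜ Le y x) fun least =>
  q (pi Nat fun c => Le (a c zero) (f zero c)) fun start_le =>
  q (pi Nat fun c => Le (f zero c) (a c zero)) fun le_start =>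
  q (pi Nat fun m => pi Nat fun c => Id 0 Bool (s c) ff ⟶ₜ
    Prod 0 (Le (f m (succ c)) (f (succ m) c)) (Le (f (succ m) c) (f m (succ c)))) fun skip =>
  q (pi Nat fun m => pi Nat fun c => Id 0 Bool (s c) tt ⟶ₜ
    Le (f (succ m) c) (a c (succ m))) fun stay =>
  body f y below least start_le le_start skip stay

end Telescopes

def stageIncr : Exp :=
  omegaTele lam fun a _ inc _ _ le_next _ _ _ _ => lam (Nat ⟶ₜ Bool) fun s => lam Nat fun m =>
  let F := stage s a
  natRec 0 (fun m => pi Nat fun c => Le (bsuc (F m c)) (F (succ m) c))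
    (lam Nat fun c =>
      boolRec 0 (fun b => Le (bsuc (a c zero)) (branch (F zero (succ c)) (a c (succ zero)) b))
        (leTrans (bsuc (a c zero)) (a c (succ zero)) (a (succ c) zero) (inc c zero)
          (le_next c (succ zero)))
        (inc c zero) (s c))
    (fun m ih => lam Nat fun c =>
      boolRec 0 (fun b => Le (bsuc (branch (F m (succ c)) (a c (succ m)) b))
          (branch (F (succ m) (succ c)) (a c (succ (succ m))) b))
        (ih (succ c)) (inc c (succ m)) (s c)) m

def stageIncrType : Exp :=
  omegaTele pi fun a _ _ _ _ _ _ _ _ _ => pi (Nat ⟶ₜ Bool) fun s => pi Nat fun m => pi Nat fun c =>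
  Le (bsuc (stage s a m c)) (stage s a (succ m) c)

def stageRefl : Exp :=
  omegaTele lam fun a _ _ _ le_self _ _ _ _ _ => lam (Nat ⟶ₜ Bool) fun s => lam Nat fun m =>
  let F := stage s a
  natRec 0 (fun m => pi Nat fun c => Le (F m c) (F m c))
    (lam Nat fun c => le_self c zero)
    (fun m ih => lam Nat fun c =>
      boolRec 0 (fun b => Le (branch (F m (succ c)) (a c (succ m)) b)
          (branch (F m (succ c)) (a c (succ m)) b))
        (ih (succ c)) (le_self c (succ m)) (s c)) m

def stageReflType : Exp :=
  omegaTele pi fun a _ _ _ _ _ _ _ _ _ => pi (Nat ⟶ₜ Bool) fun s => pi Nat fun m => pi Nat fun c =>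
  Le (stage s a m c) (stage s a m c)

/-- A strictly increasing sequence has a least upper bound. -/
def leastUpperBound : Exp :=
  lam (Nat ⟶ₜ Brw) fun f => lam (incr f) fun p => lam (U 0) fun C =>
  lam (pi Brw fun y => (pi Brw fun x => pi Nat fun k => Le x (f k) ⟶ₜ Le x y) ⟶ₜ
    (pi Brw fun x => (pi Nat fun k => Le (f k) x) ⟶ₜ Le y x) ⟶ₜ C) fun k =>
  k (blim f p) (cst .leCocone f p) (cst .leLimiting f p)

def leastUpperBoundType : Exp :=
  pi (Nat ⟶ₜ Brw) fun f => pi (incr f) fun _ => pi (U 0) fun C =>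
  (pi Brw fun y => (pi Brw fun x => pi Nat fun k => Le x (f k) ⟶ₜ Le x y) ⟶ₜ
    (pi Brw fun x => (pi Nat fun k => Le (f k) x) ⟶ₜ Le y x) ⟶ₜ C) ⟶ₜ C

/-- The sequence `f` satisfies the equations of `stage`. -/
def stageSystem : Exp :=
  omegaTele lam fun a w inc le_suc le_self le_next le_lim le_zero le_top top_le =>
  lam (Nat ⟶ₜ Bool) fun s => lam (U 0) fun C =>
  lam (stageTele pi a s fun _ _ _ _ _ _ _ _ => C) fun k =>
  let F := stage s a
  let reflF := fun m c =>
    stageRefl a w inc le_suc le_self le_next le_lim le_zero le_top top_le s m c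
  let incF := fun m c =>
    stageIncr a w inc le_suc le_self le_next le_lim le_zero le_top top_le s m c
  let f := lam Nat fun m => F m zero
  leastUpperBound f (lam Nat fun m => incF m zero) C
    (lam Brw fun y => lam (pi Brw fun x => pi Nat fun k => Le x (f k) ⟶ₜ Le x y) fun cocone =>
    lam (pi Brw fun x => (pi Nat fun k => Le (f k) x) ⟶ₜ Le y x) fun limiting =>
    k (lam Nat fun m => lam Nat fun c => F m c) y
      (lam Nat fun m => cocone (F m zero) m (reflF m zero))
      limiting
      (lam Nat fun c => le_self c zero)
      (lam Nat fun c => le_self c zero)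
      (lam Nat fun m => lam Nat fun c => lam (Id 0 Bool (s c) ff) fun e =>
        let x := F m (succ c)
        let F' := branch x (a c (succ m))
        subst 0 0 Bool (fun b => Prod 0 (Le x (F' b)) (Le (F' b) x))
          ff (s c) (symm 0 Bool (s c) ff e)
          (mkPair 0 (Le x x) (fun _ => Le x x) (reflF m (succ c)) (reflF m (succ c))))
      (lam Nat fun m => lam Nat fun c => lam (Id 0 Bool (s c) tt) fun e =>
        subst 0 0 Bool (fun b => Le (branch (F m (succ c)) (a c (succ m)) b) (a c (succ m)))
          tt (s c) (symm 0 Bool (s c) tt e) (le_self c (succ m))))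

def stageSystemType : Exp :=
  omegaTele pi fun a _ _ _ _ _ _ _ _ _ => pi (Nat ⟶ₜ Bool) fun s => pi (U 0) fun C =>
  (stageTele pi a s fun _ _ _ _ _ _ _ _ => C) ⟶ₜ C

def allZeroDecOfStage : Exp :=
  omegaTele lam fun a w _ _ _ le_next _ _ _ top_le =>
  lam (topBig a w) fun big => lam (Nat ⟶ₜ Bool) fun s =>
  stageTele lam a s fun f y below least start_le le_start skip stay =>
  let fwd := lam (allZero s) fun h => top_le y (lam Nat fun c =>
    leTrans (a c zero) (f zero c) y (start_le c)
      (natRec 0 (fun c => pi Nat fun j => Le (f j c) y) below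
        (fun c ih => lam Nat fun j =>
          leTrans (f j (succ c)) (f (succ j) c) y
            (proj₁ 0 (Le (f j (succ c)) (f (succ j) c)) (fun _ => Le (f (succ j) c) (f j (succ c)))
              (skip j c (h c)))
            (ih (succ j))) c zero))
  let bwd := lam (Le w y) fun e => lam Nat fun n =>
    let z := a (succ n) zero
    let above := fun c => pi Nat fun m => Le (f m c) z
    let start := fun q => lam Nat fun m => natRec 0 (fun m => Le (f m n) z)
      (leTrans (f zero n) (a n zero) z (le_start n) (le_next n zero))
      (fun m _ => leTrans (f (succ m) n) (a n (succ m)) z (stay m n q) (le_next n (succ m))) m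
    let down := natRec 0 (fun c => above c ⟶ₜ above zero) (lam (above zero) fun g => g)
      (fun c ih => lam (above (succ c)) fun g => ih (lam Nat fun m =>
        let next := fun k => leTrans (a c k) (a (succ c) zero) z (le_next c k)
          (leTrans (a (succ c) zero) (f zero (succ c)) z (start_le (succ c)) (g zero))
        natRec 0 (fun m => Le (f m c) z)
          (leTrans (f zero c) (a c zero) z (le_start c) (next zero))
          (fun m _ => boolRec 0 (fun b => Id 0 Bool (s c) b ⟶ₜ Le (f (succ m) c) z)
            (lam (Id 0 Bool (s c) ff) fun q =>
              leTrans (f (succ m) c) (f m (succ c)) z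
                (proj₂ 0 (Le (f m (succ c)) (f (succ m) c))
                  (fun _ => Le (f (succ m) c) (f m (succ c))) (skip m c q)) (g m))
            (lam (Id 0 Bool (s c) tt) fun q =>
              leTrans (f (succ m) c) (a c (succ m)) z (stay m c q) (next (succ m)))
            (s c) (refl 0 Bool (s c))) m)) n
    boolRec 0 (fun b => Id 0 Bool (s n) b ⟶ₜ Id 0 Bool b ff)
      (lam (Id 0 Bool (s n) ff) fun _ => refl 0 Bool ff)
      (lam (Id 0 Bool (s n) tt) fun q => emptyElim 0 (Id 0 Bool tt ff)
        (big (succ n) (leTrans w y z e (least z (down (start q))))))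
      (s n) (refl 0 Bool (s n))
  mkPair 0 Brw (fun y => iff 0 (allZero s) (Le w y)) y
    (mkPair 0 (allZero s ⟶ₜ Le w y) (fun _ => Le w y ⟶ₜ allZero s) fwd bwd)

def allZeroDecOfStageType : Exp :=
  omegaTele pi fun a w _ _ _ _ _ _ _ _ =>
  topBig a w ⟶ₜ pi (Nat ⟶ₜ Bool) fun s => stageTele pi a s fun _ _ _ _ _ _ _ _ =>
  Sig 0 Brw (lam Brw fun y => iff 0 (allZero s) (Le w y))

def allZeroDecOfTop : Exp :=
  omegaTele lam fun a w inc le_suc le_self le_next le_lim le_zero le_top top_le =>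
  lam (topBig a w) fun big => lam (Nat ⟶ₜ Bool) fun s =>
  stageSystem a w inc le_suc le_self le_next le_lim le_zero le_top top_le s
    (Sig 0 Brw (lam Brw fun y => iff 0 (allZero s) (Le w y)))
    (allZeroDecOfStage a w inc le_suc le_self le_next le_lim le_zero le_top top_le big s)

def allZeroDecOfTopType : Exp :=
  omegaTele pi fun a w _ _ _ _ _ _ _ _ => topBig a w ⟶ₜ allZeroDec w

/-! ## The top element is not below its predecessors -/

section Telescopes

variable (q : Exp → (Exp → Exp) → Exp)

/-- A monotone map `Φ` from ordinals to predicates on pairs of natural numbers, where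
`Φ x i j` means that `ω · i + j < x`. -/
def heightTele
    (body : Exp → Exp → Exp → Exp → Exp → Exp → Exp → Exp → Exp → Exp → Exp) : Exp :=
  q (Brw ⟶ₜ Nat ⟶ₜ Nat ⟶ₜ U 0) fun Φ =>
  q (pi Brw fun x => pi Nat fun i => pi Nat fun j => isProp 0 (Φ x i j)) fun isP =>
  q (pi Brw fun x => pi Brw fun y => Le x y ⟶ₜ
    pi Nat fun i => pi Nat fun j => Φ x i j ⟶ₜ Φ y i j) fun mono =>
  q (pi Nat fun i => pi Nat fun j => Φ bzero i j ⟶ₜ Empty) fun not_zero =>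
  q (pi Brw fun x => Φ (bsuc x) zero zero) fun suc_zero =>
  q (pi Brw fun x => pi Nat fun i => (pi Nat fun j => Φ x i j) ⟶ₜ Φ (bsuc x) (succ i) zero)
    fun suc_row =>
  q (pi Brw fun x => pi Nat fun i => pi Nat fun j => Φ x i j ⟶ₜ Φ (bsuc x) i (succ j))
    fun suc_col =>
  q (pi Brw fun x => pi Nat fun i => Φ (bsuc x) (succ i) zero ⟶ₜ pi Nat fun j => Φ x i j)
    fun of_row =>
  q (pi Brw fun x => pi Nat fun i => pi Nat fun j => Φ (bsuc x) i (succ j) ⟶ₜ Φ x i j)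
    fun of_col =>
  q (pi (Nat ⟶ₜ Brw) fun f => pi (incr f) fun p => pi Nat fun i => pi Nat fun j =>
    Φ (blim f p) i j ⟶ₜ ex 0 Nat fun n => Φ (f n) i j) fun of_lim =>
  body Φ isP mono not_zero suc_zero suc_row suc_col of_row of_col of_lim

end Telescopes

/-- `Φ x i j` for all `i` and `j`. -/
def full (Φ x : Exp) : Exp := pi Nat fun i => pi Nat fun j => Φ x i j

def ltSelf : Exp :=
  omegaTele lam fun a _ inc le_suc _ le_next le_lim le_zero _ _ =>
  let lt := fun c k => Le (a c k) (bsuc (a c k))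
  let row := fun c h => lam Nat fun k => natRec 0 (fun k => lt c k) h
    (fun k ih => leTrans (a c (succ k)) (bsuc (a c k)) (bsuc (a c (succ k))) (le_suc c k)
      (cst .leSuc (a c k) (a c (succ k))
        (leTrans (a c k) (bsuc (a c k)) (a c (succ k)) ih (inc c k)))) k
  lam Nat fun c => natRec 0 (fun c => pi Nat fun k => lt c k)
    (row zero (leTrans (a zero zero) bzero (bsuc (a zero zero)) le_zero
      (cst .leZero (bsuc (a zero zero)))))
    (fun c ih => row (succ c)
      (leTrans (a (succ c) zero) (blim (a c) (inc c)) (bsuc (a (succ c) zero)) (le_lim c)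
        (cst .leLimiting (a c) (inc c) (bsuc (a (succ c) zero)) (lam Nat fun k =>
          leTrans (a c k) (bsuc (a c k)) (bsuc (a (succ c) zero)) (ih k)
            (cst .leSuc (a c k) (a (succ c) zero) (le_next c k)))))) c

def ltSelfType : Exp :=
  omegaTele pi fun a _ _ _ _ _ _ _ _ _ =>
  pi Nat fun c => pi Nat fun k => Le (a c k) (bsuc (a c k))

def fullOfSucLe : Exp :=
  heightTele lam fun Φ _ mono _ suc_zero suc_row suc_col _ _ _ =>
  lam Brw fun x => lam (Le (bsuc x) x) fun h =>
  let row := fun i h0 => lam Nat fun j => natRec 0 (fun j => Φ x i j)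
    (mono (bsuc x) x h i zero h0)
    (fun j ih => mono (bsuc x) x h i (succ j) (suc_col x i j ih)) j
  lam Nat fun i => natRec 0 (fun i => pi Nat fun j => Φ x i j)
    (row zero (suc_zero x)) (fun i ih => row (succ i) (suc_row x i ih)) i

def fullOfSucLeType : Exp :=
  heightTele pi fun Φ _ _ _ _ _ _ _ _ _ => pi Brw fun x => Le (bsuc x) x ⟶ₜ full Φ x

def fullPred : Exp :=
  heightTele lam fun Φ isP mono _ _ _ _ of_row of_col of_lim =>
  omegaTele lam fun a _ inc le_suc _ _ le_lim _ _ _ =>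
  lam (pi Nat fun c => pi Nat fun k => Le (a c k) (bsuc (a c k))) fun lt_self =>
  lam Nat fun c => lam (full Φ (a (succ c) zero)) fun h => lam Nat fun i => lam Nat fun j =>
  let row := fun k => pi Nat fun j => Φ (a c k) i j
  exElim 0 0 Nat (fun k => Φ (a c k) (succ i) zero) (Φ (a c zero) i j) (isP (a c zero) i j)
    (fun k e => natRec 0 (fun k => row k ⟶ₜ row zero)
      (lam (row zero) fun g => g)
      (fun k ih => lam (row (succ k)) fun g => ih (lam Nat fun j =>
        of_col (a c k) i j
          (mono (a c (succ k)) (bsuc (a c k)) (le_suc c k) i (succ j) (g (succ j))))) k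
      (of_row (a c k) i (mono (a c k) (bsuc (a c k)) (lt_self c k) (succ i) zero e)) j)
    (of_lim (a c) (inc c) (succ i) zero
      (mono (a (succ c) zero) (blim (a c) (inc c)) (le_lim c) (succ i) zero (h (succ i) zero)))

def fullPredType : Exp :=
  heightTele pi fun Φ _ _ _ _ _ _ _ _ _ => omegaTele pi fun a _ _ _ _ _ _ _ _ _ =>
  (pi Nat fun c => pi Nat fun k => Le (a c k) (bsuc (a c k))) ⟶ₜ
  pi Nat fun c => full Φ (a (succ c) zero) ⟶ₜ full Φ (a c zero)

def topBigOfHeight : Exp :=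
  heightTele lam fun Φ isP mono not_zero suc_zero suc_row suc_col of_row of_col of_lim =>
  omegaTele lam fun a w inc le_suc le_self le_next le_lim le_zero le_top top_le =>
  lam Nat fun n => lam (Le w (a n zero)) fun e =>
    natRec 0 (fun n => full Φ (a n zero) ⟶ₜ Empty)
      (lam (full Φ (a zero zero)) fun h =>
        not_zero zero zero (mono (a zero zero) bzero le_zero zero zero (h zero zero)))
      (fun n ih => lam (full Φ (a (succ n) zero)) fun h => ih
        (fullPred Φ isP mono not_zero suc_zero suc_row suc_col of_row of_col of_lim
          a w inc le_suc le_self le_next le_lim le_zero le_top top_le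
          (ltSelf a w inc le_suc le_self le_next le_lim le_zero le_top top_le) n h)) n
      (fullOfSucLe Φ isP mono not_zero suc_zero suc_row suc_col of_row of_col of_lim (a n zero)
        (leTrans (bsuc (a n zero)) (a n (succ zero)) (a n zero) (inc n zero)
          (leTrans (a n (succ zero)) (a (succ n) zero) (a n zero) (le_next n (succ zero))
            (leTrans (a (succ n) zero) w (a n zero) (le_top (succ n)) e))))

def topBigOfHeightType : Exp :=
  heightTele pi fun _ _ _ _ _ _ _ _ _ _ => omegaTele pi fun a w _ _ _ _ _ _ _ _ => topBig a w

def allZeroDecOfHeight : Exp :=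
  heightTele lam fun Φ isP mono not_zero suc_zero suc_row suc_col of_row of_col of_lim =>
  omegaTele lam fun a w inc le_suc le_self le_next le_lim le_zero le_top top_le =>
  allZeroDecOfTop a w inc le_suc le_self le_next le_lim le_zero le_top top_le
    (topBigOfHeight Φ isP mono not_zero suc_zero suc_row suc_col of_row of_col of_lim
      a w inc le_suc le_self le_next le_lim le_zero le_top top_le)

def allZeroDecOfHeightType : Exp :=
  heightTele pi fun _ _ _ _ _ _ _ _ _ _ => omegaTele pi fun _ w _ _ _ _ _ _ _ _ => allZeroDec w


/-! ## The multiples of `ω`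

The terms in this section agree with those in the definition of `omegaSq`, except that closed
subterms are used for the addition of `ω`. -/

/-- Ordinals `x` with a proof of `x ≤ x`. -/
def Diag : Exp := Sig 0 Brw leDiag

def diagPair : Exp := cst (.pair 0) Brw leDiag

def diagFst : Exp :=
  cst (.sigInd 0 0) Brw leDiag (lam Diag fun _ => Brw) (lam Brw fun a => lam (leDiag a) fun _ => a)

def diagSnd : Exp :=
  cst (.sigInd 0 0) Brw leDiag (lam Diag fun p => leDiag (diagFst p))
    (lam Brw fun a => lam (leDiag a) fun b => b)

def diagFstType : Exp := Diag ⟶ₜ Brw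

def diagSndType : Exp := pi Diag fun z => Le (diagFst z) (diagFst z)

/-- Statements about all ordinals `x` with a proof `r : x ≤ x`. -/
def diagTele (q : Exp → (Exp → Exp) → Exp) (body : Exp → Exp → Exp) : Exp :=
  q Brw fun x => q (Le x x) fun r => body x r

def addNatSelf : Exp := diagTele lam fun x r => lam Nat fun k => addNatRefl x r k

def addNatSelfType : Exp := diagTele pi fun x _ => pi Nat fun k => Le (addNat x k) (addNat x k)

def addNatLeSuc : Exp := diagTele lam fun x r => lam Nat fun k => addNatSelf x r (succ k)

def addNatLeSucType : Exp :=
  diagTele pi fun x _ => pi Nat fun k => Le (addNat x (succ k)) (bsuc (addNat x k))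

def addNatIncr : Exp := diagTele lam fun x r => addSeqIncr x r

def addNatIncrType : Exp :=
  diagTele pi fun x _ => pi Nat fun k => Le (bsuc (addNat x k)) (addNat x (succ k))

/-- `x + ω`. -/
def addLimit : Exp := diagTele lam addOmega

def addLimitType : Exp := diagTele pi fun _ _ => Brw

def addLimitSelf : Exp := diagTele lam addOmegaRefl

def addLimitSelfType : Exp := diagTele pi fun x r => Le (addLimit x r) (addLimit x r)

def addLimitLe : Exp := diagTele lam fun x r => addLimitSelf x r

def addLimitLeType : Exp :=
  diagTele pi fun x r => Le (addLimit x r) (blim (lam Nat fun k => addNat x k) (addNatIncr x r))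

def addNatLeLimit : Exp :=
  diagTele lam fun x r => lam Nat fun k =>
  cst .leCocone (addSeq x) (addSeqIncr x r) (addNat x k) k (addNatRefl x r k)

def addNatLeLimitType : Exp :=
  diagTele pi fun x r => pi Nat fun k => Le (addNat x k) (addLimit x r)

/-- `x + 1 ≤ x + ω`. -/
def sucLeLimit : Exp :=
  diagTele lam fun x r =>
  cst .leCocone (addSeq x) (addSeqIncr x r) (bsuc x) (succ zero) (addNatRefl x r (succ zero))

def sucLeLimitType : Exp := diagTele pi fun x r => Le (bsuc x) (addLimit x r)

/-- `ω · n` with a proof of `ω · n ≤ ω · n`, as a function of `n`. -/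
def multiple : Exp :=
  cst (.natInd 0) (lam Nat fun _ => Diag) (diagPair bzero (cst .leZero bzero))
    (lam Nat fun _ => lam Diag fun z =>
      diagPair (addLimit (diagFst z) (diagSnd z)) (addLimitSelf (diagFst z) (diagSnd z)))

def multipleType : Exp := Nat ⟶ₜ Diag

/-- The ordinal `ω · n` -/
def mul (n : Exp) : Exp := diagFst (multiple n)

def mulSelf (n : Exp) : Exp := diagSnd (multiple n)

def mulSucc (n : Exp) : Exp := addLimit (mul n) (mulSelf n)

/-- Statements about all predicates `P` on ordinals. -/
def predTele (q : Exp → (Exp → Exp) → Exp) (body : Exp → Exp) : Exp := q (Brw ⟶ₜ U 0) body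

def toFstPair : Exp := predTele lam fun P => diagTele lam fun x _ => lam (P x) fun u => u

def toFstPairType : Exp :=
  predTele pi fun P => diagTele pi fun x r => P x ⟶ₜ P (diagFst (diagPair x r))

def multipleSucc (n : Exp) : Exp :=
  diagPair (mulSucc n) (addLimitSelf (mul n) (mulSelf n))

def toMultipleSucc : Exp :=
  lam (Diag ⟶ₜ U 0) fun P => lam Nat fun n => lam (P (multipleSucc n)) fun u => u

def toMultipleSuccType : Exp :=
  pi (Diag ⟶ₜ U 0) fun P => pi Nat fun n => P (multipleSucc n) ⟶ₜ P (multiple (succ n))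

def multipleZero : Exp :=
  lam (Diag ⟶ₜ U 0) fun P => lam (P (diagPair bzero (cst .leZero bzero))) fun u => u

def multipleZeroType : Exp :=
  pi (Diag ⟶ₜ U 0) fun P => P (diagPair bzero (cst .leZero bzero)) ⟶ₜ P (multiple zero)

def toMulSucc : Exp :=
  predTele lam fun P => lam Nat fun n => lam (P (mulSucc n)) fun u =>
  toMultipleSucc (lam Diag fun z => P (diagFst z)) n
    (toFstPair P (mulSucc n) (addLimitSelf (mul n) (mulSelf n)) u)

def toMulSuccType : Exp :=
  predTele pi fun P => pi Nat fun n => P (mulSucc n) ⟶ₜ P (mul (succ n))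

def mulZeroLe : Exp :=
  multipleZero (lam Diag fun z => Le (diagFst z) bzero)
    (toFstPair (lam Brw fun x => Le x bzero) bzero (cst .leZero bzero) (cst .leZero bzero))

def mulZeroLeType : Exp := Le (mul zero) bzero

def mulIncr : Exp := lam Nat fun n => sucLeLimit (mul n) (mulSelf n)

def mulIncrType : Exp := incr (lam Nat mul)

def mulLimit : Exp := blim (lam Nat mul) mulIncr

def mulLimitType : Exp := Brw

def mulLeMulLimit : Exp :=
  lam Nat fun n => cst .leCocone (lam Nat mul) mulIncr (mul n) n (mulSelf n)

def mulLeMulLimitType : Exp := pi Nat fun n => Le (mul n) mulLimit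

def mulLimitLe : Exp := cst .leLimiting (lam Nat mul) mulIncr

def mulLimitLeType : Exp :=
  pi Brw fun x => (pi Nat fun n => Le (mul n) x) ⟶ₜ Le mulLimit x

/-- A sequence `m` that satisfies the equations of `ω · n`, and its limit `w`. -/
def multipleTele (q : Exp → (Exp → Exp) → Exp)
    (body : Exp → Exp → Exp → Exp → Exp → Exp → Exp → Exp) : Exp :=
  q (Nat ⟶ₜ Brw) fun m => q (pi Nat fun n => Le (m n) (m n)) fun self =>
  q (predTele pi fun P => pi Nat fun n => P (addLimit (m n) (self n)) ⟶ₜ P (m (succ n)))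
    fun to_succ =>
  q (Le (m zero) bzero) fun zero_le => q Brw fun w => q (pi Nat fun n => Le (m n) w) fun le_lim =>
  q (pi Brw fun x => (pi Nat fun n => Le (m n) x) ⟶ₜ Le w x) fun lim_le =>
  body m self to_succ zero_le w le_lim lim_le

/-- The ordinals `m c + k` and `w` satisfy the assumptions of `omegaTele`. -/
def allZeroDecOfMultiple : Exp :=
  heightTele lam fun a b c d e f g h i j =>
  multipleTele lam fun m self to_succ zero_le w le_lim lim_le =>
  allZeroDecOfHeight a b c d e f g h i j (lam Nat fun c => lam Nat fun k => addNat (m c) k) w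
    (lam Nat fun c => addNatIncr (m c) (self c))
    (lam Nat fun c => addNatLeSuc (m c) (self c))
    (lam Nat fun c => addNatSelf (m c) (self c))
    (lam Nat fun c => lam Nat fun k =>
      to_succ (lam Brw fun z => Le (addNat (m c) k) z) c (addNatLeLimit (m c) (self c) k))
    (lam Nat fun c =>
      to_succ (lam Brw fun z => Le z (blim (lam Nat fun k => addNat (m c) k)
        (addNatIncr (m c) (self c)))) c (addLimitLe (m c) (self c)))
    zero_le le_lim lim_le

def allZeroDecOfMultipleType : Exp :=
  heightTele pi fun _ _ _ _ _ _ _ _ _ _ => multipleTele pi fun _ _ _ _ w _ _ => allZeroDec w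

def allZeroDecMulLimit : Exp :=
  heightTele lam fun a b c d e f g h i j =>
  allZeroDecOfMultiple a b c d e f g h i j (lam Nat mul) (lam Nat mulSelf) toMulSucc mulZeroLe
    mulLimit mulLeMulLimit mulLimitLe

def allZeroDecMulLimitType : Exp :=
  heightTele pi fun _ _ _ _ _ _ _ _ _ _ => allZeroDec mulLimit


/-! ## Typing of the terms about ordinals -/

theorem hasType_orSequence : HasType [] orSequence.close orSequenceType.close :=
  Checks.hasType (l := [])
    (by decide +kernel)
    TypeTable.nil

theorem hasType_lpoOfSemidec : HasType [] lpoOfSemidec.close lpoOfSemidecType.close :=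
  Checks.hasType (l := [entry orSequence orSequenceType])
    (by decide +kernel)
    (TypeTable.nil.cons hasType_orSequence)

theorem hasType_stageIncr : HasType [] stageIncr.close stageIncrType.close :=
  Checks.hasType (l := [])
    (by decide +kernel)
    TypeTable.nil

theorem hasType_stageRefl : HasType [] stageRefl.close stageReflType.close :=
  Checks.hasType (l := [])
    (by decide +kernel)
    TypeTable.nil

theorem hasType_leastUpperBound : HasType [] leastUpperBound.close leastUpperBoundType.close :=
  Checks.hasType (l := [])
    (by decide +kernel)
    TypeTable.nil

theorem hasType_stageSystem : HasType [] stageSystem.close stageSystemType.close :=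
  Checks.hasType (l := [entry stageIncr stageIncrType, entry stageRefl stageReflType, entry
      leastUpperBound leastUpperBoundType])
    (by decide +kernel)
    (((TypeTable.nil.cons hasType_leastUpperBound).cons hasType_stageRefl).cons
      hasType_stageIncr)

theorem hasType_allZeroDecOfStage :
    HasType [] allZeroDecOfStage.close allZeroDecOfStageType.close :=
  Checks.hasType (l := [])
    (by decide +kernel)
    TypeTable.nil

theorem hasType_allZeroDecOfTop : HasType [] allZeroDecOfTop.close allZeroDecOfTopType.close :=
  Checks.hasType (l := [entry stageSystem stageSystemType, entry allZeroDecOfStage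
      allZeroDecOfStageType])
    (by decide +kernel)
    ((TypeTable.nil.cons hasType_allZeroDecOfStage).cons hasType_stageSystem)

theorem hasType_ltSelf : HasType [] ltSelf.close ltSelfType.close :=
  Checks.hasType (l := [])
    (by decide +kernel)
    TypeTable.nil

theorem hasType_fullOfSucLe : HasType [] fullOfSucLe.close fullOfSucLeType.close :=
  Checks.hasType (l := [])
    (by decide +kernel)
    TypeTable.nil

theorem hasType_fullPred : HasType [] fullPred.close fullPredType.close :=
  Checks.hasType (l := [])
    (by decide +kernel)
    TypeTable.nil

theorem hasType_topBigOfHeight : HasType [] topBigOfHeight.close topBigOfHeightType.close :=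
  Checks.hasType (l := [entry ltSelf ltSelfType, entry fullOfSucLe fullOfSucLeType, entry
      fullPred fullPredType])
    (by decide +kernel)
    (((TypeTable.nil.cons hasType_fullPred).cons hasType_fullOfSucLe).cons hasType_ltSelf)

theorem hasType_allZeroDecOfHeight :
    HasType [] allZeroDecOfHeight.close allZeroDecOfHeightType.close :=
  Checks.hasType (l := [entry allZeroDecOfTop allZeroDecOfTopType, entry topBigOfHeight
      topBigOfHeightType])
    (by decide +kernel)
    ((TypeTable.nil.cons hasType_topBigOfHeight).cons hasType_allZeroDecOfTop)

theorem hasType_diagFst : HasType [] diagFst.close diagFstType.close :=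
  Checks.hasType (l := [])
    (by decide +kernel)
    TypeTable.nil

theorem hasType_diagSnd : HasType [] diagSnd.close diagSndType.close :=
  Checks.hasType (l := [entry diagFst diagFstType])
    (by decide +kernel)
    (TypeTable.nil.cons hasType_diagFst)

theorem hasType_addNatSelf : HasType [] addNatSelf.close addNatSelfType.close :=
  Checks.hasType (l := [])
    (by decide +kernel)
    TypeTable.nil

theorem hasType_addNatLeSuc : HasType [] addNatLeSuc.close addNatLeSucType.close :=
  Checks.hasType (l := [entry addNatSelf addNatSelfType])
    (by decide +kernel)
    (TypeTable.nil.cons hasType_addNatSelf)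

theorem hasType_addNatIncr : HasType [] addNatIncr.close addNatIncrType.close :=
  Checks.hasType (l := [])
    (by decide +kernel)
    TypeTable.nil

theorem hasType_addLimit : HasType [] addLimit.close addLimitType.close :=
  Checks.hasType (l := [])
    (by decide +kernel)
    TypeTable.nil

theorem hasType_addLimitSelf : HasType [] addLimitSelf.close addLimitSelfType.close :=
  Checks.hasType (l := [])
    (by decide +kernel)
    TypeTable.nil

theorem hasType_addLimitLe : HasType [] addLimitLe.close addLimitLeType.close :=
  Checks.hasType (l := [entry addLimitSelf addLimitSelfType])
    (by decide +kernel)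
    (TypeTable.nil.cons hasType_addLimitSelf)

theorem hasType_addNatLeLimit : HasType [] addNatLeLimit.close addNatLeLimitType.close :=
  Checks.hasType (l := [])
    (by decide +kernel)
    TypeTable.nil

theorem hasType_sucLeLimit : HasType [] sucLeLimit.close sucLeLimitType.close :=
  Checks.hasType (l := [])
    (by decide +kernel)
    TypeTable.nil

theorem hasType_multiple : HasType [] multiple.close multipleType.close :=
  Checks.hasType (l := [entry diagFst diagFstType, entry diagSnd diagSndType, entry addLimit
      addLimitType, entry addLimitSelf addLimitSelfType])
    (by decide +kernel)
    ((((TypeTable.nil.cons hasType_addLimitSelf).cons hasType_addLimit).cons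
      hasType_diagSnd).cons hasType_diagFst)

theorem hasType_toFstPair : HasType [] toFstPair.close toFstPairType.close :=
  Checks.hasType (l := [entry diagFst diagFstType, entry diagSnd diagSndType])
    (by decide +kernel)
    ((TypeTable.nil.cons hasType_diagSnd).cons hasType_diagFst)

theorem hasType_toMultipleSucc : HasType [] toMultipleSucc.close toMultipleSuccType.close :=
  Checks.hasType (l := [entry diagFst diagFstType, entry diagSnd diagSndType, entry addLimit
      addLimitType, entry addLimitSelf addLimitSelfType, entry multiple multipleType])
    (by decide +kernel)
    (((((TypeTable.nil.cons hasType_multiple).cons hasType_addLimitSelf).cons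
      hasType_addLimit).cons hasType_diagSnd).cons hasType_diagFst)

theorem hasType_multipleZero : HasType [] multipleZero.close multipleZeroType.close :=
  Checks.hasType (l := [entry diagFst diagFstType, entry diagSnd diagSndType, entry addLimit
      addLimitType, entry addLimitSelf addLimitSelfType, entry multiple multipleType])
    (by decide +kernel)
    (((((TypeTable.nil.cons hasType_multiple).cons hasType_addLimitSelf).cons
      hasType_addLimit).cons hasType_diagSnd).cons hasType_diagFst)

theorem hasType_toMulSucc : HasType [] toMulSucc.close toMulSuccType.close :=
  Checks.hasType (l := [entry diagFst diagFstType, entry diagSnd diagSndType, entry addLimit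
      addLimitType, entry addLimitSelf addLimitSelfType, entry multiple multipleType, entry
      toMultipleSucc toMultipleSuccType, entry toFstPair toFstPairType])
    (by decide +kernel)
    (((((((TypeTable.nil.cons hasType_toFstPair).cons hasType_toMultipleSucc).cons
      hasType_multiple).cons hasType_addLimitSelf).cons hasType_addLimit).cons
      hasType_diagSnd).cons hasType_diagFst)

theorem hasType_mulZeroLe : HasType [] mulZeroLe.close mulZeroLeType.close :=
  Checks.hasType (l := [entry diagFst diagFstType, entry diagSnd diagSndType, entry addLimit
      addLimitType, entry addLimitSelf addLimitSelfType, entry multiple multipleType, entry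
      multipleZero multipleZeroType, entry toFstPair toFstPairType])
    (by decide +kernel)
    (((((((TypeTable.nil.cons hasType_toFstPair).cons hasType_multipleZero).cons
      hasType_multiple).cons hasType_addLimitSelf).cons hasType_addLimit).cons
      hasType_diagSnd).cons hasType_diagFst)

theorem hasType_mulIncr : HasType [] mulIncr.close mulIncrType.close :=
  Checks.hasType (l := [entry diagFst diagFstType, entry diagSnd diagSndType, entry addLimit
      addLimitType, entry addLimitSelf addLimitSelfType, entry multiple multipleType, entry
      sucLeLimit sucLeLimitType])
    (by decide +kernel)
    ((((((TypeTable.nil.cons hasType_sucLeLimit).cons hasType_multiple).cons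
      hasType_addLimitSelf).cons hasType_addLimit).cons hasType_diagSnd).cons hasType_diagFst)

theorem hasType_mulLimit : HasType [] mulLimit.close mulLimitType.close :=
  Checks.hasType (l := [entry diagFst diagFstType, entry diagSnd diagSndType, entry addLimit
      addLimitType, entry addLimitSelf addLimitSelfType, entry multiple multipleType, entry
      mulIncr mulIncrType])
    (by decide +kernel)
    ((((((TypeTable.nil.cons hasType_mulIncr).cons hasType_multiple).cons
      hasType_addLimitSelf).cons hasType_addLimit).cons hasType_diagSnd).cons hasType_diagFst)

theorem hasType_mulLeMulLimit : HasType [] mulLeMulLimit.close mulLeMulLimitType.close :=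
  Checks.hasType (l := [entry diagFst diagFstType, entry diagSnd diagSndType, entry addLimit
      addLimitType, entry addLimitSelf addLimitSelfType, entry multiple multipleType, entry
      mulIncr mulIncrType])
    (by decide +kernel)
    ((((((TypeTable.nil.cons hasType_mulIncr).cons hasType_multiple).cons
      hasType_addLimitSelf).cons hasType_addLimit).cons hasType_diagSnd).cons hasType_diagFst)

theorem hasType_mulLimitLe : HasType [] mulLimitLe.close mulLimitLeType.close :=
  Checks.hasType (l := [entry diagFst diagFstType, entry diagSnd diagSndType, entry addLimit
      addLimitType, entry addLimitSelf addLimitSelfType, entry multiple multipleType, entry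
      mulIncr mulIncrType])
    (by decide +kernel)
    ((((((TypeTable.nil.cons hasType_mulIncr).cons hasType_multiple).cons
      hasType_addLimitSelf).cons hasType_addLimit).cons hasType_diagSnd).cons hasType_diagFst)

theorem hasType_allZeroDecOfMultiple :
    HasType [] allZeroDecOfMultiple.close allZeroDecOfMultipleType.close :=
  Checks.hasType (l := [entry addLimit addLimitType, entry addLimitSelf addLimitSelfType, entry
      addNatIncr addNatIncrType, entry addNatLeSuc addNatLeSucType, entry addNatSelf
      addNatSelfType, entry addNatLeLimit addNatLeLimitType, entry addLimitLe addLimitLeType,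
      entry allZeroDecOfHeight allZeroDecOfHeightType])
    (by decide +kernel)
    ((((((((TypeTable.nil.cons hasType_allZeroDecOfHeight).cons hasType_addLimitLe).cons
      hasType_addNatLeLimit).cons hasType_addNatSelf).cons hasType_addNatLeSuc).cons
      hasType_addNatIncr).cons hasType_addLimitSelf).cons hasType_addLimit)

theorem hasType_allZeroDecMulLimit :
    HasType [] allZeroDecMulLimit.close allZeroDecMulLimitType.close :=
  Checks.hasType (l := [entry diagFst diagFstType, entry diagSnd diagSndType, entry addLimit
      addLimitType, entry addLimitSelf addLimitSelfType, entry multiple multipleType, entry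
      mulLimit mulLimitType, entry mulLeMulLimit mulLeMulLimitType, entry mulLimitLe
      mulLimitLeType, entry toMulSucc toMulSuccType, entry mulZeroLe mulZeroLeType, entry
      allZeroDecOfMultiple allZeroDecOfMultipleType])
    (by decide +kernel)
    (((((((((((TypeTable.nil.cons hasType_allZeroDecOfMultiple).cons hasType_mulZeroLe).cons
      hasType_toMulSucc).cons hasType_mulLimitLe).cons hasType_mulLeMulLimit).cons
      hasType_mulLimit).cons hasType_multiple).cons hasType_addLimitSelf).cons
      hasType_addLimit).cons hasType_diagSnd).cons hasType_diagFst)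


/-! ## Propositions, sets and extensionality -/

/-- The inverse of `p` composed with `p` is trivial. -/
def symmTrans (i : ℕ) : Exp :=
  lam (U i) fun A => lam A fun x => lam A fun y => lam (Id i A x y) fun p =>
  cst (.idInd i i) A
    (lam A fun x => lam A fun y => lam (Id i A x y) fun p =>
      Id i (Id i A y y) (trans i A y x y (symm i A x y p) p) (refl i A y))
    (lam A fun x => refl i (Id i A x x) (refl i A x)) x y p

def symmTransType (i : ℕ) : Exp :=
  pi (U i) fun A => pi A fun x => pi A fun y => pi (Id i A x y) fun p =>
  Id i (Id i A y y) (trans i A y x y (symm i A x y p) p) (refl i A y)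

/-- A family `G` of endomaps of the identity types of `A` that are constant up to identity. -/
def constTele (i : ℕ) (q : Exp → (Exp → Exp) → Exp) (body : Exp → Exp → Exp → Exp) : Exp :=
  q (U i) fun A =>
  q (pi A fun x => pi A fun y => Id i A x y ⟶ₜ Id i A x y) fun G =>
  q (pi A fun x => pi A fun y => pi (Id i A x y) fun p => pi (Id i A x y) fun p' =>
    Id i (Id i A x y) (G x y p) (G x y p')) fun const => body A G const

def isSetOfConstId (i : ℕ) : Exp :=
  constTele i lam fun A G const =>
  lam (pi A fun x => pi A fun y => pi (Id i A x y) fun p => Id i (Id i A x y) (G x y p) p) fun eq =>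
  lam A fun x => lam A fun y => lam (Id i A x y) fun p => lam (Id i A x y) fun p' =>
  trans i (Id i A x y) p (G x y p) p' (symm i (Id i A x y) (G x y p) p (eq x y p))
    (trans i (Id i A x y) (G x y p) (G x y p') p' (const x y p p') (eq x y p'))

def isSetOfConstIdType (i : ℕ) : Exp :=
  constTele i pi fun A G _ =>
  (pi A fun x => pi A fun y => pi (Id i A x y) fun p => Id i (Id i A x y) (G x y p) p) ⟶ₜ isSet i A

/-- A type with constant endomaps on its identity types is a set. -/
def isSetOfConst (i : ℕ) : Exp :=
  constTele i lam fun A G const =>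
  let L := fun x => symm i A x x (G x x (refl i A x))
  let N := fun x y p => trans i A x x y (L x) (G x y p)
  isSetOfConstId i A
    (lam A fun x => lam A fun y => lam (Id i A x y) fun p => N x y p)
    (lam A fun x => lam A fun y => lam (Id i A x y) fun p => lam (Id i A x y) fun p' =>
      subst i i (Id i A x y) (fun g => Id i (Id i A x y) (N x y p) (trans i A x x y (L x) g))
        (G x y p) (G x y p') (const x y p p') (refl i (Id i A x y) (N x y p)))
    (lam A fun x => lam A fun y => lam (Id i A x y) fun p => cst (.idInd i i) A
      (lam A fun x => lam A fun y => lam (Id i A x y) fun p => Id i (Id i A x y) (N x y p) p)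
      (lam A fun x => symmTrans i A x x (G x x (refl i A x))) x y p)

def isSetOfConstType (i : ℕ) : Exp := constTele i pi fun A _ _ => isSet i A

def symmTrans₀ : Exp := symmTrans 0
def symmTrans₀Type : Exp := symmTransType 0
def isSetOfConstId₀ : Exp := isSetOfConstId 0
def isSetOfConstId₀Type : Exp := isSetOfConstIdType 0
def symmTrans₁ : Exp := symmTrans 1
def symmTrans₁Type : Exp := symmTransType 1
def isSetOfConstId₁ : Exp := isSetOfConstId 1
def isSetOfConstId₁Type : Exp := isSetOfConstIdType 1
def isSetOfConst₀ : Exp := isSetOfConst 0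
def isSetOfConst₀Type : Exp := isSetOfConstType 0
def isSetOfConst₁ : Exp := isSetOfConst 1
def isSetOfConst₁Type : Exp := isSetOfConstType 1

/-- A map with a left and a right inverse has an inverse. -/
def inverse (i : ℕ) : Exp :=
  lam (U i) fun A => lam (U i) fun B => lam (A ⟶ₜ B) fun f => lam (isEquiv i A B f) fun e =>
  proj₁ i (B ⟶ₜ A) (fun g => pi A fun x => Id i A (g (f x)) x)
    (proj₁ i (Sig i (B ⟶ₜ A) (lam (B ⟶ₜ A) fun g => pi A fun x => Id i A (g (f x)) x))
      (fun _ => Sig i (B ⟶ₜ A) (lam (B ⟶ₜ A) fun h => pi B fun y => Id i B (f (h y)) y)) e)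

def inverseType (i : ℕ) : Exp :=
  pi (U i) fun A => pi (U i) fun B => pi (A ⟶ₜ B) fun f => isEquiv i A B f ⟶ₜ B ⟶ₜ A

def inverse₀ : Exp := inverse 0
def inverse₀Type : Exp := inverseType 0
def inverse₁ : Exp := inverse 1
def inverse₁Type : Exp := inverseType 1

/-- Pointwise equal functions are equal. -/
def funExt (i : ℕ) : Exp :=
  lam (U i) fun A => lam (A ⟶ₜ U i) fun B =>
  lam (pi A fun x => B x) fun f => lam (pi A fun x => B x) fun g =>
  inverse i (Id i (pi A fun x => B x) f g) (pi A fun x => Id i (B x) (f x) (g x))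
    (happly i A B f g) (cst (.funext i) A B f g)

def funExtType (i : ℕ) : Exp :=
  pi (U i) fun A => pi (A ⟶ₜ U i) fun B =>
  pi (pi A fun x => B x) fun f => pi (pi A fun x => B x) fun g =>
  (pi A fun x => Id i (B x) (f x) (g x)) ⟶ₜ Id i (pi A fun x => B x) f g

def funExt₀ : Exp := funExt 0
def funExt₀Type : Exp := funExtType 0
def funExt₁ : Exp := funExt 1
def funExt₁Type : Exp := funExtType 1

def isPropPi : Exp :=
  lam (U 0) fun A => lam (A ⟶ₜ U 0) fun B => lam (pi A fun x => isProp 0 (B x)) fun h =>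
  lam (pi A fun x => B x) fun f => lam (pi A fun x => B x) fun g =>
  funExt₀ A B f g (lam A fun x => h x (f x) (g x))

def isPropPiType : Exp :=
  pi (U 0) fun A => pi (A ⟶ₜ U 0) fun B => (pi A fun x => isProp 0 (B x)) ⟶ₜ
  isProp 0 (pi A fun x => B x)

def isSetOfIsProp : Exp :=
  lam (U 0) fun A => lam (isProp 0 A) fun h =>
  isSetOfConst₀ A (lam A fun x => lam A fun y => lam (Id 0 A x y) fun _ => h x y)
    (lam A fun x => lam A fun y => lam (Id 0 A x y) fun _ => lam (Id 0 A x y) fun _ =>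
      refl 0 (Id 0 A x y) (h x y))

def isSetOfIsPropType : Exp := pi (U 0) fun A => isProp 0 A ⟶ₜ isSet 0 A

def isPropIsProp : Exp :=
  lam (U 0) fun A => lam (isProp 0 A) fun h =>
  isPropPi A (lam A fun x => pi A fun y => Id 0 A x y)
    (lam A fun x => isPropPi A (lam A fun y => Id 0 A x y) (lam A fun y => isSetOfIsProp A h x y))
    h

def isPropIsPropType : Exp := pi (U 0) fun A => isProp 0 (isProp 0 A)

/-- Logically equivalent propositions are equivalent. -/
def equivOfIff : Exp :=
  lam (U 0) fun A => lam (U 0) fun B => lam (isProp 0 A) fun hA => lam (isProp 0 B) fun hB =>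
  lam (A ⟶ₜ B) fun f => lam (B ⟶ₜ A) fun g =>
  let left := Sig 0 (B ⟶ₜ A) (lam (B ⟶ₜ A) fun g => pi A fun x => Id 0 A (g (f x)) x)
  let right := Sig 0 (B ⟶ₜ A) (lam (B ⟶ₜ A) fun h => pi B fun y => Id 0 B (f (h y)) y)
  mkPair 0 (A ⟶ₜ B) (fun f => isEquiv 0 A B f) f
    (mkPair 0 left (fun _ => right)
      (mkPair 0 (B ⟶ₜ A) (fun g => pi A fun x => Id 0 A (g (f x)) x) g
        (lam A fun x => hA (g (f x)) x))
      (mkPair 0 (B ⟶ₜ A) (fun h => pi B fun y => Id 0 B (f (h y)) y) g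
        (lam B fun y => hB (f (g y)) y)))

def equivOfIffType : Exp :=
  pi (U 0) fun A => pi (U 0) fun B => isProp 0 A ⟶ₜ isProp 0 B ⟶ₜ
  (A ⟶ₜ B) ⟶ₜ (B ⟶ₜ A) ⟶ₜ Equiv 0 A B

/-- Propositional extensionality for propositions given as types. -/
def idOfIff : Exp :=
  lam (U 0) fun A => lam (U 0) fun B => lam (isProp 0 A) fun hA => lam (isProp 0 B) fun hB =>
  lam (A ⟶ₜ B) fun f => lam (B ⟶ₜ A) fun g =>
  inverse₁ (Id 1 (U 0) A B) (Equiv 0 A B) (idToEquiv 0 A B) (cst (.univalence 0) A B)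
    (equivOfIff A B hA hB f g)

def idOfIffType : Exp :=
  pi (U 0) fun A => pi (U 0) fun B => isProp 0 A ⟶ₜ isProp 0 B ⟶ₜ
  (A ⟶ₜ B) ⟶ₜ (B ⟶ₜ A) ⟶ₜ Id 1 (U 0) A B

/-- The type of propositions. -/
def HProp : Exp := Sig 1 (U 0) (lam (U 0) fun A => isProp 0 A)

def hPair (A h : Exp) : Exp := mkPair 1 (U 0) (fun A => isProp 0 A) A h

def hFst (P : Exp) : Exp := proj₁ 1 (U 0) (fun A => isProp 0 A) P

def hPairEq : Exp :=
  lam (U 0) fun A => lam (U 0) fun B => lam (Id 1 (U 0) A B) fun p =>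
  cst (.idInd 1 1) (U 0)
    (lam (U 0) fun A => lam (U 0) fun B => lam (Id 1 (U 0) A B) fun _ =>
      pi (isProp 0 A) fun a => pi (isProp 0 B) fun b => Id 1 HProp (hPair A a) (hPair B b))
    (lam (U 0) fun A => lam (isProp 0 A) fun a => lam (isProp 0 A) fun b =>
      subst 0 1 (isProp 0 A) (fun b => Id 1 HProp (hPair A a) (hPair A b)) a b
        (isPropIsProp A a b) (refl 1 HProp (hPair A a)))
    A B p

def hPairEqType : Exp :=
  pi (U 0) fun A => pi (U 0) fun B => Id 1 (U 0) A B ⟶ₜ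
  pi (isProp 0 A) fun a => pi (isProp 0 B) fun b => Id 1 HProp (hPair A a) (hPair B b)

def hExt : Exp :=
  lam HProp fun P => sigElim 1 1 (U 0) (fun A => isProp 0 A)
    (fun P => pi HProp fun Q => (hFst P ⟶ₜ hFst Q) ⟶ₜ (hFst Q ⟶ₜ hFst P) ⟶ₜ Id 1 HProp P Q)
    (fun A a => lam HProp fun Q => sigElim 1 1 (U 0) (fun A => isProp 0 A)
      (fun Q => (A ⟶ₜ hFst Q) ⟶ₜ (hFst Q ⟶ₜ A) ⟶ₜ Id 1 HProp (hPair A a) Q)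
      (fun B b => lam (A ⟶ₜ B) fun f => lam (B ⟶ₜ A) fun g =>
        hPairEq A B (idOfIff A B a b f g) a b) Q) P

def hExtType : Exp :=
  pi HProp fun P => pi HProp fun Q => (hFst P ⟶ₜ hFst Q) ⟶ₜ (hFst Q ⟶ₜ hFst P) ⟶ₜ Id 1 HProp P Q

/-! ## Predicates on pairs of natural numbers -/

section Telescopes

variable (q : Exp → (Exp → Exp) → Exp)

/-- A universe `H` of propositions. -/
def propTele (body : Exp → Exp → Exp → Exp → Exp → Exp → Exp → Exp) : Exp :=
  q (U 1) fun H => q (H ⟶ₜ U 0) fun El =>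
  q (pi H fun P => isProp 0 (El P)) fun prop =>
  q (pi H fun P => pi H fun Q => (El P ⟶ₜ El Q) ⟶ₜ (El Q ⟶ₜ El P) ⟶ₜ Id 1 H P Q) fun ext =>
  q (pi (U 0) fun A => isProp 0 A ⟶ₜ H) fun mk =>
  q (pi (U 0) fun A => pi (isProp 0 A) fun h => A ⟶ₜ El (mk A h)) fun into =>
  q (pi (U 0) fun A => pi (isProp 0 A) fun h => El (mk A h) ⟶ₜ A) fun out =>
  body H El prop ext mk into out

/-- Predicates on pairs of natural numbers. -/
def Pred (H : Exp) : Exp := Nat ⟶ₜ Nat ⟶ₜ H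

/-- Inclusion of predicates. -/
def incl (El D E : Exp) : Exp := pi Nat fun i => pi Nat fun j => El (D i j) ⟶ₜ El (E i j)

/-- Operations on predicates that correspond to the constructors of ordinals, where an ordinal `x`
corresponds to the predicate `ω · i + j < x`. -/
def opTele (H El : Exp)
    (body : Exp → Exp → Exp → Exp → Exp → Exp → Exp → Exp → Exp → Exp → Exp → Exp) : Exp :=
  let D := Pred H
  q D fun mz => q (D ⟶ₜ D) fun ms => q ((Nat ⟶ₜ D) ⟶ₜ D) fun ml =>
  q (pi Nat fun i => pi Nat fun j => El (mz i j) ⟶ₜ Empty) fun zero_out =>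
  q (pi D fun D => El (ms D zero zero)) fun suc_zero =>
  q (pi D fun D => pi Nat fun i => (pi Nat fun j => El (D i j)) ⟶ₜ El (ms D (succ i) zero))
    fun row_in =>
  q (pi D fun D => pi Nat fun i => El (ms D (succ i) zero) ⟶ₜ pi Nat fun j => El (D i j))
    fun row_out =>
  q (pi D fun D => pi Nat fun i => pi Nat fun j => El (D i j) ⟶ₜ El (ms D i (succ j)))
    fun col_in =>
  q (pi D fun D => pi Nat fun i => pi Nat fun j => El (ms D i (succ j)) ⟶ₜ El (D i j))
    fun col_out =>
  q (pi (Nat ⟶ₜ D) fun f => pi Nat fun n => incl El (f n) (ml f)) fun lim_in =>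
  q (pi (Nat ⟶ₜ D) fun f => pi Nat fun i => pi Nat fun j =>
    El (ml f i j) ⟶ₜ ex 0 Nat fun n => El (f n i j)) fun lim_out =>
  body mz ms ml zero_out suc_zero row_in row_out col_in col_out lim_in lim_out

end Telescopes

def propSystem : Exp :=
  lam (U 0) fun C => lam (propTele pi fun _ _ _ _ _ _ _ => C) fun k =>
  k HProp (lam HProp hFst) (lam HProp fun P => proj₂ 1 (U 0) (fun A => isProp 0 A) P) hExt
    (lam (U 0) fun A => lam (isProp 0 A) fun h => hPair A h)
    (lam (U 0) fun A => lam (isProp 0 A) fun _ => lam A fun a => a)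
    (lam (U 0) fun A => lam (isProp 0 A) fun _ => lam A fun a => a)

def propSystemType : Exp := pi (U 0) fun C => (propTele pi fun _ _ _ _ _ _ _ => C) ⟶ₜ C

def isPropUnit : Exp :=
  cst (.unitInd 0) (lam Unit fun x => pi Unit fun y => Id 0 Unit x y)
    (cst (.unitInd 0) (lam Unit fun y => Id 0 Unit (cst .star) y) (refl 0 Unit (cst .star)))

def isPropUnitType : Exp := isProp 0 Unit

def opSystem : Exp :=
  propTele lam fun H El prop _ mk into out =>
  lam (U 0) fun C => lam (opTele pi H El fun _ _ _ _ _ _ _ _ _ _ _ => C) fun k =>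
  let D := Pred H
  let row := fun D i => pi Nat fun j => El (D i j)
  let rowProp := fun D i => isPropPi Nat (lam Nat fun j => El (D i j))
    (lam Nat fun j => prop (D i j))
  let union := fun f i j => ex 0 Nat fun n => El (f n i j)
  let unionProp := fun f i j => cst (.squash 0) (Sig 0 Nat (lam Nat fun n => El (f n i j)))
  k (lam Nat fun _ => lam Nat fun _ => mk Empty isPropEmpty)
    (lam D fun D => lam Nat fun i => lam Nat fun j => natRec 1 (fun _ => H)
      (natRec 1 (fun _ => H) (mk Unit isPropUnit) (fun i _ => mk (row D i) (rowProp D i)) i)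
      (fun j _ => D i j) j)
    (lam (Nat ⟶ₜ D) fun f => lam Nat fun i => lam Nat fun j => mk (union f i j) (unionProp f i j))
    (lam Nat fun _ => lam Nat fun _ => out Empty isPropEmpty)
    (lam D fun _ => into Unit isPropUnit (cst .star))
    (lam D fun D => lam Nat fun i => into (row D i) (rowProp D i))
    (lam D fun D => lam Nat fun i => out (row D i) (rowProp D i))
    (lam D fun D => lam Nat fun i => lam Nat fun j => lam (El (D i j)) fun e => e)
    (lam D fun D => lam Nat fun i => lam Nat fun j => lam (El (D i j)) fun e => e)
    (lam (Nat ⟶ₜ D) fun f => lam Nat fun n => lam Nat fun i => lam Nat fun j =>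
      lam (El (f n i j)) fun e => into (union f i j) (unionProp f i j)
        (exIntro 0 Nat (fun n => El (f n i j)) n e))
    (lam (Nat ⟶ₜ D) fun f => lam Nat fun i => lam Nat fun j =>
      out (union f i j) (unionProp f i j))

def opSystemType : Exp :=
  propTele pi fun H El _ _ _ _ _ => pi (U 0) fun C =>
  (opTele pi H El fun _ _ _ _ _ _ _ _ _ _ _ => C) ⟶ₜ C

/-! ## Recursion into a partially ordered set -/

section Telescopes

variable (q : Exp → (Exp → Exp) → Exp)

/-- A partially ordered set with operations that correspond to the constructors of ordinals. -/
def posetTele (body : Exp → Exp → Exp → Exp → Exp → Exp → Exp → Exp → Exp → Exp → Exp → Exp →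
    Exp → Exp → Exp) : Exp :=
  q (U 1) fun D => q (D ⟶ₜ D ⟶ₜ U 0) fun R =>
  q (isSet 1 D) fun isS => q (pi D fun x => pi D fun y => isProp 0 (R x y)) fun isP =>
  q (pi D fun x => R x x) fun le_refl =>
  q (pi D fun x => pi D fun y => pi D fun z => R x y ⟶ₜ R y z ⟶ₜ R x z) fun le_trans =>
  q (pi D fun x => pi D fun y => R x y ⟶ₜ R y x ⟶ₜ Id 1 D x y) fun antisymm =>
  q D fun mz => q (D ⟶ₜ D) fun ms => q ((Nat ⟶ₜ D) ⟶ₜ D) fun ml =>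
  q (pi D fun x => R mz x) fun zero_le =>
  q (pi D fun x => pi D fun y => R x y ⟶ₜ R (ms x) (ms y)) fun suc_le =>
  q (pi (Nat ⟶ₜ D) fun f => pi D fun x => pi Nat fun k => R x (f k) ⟶ₜ R x (ml f)) fun le_lim =>
  q (pi (Nat ⟶ₜ D) fun f => pi D fun x => (pi Nat fun k => R (f k) x) ⟶ₜ R (ml f) x) fun lim_le =>
  body D R isS isP le_refl le_trans antisymm mz ms ml zero_le suc_le le_lim lim_le

/-- A monotone map `Φ` from ordinals to `D` that commutes with the operations. -/
def morphismTele (D R mz ms ml : Exp) (body : Exp → Exp → Exp → Exp → Exp → Exp → Exp) : Exp :=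
  q (Brw ⟶ₜ D) fun Φ =>
  q (pi Brw fun x => pi Brw fun y => Le x y ⟶ₜ R (Φ x) (Φ y)) fun mono =>
  q (R (Φ bzero) mz) fun zero_le =>
  q (pi Brw fun x => R (Φ (bsuc x)) (ms (Φ x))) fun suc_le =>
  q (pi Brw fun x => R (ms (Φ x)) (Φ (bsuc x))) fun le_suc =>
  q (pi (Nat ⟶ₜ Brw) fun f => pi (incr f) fun p =>
    R (Φ (blim f p)) (ml (lam Nat fun n => Φ (f n)))) fun lim_le =>
  body Φ mono zero_le suc_le le_suc lim_le

end Telescopes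

/-- Transport in a constant family. -/
def transportConst : Exp :=
  lam (U 1) fun D => lam Brw fun x => lam Brw fun y => lam (Id 0 Brw x y) fun p =>
  cst (.idInd 0 1) Brw
    (lam Brw fun x => lam Brw fun y => lam (Id 0 Brw x y) fun p => pi D fun v =>
      Id 1 D (transport 0 1 Brw (lam Brw fun _ => D) x y p v) v)
    (lam Brw fun _ => lam D fun v => refl 1 D v) x y p

def transportConstType : Exp :=
  pi (U 1) fun D => pi Brw fun x => pi Brw fun y => pi (Id 0 Brw x y) fun p => pi D fun v =>
  Id 1 D (transport 0 1 Brw (lam Brw fun _ => D) x y p v) v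

/-- The sequences `f` and `g` in `D` simulate each other, and so do the sequences `a` and `b` of
ordinals. -/
def bisimulates (R a b f g : Exp) : Exp :=
  pi Nat fun k => ex 1 Nat fun n =>
    Sig 1 (Le (a k) (b n)) (lam (Le (a k) (b n)) fun _ => R (f k) (g n))

def limLeLim : Exp :=
  posetTele lam fun D R _ isP _ _ _ _ _ ml _ _ le_lim lim_le =>
  lam (Nat ⟶ₜ Brw) fun a => lam (Nat ⟶ₜ Brw) fun b =>
  lam (Nat ⟶ₜ D) fun f => lam (Nat ⟶ₜ D) fun g => lam (bisimulates R a b f g) fun h =>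
  lim_le f (ml g) (lam Nat fun k =>
    exElim 1 0 Nat (fun n => Sig 1 (Le (a k) (b n)) (lam (Le (a k) (b n)) fun _ => R (f k) (g n)))
      (R (f k) (ml g)) (isP (f k) (ml g))
      (fun n w => le_lim g (f k) n (proj₂ 1 (Le (a k) (b n)) (fun _ => R (f k) (g n)) w)) (h k))

def limLeLimType : Exp :=
  posetTele pi fun D R _ _ _ _ _ _ _ ml _ _ _ _ =>
  pi (Nat ⟶ₜ Brw) fun a => pi (Nat ⟶ₜ Brw) fun b =>
  pi (Nat ⟶ₜ D) fun f => pi (Nat ⟶ₜ D) fun g => bisimulates R a b f g ⟶ₜ R (ml f) (ml g)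

/-- Limits of bisimilar sequences are equal. -/
def limEqLim : Exp :=
  posetTele lam fun D R isS isP le_refl le_trans antisymm mz ms ml zero_le suc_le le_lim lim_le =>
  lam Brw fun x => lam Brw fun y => lam (Id 0 Brw x y) fun p =>
  lam (Nat ⟶ₜ Brw) fun a => lam (Nat ⟶ₜ Brw) fun b =>
  lam (Nat ⟶ₜ D) fun f => lam (Nat ⟶ₜ D) fun g =>
  lam (bisimulates R a b f g) fun h => lam (bisimulates R b a g f) fun h' =>
  let le := limLeLim D R isS isP le_refl le_trans antisymm mz ms ml zero_le suc_le le_lim lim_le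
  trans 1 D (transport 0 1 Brw (lam Brw fun _ => D) x y p (ml f)) (ml f) (ml g)
    (transportConst D x y p (ml f)) (antisymm (ml f) (ml g) (le a b f g h) (le b a g f h'))

def limEqLimType : Exp :=
  posetTele pi fun D R _ _ _ _ _ _ _ ml _ _ _ _ =>
  pi Brw fun x => pi Brw fun y => pi (Id 0 Brw x y) fun p =>
  pi (Nat ⟶ₜ Brw) fun a => pi (Nat ⟶ₜ Brw) fun b =>
  pi (Nat ⟶ₜ D) fun f => pi (Nat ⟶ₜ D) fun g =>
  bisimulates R a b f g ⟶ₜ bisimulates R b a g f ⟶ₜ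
  Id 1 D (transport 0 1 Brw (lam Brw fun _ => D) x y p (ml f)) (ml g)

section Telescopes

variable (q : Exp → (Exp → Exp) → Exp)

/-- A section `Φ` of the family `A` that respects the order and commutes with the methods. -/
def sectionTele (A R mz ms ml : Exp) (body : Exp → Exp → Exp → Exp → Exp → Exp) : Exp :=
  q (pi Brw fun x => A x) fun Φ =>
  q (pi Brw fun x => pi Brw fun y => pi (Le x y) fun e => R x y (Φ x) (Φ y) e) fun mono =>
  q (pi (A bzero ⟶ₜ U 0) fun P => P mz ⟶ₜ P (Φ bzero)) fun to_zero =>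
  q (pi Brw fun x => pi (A (bsuc x) ⟶ₜ U 0) fun P => P (ms x (Φ x)) ⟶ₜ P (Φ (bsuc x))) fun to_suc =>
  q (pi (Nat ⟶ₜ Brw) fun f => pi (incr f) fun p => pi (A (blim f p) ⟶ₜ U 0) fun P =>
    (pi (pi Nat fun n => R (bsuc (f n)) (f (succ n)) (ms (f n) (Φ (f n))) (Φ (f (succ n))) (p n))
      fun p' => P (ml f p (lam Nat fun n => Φ (f n)) p')) ⟶ₜ P (Φ (blim f p))) fun to_lim =>
  body Φ mono to_zero to_suc to_lim

end Telescopes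

/-- Induction on ordinals, with propositional computation rules. -/
def sectionSystem : Exp :=
  brwTele lam 1 fun A R mz ms ml ind => lam (U 0) fun C =>
  lam (sectionTele pi A R mz ms ml fun _ _ _ _ _ => C) fun k =>
  k (ind (.brwInd 1)) (ind (.leInd 1))
    (lam (A bzero ⟶ₜ U 0) fun P => lam (P mz) fun u => u)
    (lam Brw fun x => lam (A (bsuc x) ⟶ₜ U 0) fun P =>
      lam (P (ms x (ind (.brwInd 1) x))) fun u => u)
    (lam (Nat ⟶ₜ Brw) fun f => lam (incr f) fun p => lam (A (blim f p) ⟶ₜ U 0) fun P =>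
      lam (pi (pi Nat fun n => R (bsuc (f n)) (f (succ n)) (ms (f n) (ind (.brwInd 1) (f n)))
          (ind (.brwInd 1) (f (succ n))) (p n))
        fun p' => P (ml f p (lam Nat fun n => ind (.brwInd 1) (f n)) p')) fun u =>
      u (lam Nat fun n => ind (.leInd 1) (bsuc (f n)) (f (succ n)) (p n)))

def sectionSystemType : Exp :=
  brwTele pi 1 fun A R mz ms ml _ => pi (U 0) fun C =>
  (sectionTele pi A R mz ms ml fun _ _ _ _ _ => C) ⟶ₜ C

/-- The recursion principle: there is a monotone map that commutes with the operations. -/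
def recursion : Exp :=
  posetTele lam fun D R isS isP le_refl le_trans antisymm mz ms ml zero_le suc_le le_lim lim_le =>
  lam (U 0) fun C => lam (morphismTele pi D R mz ms ml fun _ _ _ _ _ _ => C) fun k =>
  let seqRel := fun f' => pi Nat fun n => R (ms (f' n)) (f' (succ n))
  sectionSystem
    (lam Brw fun _ => D)
    (lam Brw fun x => lam Brw fun y => lam D fun a => lam D fun b => lam (Le x y) fun _ => R a b)
    (lam Brw fun _ => isS)
    (lam Brw fun x => lam Brw fun y => lam D fun a => lam D fun b => lam (Le x y) fun _ =>
      lam (R a b) fun e => lam (R a b) fun e' => idLift 0 1 (R a b) e e' (isP a b e e'))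
    mz
    (lam Brw fun _ => lam D fun a => ms a)
    (lam (Nat ⟶ₜ Brw) fun f => lam (incr f) fun _ => lam (Nat ⟶ₜ D) fun f' =>
      lam (seqRel f') fun _ => ml f')
    (lam (Nat ⟶ₜ Brw) fun f => lam (incr f) fun p => lam (Nat ⟶ₜ D) fun f' =>
      lam (seqRel f') fun _ =>
      lam (Nat ⟶ₜ Brw) fun g => lam (incr g) fun r => lam (Nat ⟶ₜ D) fun g' =>
      lam (seqRel g') fun _ => lam (sim f g) fun u => lam (sim g f) fun v =>
      limEqLim D R isS isP le_refl le_trans antisymm mz ms ml zero_le suc_le le_lim lim_le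
        (blim f p) (blim g r) (cst .bisim f p g r u v) f g f' g')
    (lam Brw fun _ => zero_le)
    (lam Brw fun x => lam Brw fun y => lam Brw fun z => lam D fun a => lam D fun b => lam D fun c =>
      lam (Le x y) fun _ => lam (Le y z) fun _ => le_trans a b c)
    (lam Brw fun x => lam Brw fun y => lam D fun a => lam D fun b => lam (Le x y) fun _ =>
      suc_le a b)
    (lam (Nat ⟶ₜ Brw) fun f => lam (incr f) fun _ => lam (Nat ⟶ₜ D) fun f' =>
      lam (seqRel f') fun _ => lam Brw fun x => lam D fun a => lam Nat fun k =>
      lam (Le x (f k)) fun _ => le_lim f' a k)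
    (lam (Nat ⟶ₜ Brw) fun f => lam (incr f) fun _ => lam (Nat ⟶ₜ D) fun f' =>
      lam (seqRel f') fun _ => lam Brw fun x => lam D fun a => lam (pi Nat fun k => Le (f k) x)
      fun _ => lim_le f' a)
    C
    (lam (Brw ⟶ₜ D) fun Φ =>
      lam (pi Brw fun x => pi Brw fun y => Le x y ⟶ₜ R (Φ x) (Φ y)) fun mono =>
      lam (pi (D ⟶ₜ U 0) fun P => P mz ⟶ₜ P (Φ bzero)) fun to_zero =>
      lam (pi Brw fun x => pi (D ⟶ₜ U 0) fun P => P (ms (Φ x)) ⟶ₜ P (Φ (bsuc x))) fun to_suc =>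
      lam (pi (Nat ⟶ₜ Brw) fun f => pi (incr f) fun p => pi (D ⟶ₜ U 0) fun P =>
        (seqRel (lam Nat fun n => Φ (f n)) ⟶ₜ P (ml (lam Nat fun n => Φ (f n)))) ⟶ₜ
        P (Φ (blim f p))) fun to_lim =>
      k Φ mono (to_zero (lam D fun v => R v mz) (le_refl mz))
        (lam Brw fun x => to_suc x (lam D fun v => R v (ms (Φ x))) (le_refl (ms (Φ x))))
        (lam Brw fun x => to_suc x (lam D fun v => R (ms (Φ x)) v) (le_refl (ms (Φ x))))
        (lam (Nat ⟶ₜ Brw) fun f => lam (incr f) fun p =>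
          let v := ml (lam Nat fun n => Φ (f n))
          to_lim f p (lam D fun u => R u v)
            (lam (seqRel (lam Nat fun n => Φ (f n))) fun _ => le_refl v)))

def recursionType : Exp :=
  posetTele pi fun D R _ _ _ _ _ mz ms ml _ _ _ _ => pi (U 0) fun C =>
  (morphismTele pi D R mz ms ml fun _ _ _ _ _ _ => C) ⟶ₜ C

/-! ## The height function -/

def inclIsProp : Exp :=
  propTele lam fun H El prop _ _ _ _ => lam (Pred H) fun D => lam (Pred H) fun E =>
  isPropPi Nat (lam Nat fun i => pi Nat fun j => El (D i j) ⟶ₜ El (E i j)) (lam Nat fun i =>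
    isPropPi Nat (lam Nat fun j => El (D i j) ⟶ₜ El (E i j)) (lam Nat fun j =>
      isPropPi (El (D i j)) (lam (El (D i j)) fun _ => El (E i j)) (lam (El (D i j)) fun _ =>
        prop (E i j))))

def inclIsPropType : Exp :=
  propTele pi fun H El _ _ _ _ _ => pi (Pred H) fun D => pi (Pred H) fun E =>
  isProp 0 (incl El D E)

def inclAntisymm : Exp :=
  propTele lam fun H El _ ext _ _ _ => lam (Pred H) fun D => lam (Pred H) fun E =>
  lam (incl El D E) fun e => lam (incl El E D) fun e' =>
  funExt₁ Nat (lam Nat fun _ => Nat ⟶ₜ H) D E (lam Nat fun i =>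
    funExt₁ Nat (lam Nat fun _ => H) (D i) (E i) (lam Nat fun j =>
      ext (D i j) (E i j) (e i j) (e' i j)))

def inclAntisymmType : Exp :=
  propTele pi fun H El _ _ _ _ _ => pi (Pred H) fun D => pi (Pred H) fun E =>
  incl El D E ⟶ₜ incl El E D ⟶ₜ Id 1 (Pred H) D E

/-- A type with an antisymmetric reflexive proposition-valued relation is a set. -/
def isSetOfAntisymm : Exp :=
  lam (U 1) fun D => lam (D ⟶ₜ D ⟶ₜ U 0) fun R =>
  lam (pi D fun x => pi D fun y => isProp 0 (R x y)) fun isP =>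
  lam (pi D fun x => R x x) fun le_refl =>
  lam (pi D fun x => pi D fun y => R x y ⟶ₜ R y x ⟶ₜ Id 1 D x y) fun antisymm =>
  let forth := fun x y p => subst 1 0 D (fun z => R x z) x y p (le_refl x)
  let back := fun x y p => subst 1 0 D (fun z => R z x) x y p (le_refl x)
  isSetOfConst₁ D
    (lam D fun x => lam D fun y => lam (Id 1 D x y) fun p =>
      antisymm x y (forth x y p) (back x y p))
    (lam D fun x => lam D fun y => lam (Id 1 D x y) fun p => lam (Id 1 D x y) fun p' =>
      let T := Id 1 D x y
      let a := antisymm x y (forth x y p) (back x y p)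
      subst 0 1 (R y x) (fun e => Id 1 T a (antisymm x y (forth x y p') e))
        (back x y p) (back x y p')
        (isP y x (back x y p) (back x y p'))
        (subst 0 1 (R x y) (fun e => Id 1 T a (antisymm x y e (back x y p)))
          (forth x y p) (forth x y p')
          (isP x y (forth x y p) (forth x y p')) (refl 1 T a)))

def isSetOfAntisymmType : Exp :=
  pi (U 1) fun D => pi (D ⟶ₜ D ⟶ₜ U 0) fun R =>
  (pi D fun x => pi D fun y => isProp 0 (R x y)) ⟶ₜ (pi D fun x => R x x) ⟶ₜ
  (pi D fun x => pi D fun y => R x y ⟶ₜ R y x ⟶ₜ Id 1 D x y) ⟶ₜ isSet 1 D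

def inclSuc : Exp :=
  propTele lam fun H El _ _ _ _ _ =>
  opTele lam H El fun _ ms _ _ suc_zero row_in row_out col_in col_out _ _ =>
  lam (Pred H) fun D => lam (Pred H) fun E => lam (incl El D E) fun e =>
  lam Nat fun i => lam Nat fun j =>
  natRec 0 (fun j => El (ms D i j) ⟶ₜ El (ms E i j))
    (natRec 0 (fun i => El (ms D i zero) ⟶ₜ El (ms E i zero))
      (lam (El (ms D zero zero)) fun _ => suc_zero E)
      (fun i _ => lam (El (ms D (succ i) zero)) fun h =>
        row_in E i (lam Nat fun j => e i j (row_out D i h j))) i)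
    (fun j _ => lam (El (ms D i (succ j))) fun h => col_in E i j (e i j (col_out D i j h))) j

def inclSucType : Exp :=
  propTele pi fun H El _ _ _ _ _ => opTele pi H El fun _ ms _ _ _ _ _ _ _ _ _ =>
  pi (Pred H) fun D => pi (Pred H) fun E => incl El D E ⟶ₜ incl El (ms D) (ms E)

def limIncl : Exp :=
  propTele lam fun H El prop _ _ _ _ =>
  opTele lam H El fun _ _ ml _ _ _ _ _ _ _ lim_out =>
  lam (Nat ⟶ₜ Pred H) fun f => lam (Pred H) fun E => lam (pi Nat fun k => incl El (f k) E) fun e =>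
  lam Nat fun i => lam Nat fun j => lam (El (ml f i j)) fun h =>
  exElim 0 0 Nat (fun n => El (f n i j)) (El (E i j)) (prop (E i j)) (fun n h => e n i j h)
    (lim_out f i j h)

def limInclType : Exp :=
  propTele pi fun H El _ _ _ _ _ => opTele pi H El fun _ _ ml _ _ _ _ _ _ _ _ =>
  pi (Nat ⟶ₜ Pred H) fun f => pi (Pred H) fun E =>
  (pi Nat fun k => incl El (f k) E) ⟶ₜ incl El (ml f) E

/-- A monotone map into predicates is a height function. -/
def heightOfMorphism : Exp :=
  propTele lam fun H El prop _ _ _ _ =>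
  opTele lam H El fun mz ms ml zero_out suc_zero row_in row_out col_in col_out _ lim_out =>
  lam (U 0) fun C => lam (heightTele pi fun _ _ _ _ _ _ _ _ _ _ => C) fun k =>
  morphismTele lam (Pred H) (lam (Pred H) fun D => lam (Pred H) fun E => incl El D E) mz ms ml
    fun Φ mono zero_le suc_le le_suc lim_le =>
  k (lam Brw fun x => lam Nat fun i => lam Nat fun j => El (Φ x i j))
    (lam Brw fun x => lam Nat fun i => lam Nat fun j => prop (Φ x i j))
    mono
    (lam Nat fun i => lam Nat fun j => lam (El (Φ bzero i j)) fun h =>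
      zero_out i j (zero_le i j h))
    (lam Brw fun x => le_suc x zero zero (suc_zero (Φ x)))
    (lam Brw fun x => lam Nat fun i => lam (pi Nat fun j => El (Φ x i j)) fun h =>
      le_suc x (succ i) zero (row_in (Φ x) i h))
    (lam Brw fun x => lam Nat fun i => lam Nat fun j => lam (El (Φ x i j)) fun h =>
      le_suc x i (succ j) (col_in (Φ x) i j h))
    (lam Brw fun x => lam Nat fun i => lam (El (Φ (bsuc x) (succ i) zero)) fun h =>
      row_out (Φ x) i (suc_le x (succ i) zero h))
    (lam Brw fun x => lam Nat fun i => lam Nat fun j => lam (El (Φ (bsuc x) i (succ j))) fun h =>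
      col_out (Φ x) i j (suc_le x i (succ j) h))
    (lam (Nat ⟶ₜ Brw) fun f => lam (incr f) fun p => lam Nat fun i => lam Nat fun j =>
      lam (El (Φ (blim f p) i j)) fun h =>
      lim_out (lam Nat fun n => Φ (f n)) i j (lim_le f p i j h))

def heightOfMorphismType : Exp :=
  propTele pi fun H El _ _ _ _ _ => opTele pi H El fun mz ms ml _ _ _ _ _ _ _ _ =>
  pi (U 0) fun C => (heightTele pi fun _ _ _ _ _ _ _ _ _ _ => C) ⟶ₜ
  morphismTele pi (Pred H) (lam (Pred H) fun D => lam (Pred H) fun E => incl El D E) mz ms ml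
    fun _ _ _ _ _ _ => C

/-- The height function exists. -/
def heightSystem : Exp :=
  lam (U 0) fun C => lam (heightTele pi fun _ _ _ _ _ _ _ _ _ _ => C) fun k =>
  propSystem C (propTele lam fun H El prop ext mk into out =>
  opSystem H El prop ext mk into out C
    (opTele lam H El fun mz ms ml zero_out suc_zero row_in row_out col_in col_out lim_in lim_out =>
    let D := Pred H
    let R := lam D fun D => lam (Pred H) fun E => incl El D E
    let isP := inclIsProp H El prop ext mk into out
    let le_refl := lam D fun D => lam Nat fun i => lam Nat fun j => lam (El (D i j)) fun e => e
    let antisymm := inclAntisymm H El prop ext mk into out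
    recursion D R (isSetOfAntisymm D R isP le_refl antisymm) isP le_refl
      (lam D fun D => lam (Pred H) fun E => lam (Pred H) fun F => lam (incl El D E) fun e =>
        lam (incl El E F) fun e' => lam Nat fun i => lam Nat fun j => lam (El (D i j)) fun h =>
        e' i j (e i j h))
      antisymm mz ms ml
      (lam D fun D => lam Nat fun i => lam Nat fun j => lam (El (mz i j)) fun h =>
        emptyElim 0 (El (D i j)) (zero_out i j h))
      (inclSuc H El prop ext mk into out
        mz ms ml zero_out suc_zero row_in row_out col_in col_out lim_in lim_out)
      (lam (Nat ⟶ₜ D) fun f => lam D fun D => lam Nat fun k => lam (incl El D (f k)) fun e =>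
        lam Nat fun i => lam Nat fun j => lam (El (D i j)) fun h => lim_in f k i j (e i j h))
      (limIncl H El prop ext mk into out
        mz ms ml zero_out suc_zero row_in row_out col_in col_out lim_in lim_out)
      C
      (heightOfMorphism H El prop ext mk into out
        mz ms ml zero_out suc_zero row_in row_out col_in col_out lim_in lim_out C k)))

def heightSystemType : Exp :=
  pi (U 0) fun C => (heightTele pi fun _ _ _ _ _ _ _ _ _ _ => C) ⟶ₜ C


/-! ## Typing of the height function -/

theorem hasType_symmTrans₀ : HasType [] symmTrans₀.close symmTrans₀Type.close :=
  Checks.hasType (l := [])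
    (by decide +kernel)
    TypeTable.nil

theorem hasType_isSetOfConstId₀ : HasType [] isSetOfConstId₀.close isSetOfConstId₀Type.close :=
  Checks.hasType (l := [])
    (by decide +kernel)
    TypeTable.nil

theorem hasType_isSetOfConst₀ : HasType [] isSetOfConst₀.close isSetOfConst₀Type.close :=
  Checks.hasType (l := [entry symmTrans₀ symmTrans₀Type, entry isSetOfConstId₀
      isSetOfConstId₀Type])
    (by decide +kernel)
    ((TypeTable.nil.cons hasType_isSetOfConstId₀).cons hasType_symmTrans₀)

theorem hasType_symmTrans₁ : HasType [] symmTrans₁.close symmTrans₁Type.close :=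
  Checks.hasType (l := [])
    (by decide +kernel)
    TypeTable.nil

theorem hasType_isSetOfConstId₁ : HasType [] isSetOfConstId₁.close isSetOfConstId₁Type.close :=
  Checks.hasType (l := [])
    (by decide +kernel)
    TypeTable.nil

theorem hasType_isSetOfConst₁ : HasType [] isSetOfConst₁.close isSetOfConst₁Type.close :=
  Checks.hasType (l := [entry symmTrans₁ symmTrans₁Type, entry isSetOfConstId₁
      isSetOfConstId₁Type])
    (by decide +kernel)
    ((TypeTable.nil.cons hasType_isSetOfConstId₁).cons hasType_symmTrans₁)

theorem hasType_inverse₀ : HasType [] inverse₀.close inverse₀Type.close :=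
  Checks.hasType (l := [])
    (by decide +kernel)
    TypeTable.nil

theorem hasType_inverse₁ : HasType [] inverse₁.close inverse₁Type.close :=
  Checks.hasType (l := [])
    (by decide +kernel)
    TypeTable.nil

theorem hasType_funExt₀ : HasType [] funExt₀.close funExt₀Type.close :=
  Checks.hasType (l := [entry inverse₀ inverse₀Type])
    (by decide +kernel)
    (TypeTable.nil.cons hasType_inverse₀)

theorem hasType_funExt₁ : HasType [] funExt₁.close funExt₁Type.close :=
  Checks.hasType (l := [entry inverse₁ inverse₁Type])
    (by decide +kernel)
    (TypeTable.nil.cons hasType_inverse₁)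

theorem hasType_isPropPi : HasType [] isPropPi.close isPropPiType.close :=
  Checks.hasType (l := [entry funExt₀ funExt₀Type])
    (by decide +kernel)
    (TypeTable.nil.cons hasType_funExt₀)

theorem hasType_isSetOfIsProp : HasType [] isSetOfIsProp.close isSetOfIsPropType.close :=
  Checks.hasType (l := [entry isSetOfConst₀ isSetOfConst₀Type])
    (by decide +kernel)
    (TypeTable.nil.cons hasType_isSetOfConst₀)

theorem hasType_isPropIsProp : HasType [] isPropIsProp.close isPropIsPropType.close :=
  Checks.hasType (l := [entry isPropPi isPropPiType, entry isSetOfIsProp isSetOfIsPropType])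
    (by decide +kernel)
    ((TypeTable.nil.cons hasType_isSetOfIsProp).cons hasType_isPropPi)

theorem hasType_equivOfIff : HasType [] equivOfIff.close equivOfIffType.close :=
  Checks.hasType (l := [])
    (by decide +kernel)
    TypeTable.nil

theorem hasType_idOfIff : HasType [] idOfIff.close idOfIffType.close :=
  Checks.hasType (l := [entry inverse₁ inverse₁Type, entry equivOfIff equivOfIffType])
    (by decide +kernel)
    ((TypeTable.nil.cons hasType_equivOfIff).cons hasType_inverse₁)

theorem hasType_hPairEq : HasType [] hPairEq.close hPairEqType.close :=
  Checks.hasType (l := [entry isPropIsProp isPropIsPropType])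
    (by decide +kernel)
    (TypeTable.nil.cons hasType_isPropIsProp)

theorem hasType_hExt : HasType [] hExt.close hExtType.close :=
  Checks.hasType (l := [entry hPairEq hPairEqType, entry idOfIff idOfIffType])
    (by decide +kernel)
    ((TypeTable.nil.cons hasType_idOfIff).cons hasType_hPairEq)

theorem hasType_propSystem : HasType [] propSystem.close propSystemType.close :=
  Checks.hasType (l := [entry hExt hExtType])
    (by decide +kernel)
    (TypeTable.nil.cons hasType_hExt)

theorem hasType_isPropUnit : HasType [] isPropUnit.close isPropUnitType.close :=
  Checks.hasType (l := [])
    (by decide +kernel)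
    TypeTable.nil

theorem hasType_opSystem : HasType [] opSystem.close opSystemType.close :=
  Checks.hasType (l := [entry isPropPi isPropPiType, entry isPropUnit isPropUnitType])
    (by decide +kernel)
    ((TypeTable.nil.cons hasType_isPropUnit).cons hasType_isPropPi)

theorem hasType_transportConst : HasType [] transportConst.close transportConstType.close :=
  Checks.hasType (l := [])
    (by decide +kernel)
    TypeTable.nil

theorem hasType_limLeLim : HasType [] limLeLim.close limLeLimType.close :=
  Checks.hasType (l := [])
    (by decide +kernel)
    TypeTable.nil

theorem hasType_limEqLim : HasType [] limEqLim.close limEqLimType.close :=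
  Checks.hasType (l := [entry limLeLim limLeLimType, entry transportConst transportConstType])
    (by decide +kernel)
    ((TypeTable.nil.cons hasType_transportConst).cons hasType_limLeLim)

theorem hasType_sectionSystem : HasType [] sectionSystem.close sectionSystemType.close :=
  Checks.hasType (l := [])
    (by decide +kernel)
    TypeTable.nil

theorem hasType_recursion : HasType [] recursion.close recursionType.close :=
  Checks.hasType (l := [entry limEqLim limEqLimType, entry sectionSystem sectionSystemType])
    (by decide +kernel)
    ((TypeTable.nil.cons hasType_sectionSystem).cons hasType_limEqLim)

theorem hasType_inclIsProp : HasType [] inclIsProp.close inclIsPropType.close :=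
  Checks.hasType (l := [entry isPropPi isPropPiType])
    (by decide +kernel)
    (TypeTable.nil.cons hasType_isPropPi)

theorem hasType_inclAntisymm : HasType [] inclAntisymm.close inclAntisymmType.close :=
  Checks.hasType (l := [entry funExt₁ funExt₁Type])
    (by decide +kernel)
    (TypeTable.nil.cons hasType_funExt₁)

theorem hasType_isSetOfAntisymm : HasType [] isSetOfAntisymm.close isSetOfAntisymmType.close :=
  Checks.hasType (l := [entry isSetOfConst₁ isSetOfConst₁Type])
    (by decide +kernel)
    (TypeTable.nil.cons hasType_isSetOfConst₁)

theorem hasType_inclSuc : HasType [] inclSuc.close inclSucType.close :=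
  Checks.hasType (l := [])
    (by decide +kernel)
    TypeTable.nil

theorem hasType_limIncl : HasType [] limIncl.close limInclType.close :=
  Checks.hasType (l := [])
    (by decide +kernel)
    TypeTable.nil

theorem hasType_heightOfMorphism : HasType [] heightOfMorphism.close heightOfMorphismType.close :=
  Checks.hasType (l := [])
    (by decide +kernel)
    TypeTable.nil

theorem hasType_heightSystem : HasType [] heightSystem.close heightSystemType.close :=
  Checks.hasType (l := [entry propSystem propSystemType, entry opSystem opSystemType, entry
      recursion recursionType, entry isSetOfAntisymm isSetOfAntisymmType, entry inclAntisymm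
      inclAntisymmType, entry inclIsProp inclIsPropType, entry inclSuc inclSucType, entry
      limIncl limInclType, entry heightOfMorphism heightOfMorphismType])
    (by decide +kernel)
    (((((((((TypeTable.nil.cons hasType_heightOfMorphism).cons hasType_limIncl).cons
      hasType_inclSuc).cons hasType_inclIsProp).cons hasType_inclAntisymm).cons
      hasType_isSetOfAntisymm).cons hasType_recursion).cons hasType_opSystem).cons
      hasType_propSystem)


/-! ## The theorem -/

/-- The conclusion from the collapse, where `α` is an ordinal that detects constant sequences. -/
def lpoOfCollapse (i : ℕ) : Exp :=
  lam Brw fun α => lam (semidecAt α ⟶ₜ MP ⟶ₜ LPO) fun h => lam (collapseAt i α) fun c =>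
  h (semidecOfCollapse i α c)

def lpoOfCollapseType (i : ℕ) : Exp :=
  pi Brw fun α => (semidecAt α ⟶ₜ MP ⟶ₜ LPO) ⟶ₜ collapseAt i α ⟶ₜ MP ⟶ₜ LPO

theorem hasType_lpoOfCollapse (i : ℕ) :
    HasType [] (lpoOfCollapse i).close (lpoOfCollapseType i).close :=
  match i with
  | 0 => Checks.hasType (l := []) (by decide +kernel) .nil
  | 1 => Checks.hasType (l := []) (by decide +kernel) .nil
  | m + 2 => Checks.jeqAt (l := []) (t := lpoOfCollapse 2) (A := lpoOfCollapseType 2) (m := m)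
      (by decide +kernel) .nil

theorem jeq_mulLimit_omegaSq : JEq [] mulLimit.close omegaSq.close Brw.close :=
  jeqAt_zero.1 (Unfolds.jeqAt
    (l := [entry diagFst diagFstType, entry diagSnd diagSndType, entry addLimit addLimitType,
      entry addLimitSelf addLimitSelfType, entry multiple multipleType,
      entry sucLeLimit sucLeLimitType, entry mulIncr mulIncrType])
    (D := [entry addLimit addLimitType, entry addLimitSelf addLimitSelfType,
      entry sucLeLimit sucLeLimitType])
    (by decide +kernel)
    (((((((TypeTable.nil.cons hasType_mulIncr).cons hasType_sucLeLimit).cons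
      hasType_multiple).cons hasType_addLimitSelf).cons hasType_addLimit).cons
      hasType_diagSnd).cons hasType_diagFst)
    (((TypeTable.nil.cons hasType_sucLeLimit).cons hasType_addLimitSelf).cons hasType_addLimit))

theorem hasType_omegaSq : HasType [] omegaSq.close Brw.close :=
  jeq_mulLimit_omegaSq.right

theorem hasType_lam_allZeroDec : HasType [] (lam Brw allZeroDec).close (Brw ⟶ₜ U 0).close :=
  Checks.hasType (l := []) (by decide +kernel) .nil

theorem jeq_allZeroDec :
    JEq [] (allZeroDec mulLimit).close (allZeroDec omegaSq).close (U 0).close := by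
  have h := hasType_lam_allZeroDec
  have hm : JEq [] _ (allZeroDec mulLimit).close (U 0).close := JEq.beta h hasType_mulLimit
  have ho : JEq [] _ (allZeroDec omegaSq).close (U 0).close := JEq.beta h hasType_omegaSq
  exact (hm.symm.trans (JEq.app h jeq_mulLimit_omegaSq)).trans ho

/-- A decision procedure showing that being constantly `0` is `ω²`-decidable. -/
def allZeroDecOmegaSq : Exp := heightSystem (allZeroDec mulLimit) allZeroDecMulLimit

theorem hasType_allZeroDecOmegaSq :
    HasType [] allZeroDecOmegaSq.close (allZeroDec omegaSq).close := by
  have hs : HasType [] (heightSystem (allZeroDec mulLimit)).close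
      (allZeroDecMulLimitType ⟶ₜ allZeroDec mulLimit).close :=
    JEq.app hasType_heightSystem jeq_allZeroDec.left
  exact JEq.conv (JEq.app hs hasType_allZeroDecMulLimit) jeq_allZeroDec

theorem hasType_lpoOfSemidec_omegaSq :
    HasType [] (lpoOfSemidec omegaSq allZeroDecOmegaSq).close
      (semidecAt omegaSq ⟶ₜ MP ⟶ₜ LPO).close := by
  have h : HasType [] (lpoOfSemidec omegaSq).close
      (allZeroDec omegaSq ⟶ₜ semidecAt omegaSq ⟶ₜ MP ⟶ₜ LPO).close :=
    JEq.app hasType_lpoOfSemidec hasType_omegaSq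
  exact JEq.app h hasType_allZeroDecOmegaSq

theorem provable_collapse_imp (i : ℕ) : Provable (collapse i ⟶ₜ MP ⟶ₜ LPO) := by
  have h : HasType [] (lpoOfCollapse i omegaSq).close
      ((semidecAt omegaSq ⟶ₜ MP ⟶ₜ LPO) ⟶ₜ collapse i ⟶ₜ MP ⟶ₜ LPO).close :=
    JEq.app (hasType_lpoOfCollapse i) hasType_omegaSq
  exact ⟨(lpoOfCollapse i omegaSq (lpoOfSemidec omegaSq allZeroDecOmegaSq)).close,
    JEq.app h hasType_lpoOfSemidec_omegaSq⟩

end HoTT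

open HoTT in
theorem theorem8p4 :
    (∀ i : ℕ, Provable (collapse i ⟶ₜ MP ⟶ₜ LPO)) ∧
    (∀ (i j : ℕ) (T : Set Tm), IsTheory T →
      (CC j).close ∈ T → MP.close ∈ T → LPO.close ∉ T →
        (collapse i).close ∉ T ∧ ¬ Provable (CC j ⟶ₜ collapse i)) := by
  refine ⟨provable_collapse_imp, fun i j T hT hCC hMP hLPO => ?_⟩
  have hcollapse : (collapse i).close ∉ T := fun hc => hLPO <|
    hT.mp _ _ (hT.mp _ (MP ⟶ₜ LPO).close (hT.of_provable _ (provable_collapse_imp i)) hc) hMP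
  exact ⟨hcollapse, fun h => hcollapse (hT.mp _ _ (hT.of_provable _ h) hCC)⟩
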